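/- Let $G$ be a connected undirected multigraph (parallel edges and loops allowed) with $n\ge 1$ vertices and $m$ edges, and let $w\colon E(G)\to\mathbb R$ be arbitrary real edge weights. A set $S\subseteq E(G)$ is a forcing set (resp. an anti-forcing set) for minimum weight spanning trees of $(G,w)$ if there is exactly one minimum weight spanning tree $T$ of $(G,w)$ with $S\subseteq E(T)$ (resp. with $S\cap E(T)=\varnothing$). For a real number $c$ let $G_c$ be the multigraph obtained from $G$ by contracting all edges of weight less than $c$ (keeping the parallel edges and loops that arise) and then deleting all edges of weight greater than $c$; thus $E(G_c)=\{e\in E(G): w(e)=c\}$. (1) For each of the two problems "forcing" and "anti-forcing" there are a single random access machine program and a constant $C$ such that for every $(G,w)$ as above, with the edges given as a list of pairs of end vertices in any order, and every $k\in\mathbb N$, the program halts after at most $C\,(m\log n+1)$ steps (hence in $O(m\log n)$ time whenever $n\ge 2$, since then $m\ge1$), outputs a forcing (resp. anti-forcing) set $S$ for minimum weight spanning trees of $(G,w)$ of minimum cardinality, and decides correctly whether there is such a set of cardinality at most $k$. Here the machine works at unit cost on words whose values are bounded by a polynomial in $n+m+k+2$ and accesses the weights only through unit-cost comparisons of the weights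 of two edges. Moreover, $S$ has the form described in (2). (2) For each weight $c$ choose an arbitrary maximal forest $F_c$ of $G_c$. Then the set of all edges $e\in F_{w(e)}$ that are not bridges of $G_{w(e)}$ is a forcing set of minimum cardinality, and the set of all edges $e\notin F_{w(e)}$ that are not loops of $G_{w(e)}$ is an anti-forcing set of minimum cardinality, for minimum weight spanning trees of $(G,w)$. -/

import Mathlib

open scoped Graph

namespace ForcingMST

/-! ## Forcing and anti-forcing sets for a property -/

section Forcing

variable {β : Type*}

/-- `X` is the unique member of the property `P` that contains `S`. -/
def IsForcingSetFor (P : Set (Finset β)) (X S : Finset β) : Prop :=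
  X ∈ P ∧ S ⊆ X ∧ ∀ X' ∈ P, X' ≠ X → ¬ S ⊆ X'

/-- `X` is the unique member of the property `P` that is disjoint from `S`. -/
def IsAntiForcingSetFor (P : Set (Finset β)) (X S : Finset β) : Prop :=
  X ∈ P ∧ Disjoint S X ∧ ∀ X' ∈ P, X' ≠ X → ¬ Disjoint S X'

def IsForcingSet (P : Set (Finset β)) (S : Finset β) : Prop :=
  ∃ X, IsForcingSetFor P X S

def IsAntiForcingSet (P : Set (Finset β)) (S : Finset β) : Prop :=
  ∃ X, IsAntiForcingSetFor P X S

/-- `S` has minimum cardinality among the sets satisfying `Q`. -/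
def IsMinimumSet (Q : Finset β → Prop) (S : Finset β) : Prop :=
  Q S ∧ ∀ S', Q S' → S.card ≤ S'.card

end Forcing

/-! ## Multigraphs: connectivity, forests, minimum weight spanning trees

Multigraphs are Mathlib's `Graph α β`, in which parallel edges and loops are allowed. For a set
`F` of edges, `G.restrict F` is the graph with the vertices of `G` and the edges of `G` in `F`. -/

section Multigraph

variable {α β : Type*}

/-- `l` is the sequence of edges of a walk of `G` from the first to the last vertex argument. -/
def IsWalk (G : Graph α β) : α → List β → α → Prop
  | x, [], y => x ∈ V(G) ∧ x = y
  | x, e :: l, y => ∃ z, G.IsLink e x z ∧ IsWalk G z l y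

def Reachable (G : Graph α β) (x y : α) : Prop :=
  ∃ l, IsWalk G x l y

def Connected (G : Graph α β) : Prop :=
  V(G).Nonempty ∧ ∀ x ∈ V(G), ∀ y ∈ V(G), Reachable G x y

/-- `G` has no closed trail of positive length, that is, no cycle.
A loop is a cycle of length one and two parallel edges form a cycle of length two. -/
def Acyclic (G : Graph α β) : Prop :=
  ∀ x l, l ≠ [] → l.Nodup → ¬ IsWalk G x l x

/-- `T` is the edge set of a spanning tree of `G`. -/
def IsSpanningTree (G : Graph α β) (T : Finset β) : Prop :=
  (T : Set β) ⊆ E(G) ∧ Connected (G.restrict T) ∧ Acyclic (G.restrict T)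

/-- The property of being (the edge set of) a minimum weight spanning tree of `(G, w)`. -/
def minSpanningTrees (G : Graph α β) (w : β → ℝ) : Set (Finset β) :=
  {T | IsSpanningTree G T ∧ ∀ T', IsSpanningTree G T' → ∑ e ∈ T, w e ≤ ∑ e ∈ T', w e}

/-! ## The two weight-class procedures -/

/-- Contraction of the edges in `X`: the vertices of the new graph are the classes of vertices
that are connected through `X`; parallel edges and loops that arise are kept. -/
def contract (G : Graph α β) (X : Set β) : Graph (Set α) β :=
  (G.map fun x ↦ {y | Reachable (G.restrict X) x y}).deleteEdges X

/-- The graph that is treated when the weight `c` is processed: all edges of smaller weight have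
been contracted, and only the edges of weight exactly `c` are present. -/
def weightClass (G : Graph α β) (w : β → ℝ) (c : ℝ) : Graph (Set α) β :=
  (contract G {e | w e < c}).restrict {e | w e = c}

def IsMaximalForest (H : Graph α β) (F : Finset β) : Prop :=
  Maximal (fun X : Finset β ↦ (X : Set β) ⊆ E(H) ∧ Acyclic (H.restrict X)) F

def IsLoop (H : Graph α β) (e : β) : Prop :=
  ∃ x, H.IsLoopAt e x

def IsBridge (H : Graph α β) (e : β) : Prop :=
  ∃ x y, H.IsLink e x y ∧ ¬ Reachable (H.deleteEdges {e}) x y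

/-- `S` is a possible outcome of the procedure which selects a maximal forest in each weight
class and outputs the selected edges that are not bridges of the graph of their class. -/
def IsForcingOutcome (G : Graph α β) (w : β → ℝ) (S : Finset β) : Prop :=
  ∃ F : ℝ → Finset β, (∀ c, IsMaximalForest (weightClass G w c) (F c)) ∧
    ∀ e, e ∈ S ↔ e ∈ E(G) ∧ e ∈ F (w e) ∧ ¬ IsBridge (weightClass G w (w e)) e

/-- `S` is a possible outcome of the procedure which selects a maximal forest in each weight
class and outputs the edges that are neither selected nor loops of the graph of their class. -/
def IsAntiForcingOutcome (G : Graph α β) (w : β → ℝ) (S : Finset β) : Prop :=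
  ∃ F : ℝ → Finset β, (∀ c, IsMaximalForest (weightClass G w c) (F c)) ∧
    ∀ e, e ∈ S ↔ e ∈ E(G) ∧ e ∉ F (w e) ∧ ¬ IsLoop (weightClass G w (w e)) e

end Multigraph

/-! ## The machine model

A random access machine with unit-cost operations on bounded words, which can access the real
edge weights only by comparing the weights of two edges. Its memory consists of registers and
arrays (a program names finitely many of both) whose cells hold natural numbers; its programs are
built from instructions by sequencing, branching and looping. Executing an instruction or
evaluating a test takes one step, and a result that exceeds the word bound is not allowed. -/

structure State where
  reg : ℕ → ℕ
  arr : ℕ → ℕ → ℕ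

inductive Instr where
  | const (x c : ℕ)
  | copy (x y : ℕ)
  | add (x y z : ℕ)
  | sub (x y z : ℕ)
  | mul (x y z : ℕ)
  | div (x y z : ℕ)
  | load (x a y : ℕ)
  | store (a x y : ℕ)

/-- The value that an instruction computes and writes. -/
def Instr.value : Instr → State → ℕ
  | .const _ c, _ => c
  | .copy _ y, σ => σ.reg y
  | .add _ y z, σ => σ.reg y + σ.reg z
  | .sub _ y z, σ => σ.reg y - σ.reg z
  | .mul _ y z, σ => σ.reg y * σ.reg z
  | .div _ y z, σ => σ.reg y / σ.reg z
  | .load _ a y, σ => σ.arr a (σ.reg y)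
  | .store _ _ y, σ => σ.reg y

def State.setReg (σ : State) (x v : ℕ) : State :=
  { σ with reg := Function.update σ.reg x v }

def State.setArr (σ : State) (a i v : ℕ) : State :=
  { σ with arr := Function.update σ.arr a (Function.update (σ.arr a) i v) }

/-- `store a x y` writes register `y` into the cell of array `a` whose index is in register `x`;
every other instruction writes its value into the register that is its first argument. -/
def Instr.run : Instr → State → State
  | .const x c, σ => σ.setReg x ((Instr.const x c).value σ)
  | .copy x y, σ => σ.setReg x ((Instr.copy x y).value σ)
  | .add x y z, σ => σ.setReg x ((Instr.add x y z).value σ)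
  | .sub x y z, σ => σ.setReg x ((Instr.sub x y z).value σ)
  | .mul x y z, σ => σ.setReg x ((Instr.mul x y z).value σ)
  | .div x y z, σ => σ.setReg x ((Instr.div x y z).value σ)
  | .load x a y, σ => σ.setReg x ((Instr.load x a y).value σ)
  | .store a x y, σ => σ.setArr a (σ.reg x) ((Instr.store a x y).value σ)

inductive Test where
  | lt (x y : ℕ)
  | eq (x y : ℕ)
  | ne (x y : ℕ)
  | weightLt (x y : ℕ)

/-- `weightLt x y` compares the weights of the edges whose indices are in registers `x` and `y`. -/
def Test.Holds {m : ℕ} (w : Fin m → ℝ) (σ : State) : Test → Prop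
  | .lt x y => σ.reg x < σ.reg y
  | .eq x y => σ.reg x = σ.reg y
  | .ne x y => σ.reg x ≠ σ.reg y
  | .weightLt x y =>
    ∃ (hx : σ.reg x < m) (hy : σ.reg y < m), w ⟨σ.reg x, hx⟩ < w ⟨σ.reg y, hy⟩

inductive Program where
  | instr (i : Instr)
  | seq (p q : Program)
  | ite (b : Test) (p q : Program)
  | loop (b : Test) (p : Program)

/-- `Exec w B P σ t τ`: on a machine with edge weights `w` and word bound `B`, the program `P`,
started in the state `σ`, halts after exactly `t` steps in the state `τ`.
Here `loop b p` repeats `p` as long as `b` holds. -/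
inductive Exec {m : ℕ} (w : Fin m → ℝ) (B : ℕ) : Program → State → ℕ → State → Prop where
  | instr {i : Instr} {σ : State} (h : i.value σ ≤ B) : Exec w B (.instr i) σ 1 (i.run σ)
  | seq {p q : Program} {σ τ ρ : State} {s t : ℕ} (hp : Exec w B p σ s τ) (hq : Exec w B q τ t ρ) :
      Exec w B (.seq p q) σ (s + t) ρ
  | iteTrue {b : Test} {p q : Program} {σ τ : State} {t : ℕ} (hb : b.Holds w σ)
      (hp : Exec w B p σ t τ) : Exec w B (.ite b p q) σ (1 + t) τ
  | iteFalse {b : Test} {p q : Program} {σ τ : State} {t : ℕ} (hb : ¬ b.Holds w σ)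
      (hq : Exec w B q σ t τ) : Exec w B (.ite b p q) σ (1 + t) τ
  | loopTrue {b : Test} {p : Program} {σ τ ρ : State} {s t : ℕ} (hb : b.Holds w σ)
      (hp : Exec w B p σ s τ) (hl : Exec w B (.loop b p) τ t ρ) :
      Exec w B (.loop b p) σ (1 + s + t) ρ
  | loopFalse {b : Test} {p : Program} {σ : State} (hb : ¬ b.Holds w σ) :
      Exec w B (.loop b p) σ 1 σ

/-- The initial state: registers 0, 1, 2 hold `n`, `m`, `k`, arrays 0 and 1 hold the two ends of
each edge, and all other cells are zero. -/
def inputState {n m : ℕ} (u v : Fin m → Fin n) (k : ℕ) : State where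
  reg := fun i ↦ if i = 0 then n else if i = 1 then m else if i = 2 then k else 0
  arr := fun a i ↦ if h : i < m then
    (if a = 0 then (u ⟨i, h⟩ : ℕ) else if a = 1 then (v ⟨i, h⟩ : ℕ) else 0) else 0

/-- The edge set that is marked by nonzero entries in array 2. -/
def State.edgeOutput (σ : State) (m : ℕ) : Finset (Fin m) :=
  {e | σ.arr 2 e ≠ 0}

/-- There is one program which, for every connected multigraph `G` with vertices `0, …, n - 1` and
edges `0, …, m - 1`, given by the lists `u`, `v` of the ends of the edges in any order, all real
edge weights `w` and every `k`, halts after at most `C (T n m + 1)` steps, for a constant `C` and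
with all words bounded by a polynomial in the input parameters. The output is a set of edges of
minimum cardinality among the solutions, which is a possible outcome of the given procedure, and
the answer (register 0) to the question whether there is a solution of cardinality at most `k`. -/
def SolvableInTime
    (Solution Outcome :
      ∀ {n m : ℕ}, Graph (Fin n) (Fin m) → (Fin m → ℝ) → Finset (Fin m) → Prop)
    (T : ℕ → ℕ → ℝ) : Prop :=
  ∃ (P : Program) (C D : ℕ), ∀ (n m : ℕ) (G : Graph (Fin n) (Fin m)) (u v : Fin m → Fin n)
    (w : Fin m → ℝ) (k : ℕ),
    V(G) = Set.univ → E(G) = Set.univ → (∀ e, G.IsLink e (u e) (v e)) → Connected G →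
    ∃ (t : ℕ) (σ : State),
      Exec w ((n + m + k + 2) ^ D) P (inputState u v k) t σ ∧
      (t : ℝ) ≤ C * (T n m + 1) ∧
      IsMinimumSet (Solution G w) (σ.edgeOutput m) ∧
      Outcome G w (σ.edgeOutput m) ∧
      (σ.reg 0 = 1 ↔ ∃ S, Solution G w S ∧ S.card ≤ k)

end ForcingMST

open ForcingMST

/-! Let `e` be an edge with ends `x`, `y`. It lies in some minimum weight spanning tree iff `x` and
`y` are not connected through edges lighter than `e`, and in all of them iff `x` and `y` are not
connected through the other edges of weight at most `w e`. Both come from two exchanges: a tree edge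
can be replaced by an edge of any given connection of its ends
(`IsSpanningTree.exists_exchange_in`), and a nontree edge whose ends are not connected through `A`
can replace a tree edge outside `A` (`IsSpanningTree.exists_exchange_out`).

Fix a minimum weight spanning tree `T`. Its edges that do not lie in all such trees form a forcing
set, because all spanning trees have the same size. A set `S'` that forces a tree `X` contains every
edge of `X` that does not lie in all trees, for otherwise an exchange produces a second tree that
contains `S'`; the number of these edges does not depend on `X`. Dually, a set that anti-forces `X`
contains every edge outside `X` that lies in some minimum weight spanning tree. In the graph of the
weight class of `e`, lying in some tree means not being a loop, and lying in all trees means being a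
bridge. The union of maximal forests of the classes is a minimum weight spanning tree, and this
proves the correctness of the two procedures for every choice of the forests.

The program avoids explicit contractions. It runs one Prim search, with ties broken in favour of the
latest tail, and lets `te p` be the edge through which position `p` is reached. Two facts carry the
rest. (a) Vertices at positions `i ≤ j` are connected through edges lighter than `c` iff all `te q`
with `i < q ≤ j` are lighter than `c` (`reachIn_lt_iff`). The vertices of a contracted graph are
therefore intervals of positions, and the interval of `j` starts at its top position, the last `q ≤
j` for which `te q` has weight at least `c`. An edge `f` is a loop of its class iff the top position
of its later end for the weight `w f` is not after its earlier end. Top positions are found by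
binary search in a monotone stack. (b) The tie-breaking makes the search depth first inside each
contracted class. So a tree edge is not a bridge iff another edge of its class leads from its
subtree to a position before it (`reachIn_iff_exists_covers`). This is decided by low points, which
are propagated from children to parents in decreasing order of positions.

The priority queue of the search is a tournament tree. Each of the `2 * m` half-edges causes at most
one update of it and one binary search, each in logarithmic time, and connectedness gives `n ≤ m +
1`. -/

namespace ForcingMST

/-! ### Walks, trails and reachability through a set of edges. -/

section Walks

variable {α β : Type*} {G H : Graph α β} {x y z a b : α} {e f : β} {A A' : Set β} {l l₁ l₂ : List β}

theorem IsWalk.left_mem (h : IsWalk H x l y) : x ∈ V(H) := by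
  cases l with
  | nil => exact h.1
  | cons e l => obtain ⟨z, hz, -⟩ := h; exact hz.left_mem

theorem IsWalk.append : ∀ {l₁ : List β} {x : α}, IsWalk H x l₁ y → IsWalk H y l₂ z →
    IsWalk H x (l₁ ++ l₂) z
  | [], _, h, h' => by obtain ⟨-, rfl⟩ := h; exact h'
  | _ :: _, _, ⟨u, hu, h⟩, h' => ⟨u, hu, h.append h'⟩

theorem IsWalk.split : ∀ {l₁ : List β} {x : α}, IsWalk H x (l₁ ++ e :: l₂) y →
    ∃ a b, H.IsLink e a b ∧ IsWalk H x l₁ a ∧ IsWalk H b l₂ y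
  | [], x, ⟨u, hu, h⟩ => ⟨x, u, hu, ⟨hu.left_mem, rfl⟩, h⟩
  | _ :: _, _, ⟨u, hu, h⟩ => by
    obtain ⟨a, b, hab, h₁, h₂⟩ := IsWalk.split h
    exact ⟨a, b, hab, ⟨u, hu, h₁⟩, h₂⟩

theorem isWalk_restrict : ∀ {l : List β} {x : α},
    IsWalk (G.restrict A) x l y ↔ IsWalk G x l y ∧ ∀ e ∈ l, e ∈ A
  | [], x => by simp [IsWalk]
  | e :: l, x => by
    simp only [IsWalk, isWalk_restrict (l := l), Graph.restrict_isLink, List.mem_cons, forall_eq_or_imp]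
    constructor
    · rintro ⟨z, ⟨h1, h2⟩, h3, h4⟩
      exact ⟨⟨z, h2, h3⟩, h1, h4⟩
    · rintro ⟨⟨z, h2, h3⟩, h1, h4⟩
      exact ⟨z, ⟨h1, h2⟩, h3, h4⟩

theorem Reachable.refl (hx : x ∈ V(H)) : Reachable H x x := ⟨[], hx, rfl⟩

theorem Reachable.trans (h : Reachable H x y) (h' : Reachable H y z) : Reachable H x z := by
  obtain ⟨l, h⟩ := h
  obtain ⟨l', h'⟩ := h'
  exact ⟨_, h.append h'⟩

theorem Reachable.of_isLink (h : H.IsLink e x y) : Reachable H x y :=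
  ⟨[e], y, h, h.right_mem, rfl⟩

theorem Reachable.induct {P : α → Prop} (h : Reachable H x y) (hx : P x)
    (hs : ∀ e a b, Reachable H x a → H.IsLink e a b → P a → P b) : P y := by
  obtain ⟨l, h⟩ := h
  suffices ∀ (l : List β) (a : α), Reachable H x a → P a → IsWalk H a l y → P y from
    this l x (.refl h.left_mem) hx h
  intro l
  induction l with
  | nil => rintro a - ha ⟨-, rfl⟩; exact ha
  | cons e l ih =>
    rintro a hxa ha ⟨u, hu, h⟩
    exact ih u (hxa.trans (.of_isLink hu)) (hs e a u hxa hu ha) h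

theorem Reachable.left_mem (h : Reachable H x y) : x ∈ V(H) := h.choose_spec.left_mem

theorem Reachable.symm (h : Reachable H x y) : Reachable H y x :=
  h.induct (P := fun z ↦ Reachable H z x) (.refl h.left_mem)
    fun _ _ _ _ hab ha ↦ (Reachable.of_isLink hab.symm).trans ha

theorem Reachable.lift (h : Reachable H x y) (hx : x ∈ V(G))
    (hl : ∀ e a b, H.IsLink e a b → Reachable G a b) : Reachable G x y :=
  h.induct (P := fun z ↦ Reachable G x z) (.refl hx) fun e a b _ hab ha ↦ ha.trans (hl e a b hab)

/-- A reachable vertex is reached by a walk without repeated edges. -/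
theorem Reachable.exists_trail (h : Reachable H x y) : ∃ l, l.Nodup ∧ IsWalk H x l y := by
  obtain ⟨l, h⟩ := h
  induction l generalizing x with
  | nil => exact ⟨[], List.nodup_nil, h⟩
  | cons e l ih =>
    obtain ⟨z, hz, h⟩ := h
    obtain ⟨l', hn, h'⟩ := ih h
    by_cases he : e ∈ l'
    · obtain ⟨l₁, l₂, rfl⟩ := List.append_of_mem he
      obtain ⟨a, b, hab, h₁, h₂⟩ := h'.split
      have hn' := (List.nodup_append.1 hn).2.1
      -- If the old trail traverses `e` in the same direction, only the part `l₁` before it is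
      -- dropped. Otherwise it is back at the start right after `e`, and `l₂` alone suffices.
      rcases hz.eq_and_eq_or_eq_and_eq hab with ⟨rfl, rfl⟩ | ⟨rfl, rfl⟩
      · exact ⟨e :: l₂, hn', _, hz, h₂⟩
      · exact ⟨l₂, (List.nodup_cons.1 hn').2, h₂⟩
    · exact ⟨e :: l', List.nodup_cons.2 ⟨he, hn⟩, z, hz, h'⟩

/-- `y` is reachable from `x` through edges in `A`. -/
abbrev ReachIn (G : Graph α β) (A : Set β) (x y : α) : Prop :=
  Reachable (G.restrict A) x y

theorem ReachIn.mono (hA : A ⊆ A') (h : ReachIn G A x y) : ReachIn G A' x y := by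
  obtain ⟨l, h⟩ := h
  rw [isWalk_restrict] at h
  exact ⟨l, isWalk_restrict.2 ⟨h.1, fun e he ↦ hA (h.2 e he)⟩⟩

theorem reachIn_of_isLink (h : G.IsLink e x y) (he : e ∈ A) : ReachIn G A x y :=
  .of_isLink (e := e) (by simp [h, he])

theorem ReachIn.lift (h : ReachIn G A x y)
    (hl : ∀ e a b, e ∈ A → G.IsLink e a b → ReachIn G A' a b) : ReachIn G A' x y := by
  refine Reachable.lift h h.left_mem fun e a b hab ↦ ?_
  rw [Graph.restrict_isLink] at hab
  exact hl e a b (by tauto) (by tauto)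

/-- Reachability when one edge is added. -/
theorem ReachIn.of_insert (h : ReachIn G (insert e A) x y) (he : G.IsLink e a b) :
    ReachIn G A x y ∨ (ReachIn G A x a ∧ ReachIn G A b y) ∨
      (ReachIn G A x b ∧ ReachIn G A a y) := by
  have hb : ∀ v, v ∈ V(G) → ReachIn G A v v := fun v hv ↦ .refl (by simpa using hv)
  refine Reachable.induct (P := fun y ↦ ReachIn G A x y ∨ (ReachIn G A x a ∧ ReachIn G A b y) ∨
      (ReachIn G A x b ∧ ReachIn G A a y)) h (.inl (hb x (by simpa using h.left_mem))) ?_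
  intro f c d _ hcd ih
  rw [Graph.restrict_isLink] at hcd
  obtain ⟨hf, hcd⟩ := hcd
  by_cases hfA : f ∈ A
  · have := reachIn_of_isLink hcd hfA
    rcases ih with ih | ⟨ih, ih'⟩ | ⟨ih, ih'⟩
    · exact .inl (ih.trans this)
    · exact .inr (.inl ⟨ih, ih'.trans this⟩)
    · exact .inr (.inr ⟨ih, ih'.trans this⟩)
  · obtain rfl : f = e := by simpa [hfA] using hf
    rcases hcd.eq_and_eq_or_eq_and_eq he with ⟨rfl, rfl⟩ | ⟨rfl, rfl⟩
    · rcases ih with ih | ⟨ih, ih'⟩ | ⟨ih, ih'⟩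
      · exact .inr (.inl ⟨ih, hb _ hcd.right_mem⟩)
      · exact .inr (.inl ⟨ih, hb _ hcd.right_mem⟩)
      · exact .inl ih
    · rcases ih with ih | ⟨ih, ih'⟩ | ⟨ih, ih'⟩
      · exact .inr (.inr ⟨ih, hb _ hcd.right_mem⟩)
      · exact .inl ih
      · exact .inr (.inr ⟨ih, hb _ hcd.right_mem⟩)

/-- A reachability relation that crosses a set of vertices uses an edge that crosses it. -/
theorem ReachIn.exists_crossing {D : Set α} (h : ReachIn G A x y) (hx : x ∈ D) (hy : y ∉ D) :
    ∃ f ∈ A, ∃ a b, G.IsLink f a b ∧ a ∈ D ∧ b ∉ D := by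
  by_contra! hc
  refine hy (Reachable.induct (P := (· ∈ D)) h hx fun f a b _ hab ha ↦ ?_)
  rw [Graph.restrict_isLink] at hab
  exact hc f (by tauto) a b (by tauto) ha

/-- A closed trail consists of its first edge and a trail back that avoids this edge. From here on,
forests are handled through reachability instead of cycles. -/
theorem acyclic_restrict_iff : Acyclic (G.restrict A) ↔
    ∀ e ∈ A, ∀ x y, G.IsLink e x y → ¬ ReachIn G (A \ {e}) x y := by
  constructor
  · intro h e he x y hxy hr
    obtain ⟨l, hn, hw⟩ := Reachable.exists_trail hr.symm
    rw [isWalk_restrict] at hw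
    refine h x (e :: l) (by simp) (List.nodup_cons.2 ⟨fun hel ↦ (hw.2 e hel).2 rfl, hn⟩)
      ⟨y, by simp [hxy, he], isWalk_restrict.2 ⟨hw.1, fun f hf ↦ (hw.2 f hf).1⟩⟩
  · rintro h x (_ | ⟨e, l⟩) hl hn hw
    · exact hl rfl
    · rw [isWalk_restrict] at hw
      obtain ⟨⟨z, hz, hw⟩, hA⟩ := hw
      refine h e (hA e (by simp)) x z hz (Reachable.symm ⟨l, isWalk_restrict.2 ⟨hw, fun f hf ↦ ?_⟩⟩)
      exact ⟨hA f (by simp [hf]), fun hfe ↦ (List.nodup_cons.1 hn).1 (hfe ▸ hf)⟩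

/-- An edge of a trail splits it into two trails that avoid the edge. -/
theorem IsWalk.split_trail (h : IsWalk (G.restrict A) x l y) (hn : l.Nodup) (hf : f ∈ l) :
    ∃ a b, G.IsLink f a b ∧ ReachIn G (A \ {f}) x a ∧ ReachIn G (A \ {f}) b y := by
  rw [isWalk_restrict] at h
  obtain ⟨h, hA⟩ := h
  obtain ⟨l₁, l₂, rfl⟩ := List.append_of_mem hf
  obtain ⟨a, b, hab, h₁, h₂⟩ := h.split
  rw [List.nodup_append] at hn
  obtain ⟨hn₁, hn₂, hd⟩ := hn
  refine ⟨a, b, hab, ⟨l₁, isWalk_restrict.2 ⟨h₁, fun g hg ↦ ⟨hA g (by simp [hg]), ?_⟩⟩⟩,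
    ⟨l₂, isWalk_restrict.2 ⟨h₂, fun g hg ↦ ⟨hA g (by simp [hg]), ?_⟩⟩⟩⟩
  · rintro rfl; exact hd g hg g (by simp) rfl
  · rintro rfl; exact (List.nodup_cons.1 hn₂).1 hg

end Walks

/-! ### Exchange of edges in spanning trees. -/

section Trees

variable {α β : Type*} {G : Graph α β} {x y : α} {e f : β} {A : Set β} {T X : Finset β}

theorem isSpanningTree_iff (hV : V(G) = Set.univ) [Nonempty α] : IsSpanningTree G T ↔
    (T : Set β) ⊆ E(G) ∧ (∀ x y, ReachIn G T x y) ∧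
      ∀ e ∈ T, ∀ x y, G.IsLink e x y → ¬ ReachIn G (T \ {e}) x y := by
  rw [IsSpanningTree, acyclic_restrict_iff, Connected]
  simp [hV]

variable [DecidableEq β]

/-- Replacing an edge `e` of a spanning tree by an edge `f` that joins the two sides. -/
theorem IsSpanningTree.exchange (hV : V(G) = Set.univ) (hT : IsSpanningTree G T) {a b : α}
    (he : e ∈ T) (hxy : G.IsLink e x y) (hab : G.IsLink f a b)
    (hxa : ReachIn G (T \ {e}) x a) (hby : ReachIn G (T \ {e}) b y) :
    IsSpanningTree G (insert f (T.erase e)) := by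
  have : Nonempty α := ⟨x⟩
  rw [isSpanningTree_iff hV] at hT ⊢
  obtain ⟨hE, hc, ha⟩ := hT
  push_cast
  refine ⟨?_, fun p q ↦ ?_, ?_⟩
  · rw [Set.insert_subset_iff]
    exact ⟨hab.edge_mem, Set.sdiff_subset.trans hE⟩
  · refine (hc p q).lift fun g c d hg hcd ↦ ?_
    have hm : (T : Set β) \ {e} ⊆ insert f ((T : Set β) \ {e}) := Set.subset_insert _ _
    by_cases hge : g = e
    · subst hge
      have h1 : ReachIn G (insert f ((T : Set β) \ {g})) x y :=
        ((hxa.mono hm).trans (reachIn_of_isLink hab (by simp))).trans (hby.mono hm)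
      rcases hcd.eq_and_eq_or_eq_and_eq hxy with ⟨rfl, rfl⟩ | ⟨rfl, rfl⟩
      · exact h1
      · exact h1.symm
    · exact reachIn_of_isLink hcd (by simp [hg, hge])
  -- The ends of `f` lie on different sides of `T - e`. A cycle in the new edge set would either lie
  -- in `T` or join the two sides without `f`.
  · have hnab : ¬ ReachIn G ((T : Set β) \ {e}) a b := fun h ↦
      ha e he x y hxy ((hxa.trans h).trans hby)
    intro g hg c d hcd hr
    by_cases hgf : g = f
    · subst hgf
      have : ReachIn G ((T : Set β) \ {e}) c d := hr.mono (by intro i hi; simp at hi ⊢; tauto)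
      rcases hcd.eq_and_eq_or_eq_and_eq hab with ⟨rfl, rfl⟩ | ⟨rfl, rfl⟩
      · exact hnab this
      · exact hnab this.symm
    · have hg' : g ∈ T ∧ g ≠ e := by simp [hgf] at hg; tauto
      have hm : ((T : Set β) \ {e}) \ {g} ⊆ (T : Set β) \ {e} := Set.sdiff_subset
      have hr' : ReachIn G (insert f (((T : Set β) \ {e}) \ {g})) c d :=
        hr.mono (by intro i hi; simp at hi ⊢; tauto)
      have hcd' : ReachIn G ((T : Set β) \ {e}) c d := reachIn_of_isLink hcd (by simp [hg'])
      rcases hr'.of_insert hab with h | ⟨h, h'⟩ | ⟨h, h'⟩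
      · exact ha g hg'.1 c d hcd (h.mono (by intro i hi; simp at hi ⊢; tauto))
      · exact hnab (((h.mono hm).symm.trans hcd').trans (h'.mono hm).symm)
      · exact hnab (((h'.mono hm).trans hcd'.symm).trans (h.mono hm))

/-- An edge `e` of a spanning tree can be replaced by an edge of any connection of its ends. -/
theorem IsSpanningTree.exists_exchange_in (hV : V(G) = Set.univ) (hT : IsSpanningTree G T)
    (he : e ∈ T) (hxy : G.IsLink e x y) (hA : ReachIn G A x y) :
    ∃ f ∈ A, (f ∈ T → f = e) ∧ IsSpanningTree G (insert f (T.erase e)) := by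
  have : Nonempty α := ⟨x⟩
  have hT' := hT
  rw [isSpanningTree_iff hV] at hT'
  obtain ⟨hE, hc, ha⟩ := hT'
  have hrefl : ∀ v, ReachIn G ((T : Set β) \ {e}) v v := fun v ↦ .refl (by simp [hV])
  -- `D` is the side of `x` in `T - e`; the connection through `A` has to leave it.
  obtain ⟨f, hf, a, b, hab, hxa, hxb⟩ := hA.exists_crossing
    (D := {v | ReachIn G ((T : Set β) \ {e}) x v}) (hrefl x) (ha e he x y hxy)
  have hTe : insert e ((T : Set β) \ {e}) = T := by
    ext i; by_cases h : i = e <;> simp [h, he]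
  have hby : ReachIn G ((T : Set β) \ {e}) b y := by
    have h := hc x b
    rw [← hTe] at h
    rcases h.of_insert hxy with h | ⟨h, h'⟩ | ⟨h, h'⟩
    · exact absurd h hxb
    · exact h'.symm
    · exact absurd h' hxb
  refine ⟨f, hf, fun hfT ↦ by_contra fun hfe ↦ hxb ?_, hT.exchange hV he hxy hab hxa hby⟩
  exact Reachable.trans hxa (reachIn_of_isLink hab (by simp [hfT, hfe]))

/-- If the ends of an edge `e` outside a spanning tree are not connected through `A`, then `e` can
replace a tree edge outside `A`. -/
theorem IsSpanningTree.exists_exchange_out (hV : V(G) = Set.univ) (hT : IsSpanningTree G T)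
    (hxy : G.IsLink e x y) (hA : ¬ ReachIn G A x y) :
    ∃ f ∈ T, f ∉ A ∧ IsSpanningTree G (insert e (T.erase f)) := by
  have : Nonempty α := ⟨x⟩
  have hT' := hT
  rw [isSpanningTree_iff hV] at hT'
  obtain ⟨hE, hc, ha⟩ := hT'
  obtain ⟨l, hn, hl⟩ := (hc x y).exists_trail
  have : ∃ f ∈ l, f ∉ A := by
    by_contra! h
    rw [isWalk_restrict] at hl
    exact hA ⟨l, isWalk_restrict.2 ⟨hl.1, h⟩⟩
  obtain ⟨f, hfl, hfA⟩ := this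
  have hfT : f ∈ T := (isWalk_restrict.1 hl).2 f hfl
  obtain ⟨a, b, hab, hxa, hby⟩ := hl.split_trail hn hfl
  exact ⟨f, hfT, hfA, hT.exchange hV hfT hab hxy hxa.symm hby.symm⟩

/-- Exchanging an edge of `T \ X` for an edge of `X` keeps the cardinality and shrinks `T \ X`. Once
`T ⊆ X`, a further edge of `X` would close a cycle. -/
theorem IsSpanningTree.card_eq (hV : V(G) = Set.univ) (hT : IsSpanningTree G T)
    (hX : IsSpanningTree G X) : T.card = X.card := by
  obtain ⟨v, hv⟩ := hT.2.1.1
  have : Nonempty α := ⟨v⟩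
  induction h : (T \ X).card generalizing T with
  | zero =>
    have hTX : T ⊆ X := by simpa using h
    rw [(Finset.eq_of_subset_of_card_le hTX (Finset.card_le_card fun e heX ↦ ?_) : T = X)]
    by_contra heT
    have h1 := (isSpanningTree_iff hV).1 hT
    have h2 := (isSpanningTree_iff hV).1 hX
    obtain ⟨x, y, hxy⟩ := Graph.exists_isLink_of_mem_edgeSet (h2.1 heX)
    exact h2.2.2 e heX x y hxy ((h1.2.1 x y).mono fun i hi ↦ ⟨hTX hi, by rintro rfl; exact heT hi⟩)
  | succ k ih =>
    obtain ⟨e, he⟩ : (T \ X).Nonempty := by rw [← Finset.card_pos]; omega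
    rw [Finset.mem_sdiff] at he
    obtain ⟨x, y, hxy⟩ := Graph.exists_isLink_of_mem_edgeSet (hT.1 he.1)
    obtain ⟨f, hfX, hfT, ht⟩ := hT.exists_exchange_in hV he.1 hxy
      (((isSpanningTree_iff hV).1 hX).2.1 x y)
    have hfT' : f ∉ T := fun h ↦ he.2 (hfT h ▸ hfX)
    have hd : insert f (T.erase e) \ X = (T \ X).erase e := by
      ext i; by_cases h : i = f
      · subst h; simp; tauto
      · simp [h]; tauto
    rw [← ih ht (hv := by simpa using hv) (by rw [hd, Finset.card_erase_of_mem (by simp [he]), h]; rfl),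
      Finset.card_insert_of_notMem (by simp [hfT']), Finset.card_erase_of_mem he.1]
    have := Finset.card_pos.2 ⟨e, he.1⟩
    omega

end Trees

/-! ### Edges in some and edges in all minimum weight spanning trees. -/

section MinSpanningTrees

variable {α β : Type*} [DecidableEq β] {G : Graph α β} {w : β → ℝ} {x y : α} {e f : β} {T X : Finset β}

/-- The trivial exchange `f = e` is admitted, because `exists_exchange_in` does not exclude it. -/
theorem exists_insert_erase_swap_sum (he : e ∈ T) (hf : f ∈ T → f = e) :
    ∑ g ∈ insert f (T.erase e), w g + w e = ∑ g ∈ T, w g + w f := by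
  rw [Finset.sum_insert (by simpa using fun h hT ↦ h (hf hT)), ← Finset.add_sum_erase T w he]
  ring

/-- The ends of a tree edge are not connected through cheaper edges. -/
theorem not_reachIn_of_mem_minSpanningTrees (hV : V(G) = Set.univ) (hT : T ∈ minSpanningTrees G w)
    (he : e ∈ T) (hxy : G.IsLink e x y) : ¬ ReachIn G {f | w f < w e} x y := by
  intro h
  obtain ⟨f, hf, hfT, hS⟩ := hT.1.exists_exchange_in hV he hxy h
  have h1 := hT.2 _ hS
  have h2 := exists_insert_erase_swap_sum (w := w) he hfT
  simp only [Set.mem_ofPred_eq] at hf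
  linarith

/-- A tree without `e` would contain a heavier edge on the path between the ends of `e`, and
exchanging it for `e` would lower the weight. -/
theorem mem_of_mem_minSpanningTrees (hV : V(G) = Set.univ) (hT : T ∈ minSpanningTrees G w)
    (hxy : G.IsLink e x y) (hr : ¬ ReachIn G ({f | w f ≤ w e} \ {e}) x y) : e ∈ T := by
  by_contra he
  obtain ⟨f, hfT, hf, hS⟩ := hT.1.exists_exchange_out hV hxy hr
  have h1 := hT.2 _ hS
  have h2 := exists_insert_erase_swap_sum (w := w) hfT (f := e) (fun h ↦ absurd h he)
  have hfe : f ≠ e := by rintro rfl; exact he hfT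
  simp only [Set.mem_sdiff, Set.mem_ofPred_eq, Set.mem_singleton_iff, hfe, not_false_eq_true,
    and_true, not_le] at hf
  linarith

/-- Converse of `mem_of_mem_minSpanningTrees`: the connection supplies a replacement for `e` that is
not heavier. -/
theorem exists_minSpanningTree_erase (hV : V(G) = Set.univ) (hT : T ∈ minSpanningTrees G w)
    (he : e ∈ T) (hxy : G.IsLink e x y) (hr : ReachIn G ({f | w f ≤ w e} \ {e}) x y) :
    ∃ f ∉ T, insert f (T.erase e) ∈ minSpanningTrees G w := by
  obtain ⟨f, hf, hfT, hS⟩ := hT.1.exists_exchange_in hV he hxy hr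
  have h2 := exists_insert_erase_swap_sum (w := w) he hfT
  have hf1 : w f ≤ w e := hf.1
  refine ⟨f, fun h ↦ hf.2 (hfT h), hS, fun T' hT' ↦ ?_⟩
  have := hT.2 _ hT'
  linarith

/-- Converse of `not_reachIn_of_mem_minSpanningTrees`: the tree path between the ends of `e`
contains an edge at least as heavy as `e`, which `e` can replace. -/
theorem exists_minSpanningTree_insert (hV : V(G) = Set.univ) (hT : T ∈ minSpanningTrees G w)
    (he : e ∉ T) (hxy : G.IsLink e x y) (hr : ¬ ReachIn G {f | w f < w e} x y) :
    ∃ f ∈ T, insert e (T.erase f) ∈ minSpanningTrees G w := by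
  obtain ⟨f, hfT, hf, hS⟩ := hT.1.exists_exchange_out hV hxy hr
  have h2 := exists_insert_erase_swap_sum (w := w) hfT (f := e) (fun h ↦ absurd h he)
  simp only [Set.mem_ofPred_eq, not_lt] at hf
  refine ⟨f, hfT, hS, fun T' hT' ↦ ?_⟩
  have := hT.2 _ hT'
  linarith

/-- A spanning tree is a minimum weight spanning tree if the ends of every edge are connected in the
tree through edges that are not heavier. -/
theorem mem_minSpanningTrees_of_reachIn (hV : V(G) = Set.univ) (hT : IsSpanningTree G T)
    (hr : ∀ g a b, G.IsLink g a b → ReachIn G ({f | w f ≤ w g} ∩ T) a b) :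
    T ∈ minSpanningTrees G w := by
  refine ⟨hT, fun X hX ↦ ?_⟩
  obtain ⟨v, hv⟩ := hT.2.1.1
  have : Nonempty α := ⟨v⟩
  induction h : (T \ X).card generalizing X with
  | zero =>
    have hTX : T ⊆ X := by simpa using h
    rw [Finset.eq_of_subset_of_card_le hTX (hT.card_eq hV hX).ge]
  | succ k ih =>
    obtain ⟨e, he⟩ : (T \ X).Nonempty := by rw [← Finset.card_pos]; omega
    rw [Finset.mem_sdiff] at he
    obtain ⟨x, y, hxy⟩ := Graph.exists_isLink_of_mem_edgeSet (hT.1 he.1)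
    -- By `hr`, an edge lighter than `e` can be replaced by a connection in `T` that avoids `e`. So
    -- such edges do not join the two sides of `T - e`, and `e` can replace an edge of `X \ T` that
    -- is at least as heavy.
    have hn : ¬ ReachIn G ({g | w g < w e} ∪ (T \ {e})) x y := fun hc ↦ by
      refine ((isSpanningTree_iff hV).1 hT).2.2 e he.1 x y hxy (hc.lift ?_)
      rintro g a b (hg | hg) hab
      · refine (hr g a b hab).mono fun i hi ↦ ⟨hi.2, ?_⟩
        rintro rfl
        exact (not_le.2 hg : ¬ w i ≤ w g) hi.1
      · exact reachIn_of_isLink hab hg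
    obtain ⟨f, hfX, hf, hS⟩ := hX.exists_exchange_out hV hxy hn
    have hfe : f ≠ e := by rintro rfl; exact he.2 hfX
    simp only [Set.mem_union, Set.mem_ofPred_eq, Set.mem_sdiff, Finset.mem_coe, not_or, not_lt,
      Set.mem_singleton_iff, hfe, not_false_eq_true, and_true] at hf
    have hd : T \ insert e (X.erase f) = (T \ X).erase e := by
      ext i; by_cases h : i = f
      · subst h; simp [hf.2]
      · simp [h]; tauto
    have h1 := ih _ hS (by rw [hd, Finset.card_erase_of_mem (by simp [he]), h]; rfl)
    have h2 := exists_insert_erase_swap_sum (w := w) hfX (f := e) (fun h ↦ absurd h he.2)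
    linarith [hf.1]

/-! ### Minimum forcing and anti-forcing sets in terms of reachability -/

/-- `S` consists of the edges of a minimum weight spanning tree that can be avoided. -/
theorem isMinimumSet_isForcingSet (hV : V(G) = Set.univ) {S : Finset β} {T : Finset β}
    (hT : T ∈ minSpanningTrees G w)
    (hS : ∀ e, e ∈ S ↔ e ∈ T ∧ ∀ x y, G.IsLink e x y → ReachIn G ({f | w f ≤ w e} \ {e}) x y) :
    IsMinimumSet (IsForcingSet (minSpanningTrees G w)) S := by
  have key : ∀ X ∈ minSpanningTrees G w, ∀ e ∈ T,
      (¬ ∀ x y, G.IsLink e x y → ReachIn G ({f | w f ≤ w e} \ {e}) x y) → e ∈ X := by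
    intro X hX e _ hr
    push Not at hr
    obtain ⟨x, y, hxy, hr⟩ := hr
    exact mem_of_mem_minSpanningTrees hV hX hxy hr
  have hST : S ⊆ T := fun e he ↦ ((hS e).1 he).1
  refine ⟨⟨T, hT, hST, fun X hX hne hSX ↦ hne ?_⟩, ?_⟩
  · refine (Finset.eq_of_subset_of_card_le (fun e he ↦ ?_) (hX.1.card_eq hV hT.1).le).symm
    by_cases hr : ∀ x y, G.IsLink e x y → ReachIn G ({f | w f ≤ w e} \ {e}) x y
    · exact hSX ((hS e).2 ⟨he, hr⟩)
    · exact key X hX e he hr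
  · rintro S' ⟨X, hX, hSX, hu⟩
    -- `T \ S` consists of the edges that lie in all minimum weight spanning trees. Any other edge
    -- of `X` can be exchanged, and if it were outside `S'`, the new tree would also contain `S'`.
    have h1 : X \ (T \ S) ⊆ S' := by
      intro e he
      rw [Finset.mem_sdiff, Finset.mem_sdiff, not_and, not_not] at he
      by_contra heS
      obtain ⟨x, y, hxy⟩ := Graph.exists_isLink_of_mem_edgeSet (hX.1.1 he.1)
      have hr : ReachIn G ({f | w f ≤ w e} \ {e}) x y := by
        by_contra hr
        have heT := mem_of_mem_minSpanningTrees hV hT hxy hr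
        exact hr (((hS e).1 (he.2 heT)).2 x y hxy)
      obtain ⟨f, hf, hm⟩ := exists_minSpanningTree_erase hV hX he.1 hxy hr
      refine hu _ hm (fun h ↦ hf (h ▸ Finset.mem_insert_self _ _)) fun g hg ↦ ?_
      exact Finset.mem_insert_of_mem (Finset.mem_erase.2 ⟨by rintro rfl; exact heS hg, hSX hg⟩)
    have h2 := Finset.card_le_card h1
    have h3 : T \ S ⊆ X := fun e he ↦ by
      rw [Finset.mem_sdiff] at he
      exact key X hX e he.1 fun hr ↦ he.2 ((hS e).2 ⟨he.1, hr⟩)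
    rw [Finset.card_sdiff_of_subset h3, Finset.card_sdiff_of_subset hST, hX.1.card_eq hV hT.1] at h2
    have := Finset.card_le_card hST
    omega

/-- `S` consists of the edges outside a minimum weight spanning tree that belong to another one. -/
theorem isMinimumSet_isAntiForcingSet (hV : V(G) = Set.univ) {S : Finset β} {T : Finset β}
    (hT : T ∈ minSpanningTrees G w)
    (hS : ∀ e, e ∈ S ↔ e ∈ E(G) ∧ e ∉ T ∧ ∀ x y, G.IsLink e x y → ¬ ReachIn G {f | w f < w e} x y) :
    IsMinimumSet (IsAntiForcingSet (minSpanningTrees G w)) S := by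
  have hl : ∀ X ∈ minSpanningTrees G w, X ⊆ S ∪ T := by
    intro X hX e he
    by_cases heT : e ∈ T
    · simp [heT]
    · exact Finset.mem_union_left _ ((hS e).2 ⟨hX.1.1 he, heT, fun x y hxy ↦
        not_reachIn_of_mem_minSpanningTrees hV hX he hxy⟩)
  have hST : Disjoint S T := Finset.disjoint_left.2 fun e he ↦ ((hS e).1 he).2.1
  refine ⟨⟨T, hT, hST, fun X hX hne hSX ↦ hne ?_⟩, ?_⟩
  · refine Finset.eq_of_subset_of_card_le (fun e he ↦ ?_) (hX.1.card_eq hV hT.1).ge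
    exact (Finset.mem_union.1 (hl X hX he)).resolve_left fun h ↦ Finset.disjoint_left.1 hSX h he
  · rintro S' ⟨X, hX, hSX, hu⟩
    -- `S ∪ T` consists of the edges that lie in some minimum weight spanning tree. One outside `X`
    -- and `S'` could be exchanged into `X`, and the new tree would also avoid `S'`. The size of the
    -- left side does not depend on `X`.
    have h1 : (S ∪ T) \ X ⊆ S' := by
      intro e he
      rw [Finset.mem_sdiff, Finset.mem_union] at he
      by_contra heS
      have heE : e ∈ E(G) := he.1.elim (fun h ↦ ((hS e).1 h).1) fun h ↦ hT.1.1 h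
      obtain ⟨x, y, hxy⟩ := Graph.exists_isLink_of_mem_edgeSet heE
      have hr : ¬ ReachIn G {f | w f < w e} x y := he.1.elim
        (fun h ↦ ((hS e).1 h).2.2 x y hxy)
        (fun h ↦ not_reachIn_of_mem_minSpanningTrees hV hT h hxy)
      obtain ⟨f, hf, hm⟩ := exists_minSpanningTree_insert hV hX he.2 hxy hr
      refine hu _ hm (fun h ↦ he.2 (h ▸ Finset.mem_insert_self _ _)) ?_
      rw [Finset.disjoint_insert_right]
      exact ⟨heS, hSX.mono_right (Finset.erase_subset _ _)⟩
    have h2 := Finset.card_le_card h1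
    rw [Finset.card_sdiff_of_subset (hl X hX), Finset.card_union_of_disjoint hST,
      hX.1.card_eq hV hT.1] at h2
    omega

end MinSpanningTrees

/-! ### The graph of a weight class -/

section WeightClass

variable {α β : Type*} {G : Graph α β} {w : β → ℝ} {x y : α} {e f : β} {c : ℝ} {A : Set β}

/-- The vertex of the graph of a weight class to which a vertex is contracted. -/
def lightClass (G : Graph α β) (w : β → ℝ) (c : ℝ) (x : α) : Set α :=
  {y | ReachIn G {e | w e < c} x y}

theorem weightClass_isLink {P Q : Set α} : (weightClass G w c).IsLink e P Q ↔
    w e = c ∧ ∃ x y, G.IsLink e x y ∧ lightClass G w c x = P ∧ lightClass G w c y = Q := by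
  simp only [weightClass, contract, Graph.restrict_isLink, Graph.deleteEdges_isLink,
    Graph.map_isLink, Relation.Map, Set.mem_ofPred_eq, lightClass]
  constructor
  · rintro ⟨h, h1, h2⟩
    tauto
  · rintro ⟨rfl, h⟩
    simp [h]

theorem mem_edgeSet_weightClass : e ∈ E(weightClass G w c) ↔ e ∈ E(G) ∧ w e = c := by
  constructor
  · intro h
    obtain ⟨P, Q, h⟩ := Graph.exists_isLink_of_mem_edgeSet h
    obtain ⟨h1, x, y, hxy, -, -⟩ := weightClass_isLink.1 h
    exact ⟨hxy.edge_mem, h1⟩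
  · rintro ⟨h, h1⟩
    obtain ⟨x, y, hxy⟩ := Graph.exists_isLink_of_mem_edgeSet h
    exact (weightClass_isLink.2 ⟨h1, x, y, hxy, rfl, rfl⟩).edge_mem

theorem lightClass_eq_iff (hy : y ∈ V(G)) :
    lightClass G w c x = lightClass G w c y ↔ ReachIn G {e | w e < c} x y := by
  constructor
  · intro h
    have : y ∈ lightClass G w c y := Reachable.refl (by simpa using hy)
    rw [← h] at this
    exact this
  · intro h
    ext z
    exact ⟨fun hz ↦ h.symm.trans hz, fun hz ↦ h.trans hz⟩

/-- Passing through a contracted vertex amounts to a connection through lighter edges. With this,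
questions about weight classes are answered in `G` itself. -/
theorem reachIn_weightClass_iff (hx : x ∈ V(G)) (hy : y ∈ V(G)) (hA : ∀ e ∈ A, w e = c) :
    ReachIn (weightClass G w c) A (lightClass G w c x) (lightClass G w c y) ↔
      ReachIn G ({e | w e < c} ∪ A) x y := by
  have hm : {e | w e < c} ⊆ {e | w e < c} ∪ A := Set.subset_union_left
  constructor
  · intro h
    refine Reachable.induct (P := fun P ↦ ∀ y ∈ V(G), lightClass G w c y = P →
      ReachIn G ({e | w e < c} ∪ A) x y) h ?_ ?_ y hy rfl
    · intro y hy h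
      exact ((lightClass_eq_iff hy).1 h.symm).mono hm
    · rintro e P Q - hPQ ih z hz rfl
      rw [Graph.restrict_isLink, weightClass_isLink] at hPQ
      obtain ⟨heA, -, a, b, hab, rfl, hb⟩ := hPQ
      exact ((ih a hab.left_mem rfl).trans (reachIn_of_isLink hab (.inr heA))).trans
        (((lightClass_eq_iff hz).1 hb).mono hm)
  · intro h
    have hV : ∀ v ∈ V(G), lightClass G w c v ∈ V(weightClass G w c) := fun v hv ↦ by
      simpa [weightClass, contract] using ⟨v, hv, rfl⟩
    refine Reachable.induct (P := fun y ↦ ReachIn (weightClass G w c) A (lightClass G w c x)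
      (lightClass G w c y)) h (.refl (by simpa using hV x hx)) ?_
    intro e a b _ hab ih
    rw [Graph.restrict_isLink] at hab
    obtain ⟨he | he, hab⟩ := hab
    · rwa [← (lightClass_eq_iff hab.right_mem).2 (reachIn_of_isLink hab he)]
    · exact ih.trans (reachIn_of_isLink (weightClass_isLink.2 ⟨hA e he, a, b, hab, rfl, rfl⟩) he)

/-- A loop arises exactly when both ends are contracted to the same vertex. -/
theorem isLoop_weightClass_iff (hxy : G.IsLink e x y) :
    IsLoop (weightClass G w (w e)) e ↔ ReachIn G {f | w f < w e} x y := by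
  rw [← lightClass_eq_iff hxy.right_mem]
  constructor
  · rintro ⟨P, h⟩
    obtain ⟨-, a, b, hab, h1, h2⟩ := weightClass_isLink.1 h
    rcases hxy.eq_and_eq_or_eq_and_eq hab with ⟨rfl, rfl⟩ | ⟨rfl, rfl⟩
    · exact h1.trans h2.symm
    · exact h2.trans h1.symm
  · intro h
    exact ⟨_, weightClass_isLink.2 ⟨rfl, x, y, hxy, rfl, h.symm⟩⟩

/-- A connection in the class graph without `e` lifts to one in `G` through lighter edges and the
other edges of weight `w e`. -/
theorem isBridge_weightClass_iff (hxy : G.IsLink e x y) :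
    IsBridge (weightClass G w (w e)) e ↔ ¬ ReachIn G ({f | w f ≤ w e} \ {e}) x y := by
  have key : ∀ x y, G.IsLink e x y → (Reachable ((weightClass G w (w e)).deleteEdges {e})
      (lightClass G w (w e) x) (lightClass G w (w e) y) ↔
        ReachIn G ({f | w f ≤ w e} \ {e}) x y) := by
    intro x y hxy
    have h1 : (weightClass G w (w e)).deleteEdges {e} =
        (weightClass G w (w e)).restrict ({f | w f = w e} \ {e}) := by
      rw [← Graph.restrict_edgeSet_sdiff_eq_deleteEdges, ← Graph.restrict_edgeSet_inter]
      conv_rhs => rw [← Graph.restrict_edgeSet_inter]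
      congr 1
      ext f
      simp only [Set.mem_inter_iff, Set.mem_sdiff, mem_edgeSet_weightClass, Set.mem_ofPred_eq]
      tauto
    have hw : ∀ f ∈ {f | w f = w e} \ {e}, w f = w e := fun f hf ↦ hf.1
    rw [h1]
    refine (reachIn_weightClass_iff hxy.left_mem hxy.right_mem hw).trans ?_
    rw [show {f | w f < w e} ∪ ({f | w f = w e} \ {e}) = {f | w f ≤ w e} \ {e} by
      ext f; by_cases hf : f = e <;> simp [hf, le_iff_lt_or_eq]]
  constructor
  · rintro ⟨P, Q, h, hn⟩
    obtain ⟨-, a, b, hab, rfl, rfl⟩ := weightClass_isLink.1 h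
    rw [key a b hab] at hn
    rcases hxy.eq_and_eq_or_eq_and_eq hab with ⟨rfl, rfl⟩ | ⟨rfl, rfl⟩
    · exact hn
    · exact fun h ↦ hn h.symm
  · intro h
    exact ⟨_, _, weightClass_isLink.2 ⟨rfl, x, y, hxy, rfl, rfl⟩, by rwa [key x y hxy]⟩

/-- A forest is maximal iff the ends of every edge of the class are already connected, since any
other edge could be added. Stated in `G`, this allows lighter edges for free. -/
theorem isMaximalForest_weightClass_iff {F : Finset β} [DecidableEq β] :
    IsMaximalForest (weightClass G w c) F ↔
      (∀ e ∈ F, e ∈ E(G) ∧ w e = c) ∧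
      (∀ e ∈ F, ∀ x y, G.IsLink e x y → ¬ ReachIn G ({f | w f < c} ∪ (F \ {e})) x y) ∧
      (∀ e, w e = c → ∀ x y, G.IsLink e x y → ReachIn G ({f | w f < c} ∪ F) x y) := by
  have ac : ∀ F : Finset β, (∀ e ∈ F, e ∈ E(G) ∧ w e = c) →
      (Acyclic ((weightClass G w c).restrict F) ↔ ∀ e ∈ F, ∀ x y, G.IsLink e x y →
        ¬ ReachIn G ({f | w f < c} ∪ (F \ {e})) x y) := by
    intro F hF
    have hw : ∀ e, ∀ f ∈ (F : Set β) \ {e}, w f = c := fun e f hf ↦ (hF f hf.1).2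
    rw [acyclic_restrict_iff]
    constructor
    · intro h e he x y hxy hr
      exact h e he _ _ (weightClass_isLink.2 ⟨(hF e he).2, x, y, hxy, rfl, rfl⟩)
        ((reachIn_weightClass_iff hxy.left_mem hxy.right_mem (hw e)).2 hr)
    · rintro h e he _ _ hPQ hr
      obtain ⟨-, x, y, hxy, rfl, rfl⟩ := weightClass_isLink.1 hPQ
      exact h e he x y hxy ((reachIn_weightClass_iff hxy.left_mem hxy.right_mem (hw e)).1 hr)
  have hE : ∀ F : Finset β, (F : Set β) ⊆ E(weightClass G w c) ↔ ∀ e ∈ F, e ∈ E(G) ∧ w e = c := by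
    intro F
    exact forall₂_congr fun e _ ↦ mem_edgeSet_weightClass
  rw [IsMaximalForest, maximal_iff]
  simp only [hE]
  constructor
  · rintro ⟨⟨h1, h2⟩, h3⟩
    refine ⟨h1, (ac F h1).1 h2, fun e he x y hxy ↦ ?_⟩
    by_contra hr
    have heF : e ∉ F := fun h ↦ hr (reachIn_of_isLink hxy (.inr h))
    have h1' : ∀ g ∈ insert e F, g ∈ E(G) ∧ w g = c := by
      intro g hg
      rcases Finset.mem_insert.1 hg with rfl | hg
      · exact ⟨hxy.edge_mem, he⟩
      · exact h1 g hg
    refine heF ((h3 (y := insert e F) ⟨h1', (ac _ h1').2 ?_⟩ (Finset.subset_insert _ _)) ▸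
      Finset.mem_insert_self e F)
    intro g hg a b hab hab'
    rcases Finset.mem_insert.1 hg with rfl | hg
    · have h4 : ReachIn G ({f | w f < c} ∪ F) a b := hab'.mono (by
        intro i hi; simp at hi ⊢; tauto)
      rcases hxy.eq_and_eq_or_eq_and_eq hab with ⟨rfl, rfl⟩ | ⟨rfl, rfl⟩
      · exact hr h4
      · exact hr h4.symm
    · have hge : g ≠ e := fun h ↦ heF (h ▸ hg)
      have h4 : ReachIn G (insert e ({f | w f < c} ∪ (F \ {g}))) a b := hab'.mono (by
        intro i hi; simp at hi ⊢; tauto)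
      have hm : {f | w f < c} ∪ ((F : Set β) \ {g}) ⊆ {f | w f < c} ∪ F := by
        intro i hi; simp at hi ⊢; tauto
      have hg' : ReachIn G ({f | w f < c} ∪ F) a b := reachIn_of_isLink hab (.inr hg)
      rcases h4.of_insert hxy with h | ⟨h, h'⟩ | ⟨h, h'⟩
      · exact (ac F h1).1 h2 g hg a b hab h
      · exact hr (((h.mono hm).symm.trans hg').trans (h'.mono hm).symm)
      · exact hr (((h'.mono hm).trans hg'.symm).trans (h.mono hm))
  · rintro ⟨h1, h2, h3⟩
    refine ⟨⟨h1, (ac F h1).2 h2⟩, fun X ⟨hX, hX'⟩ hFX ↦ Finset.Subset.antisymm hFX fun e he ↦ ?_⟩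
    by_contra heF
    obtain ⟨x, y, hxy⟩ := Graph.exists_isLink_of_mem_edgeSet (hX e he).1
    refine (ac X hX).1 hX' e he x y hxy ((h3 e (hX e he).2 x y hxy).mono ?_)
    intro i hi
    rcases hi with hi | hi
    · exact .inl hi
    · exact .inr ⟨hFX hi, by rintro rfl; exact heF hi⟩

end WeightClass

/-! ### The union of the chosen forests is a minimum weight spanning tree. -/

section Outcomes

variable {α β : Type*} [Fintype β] [DecidableEq β] {G : Graph α β} {w : β → ℝ} {F : ℝ → Finset β}

/-- The union of forests chosen in the weight classes. -/
def classUnion (w : β → ℝ) (F : ℝ → Finset β) : Finset β := {e | e ∈ F (w e)}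

theorem mem_classUnion {e : β} : e ∈ classUnion w F ↔ e ∈ F (w e) := by simp [classUnion]

/-- Induction on the number of edges lighter than `g`: maximality of the forest connects the ends
through `F (w g)` and lighter edges, and the latter are replaced by induction. -/
theorem reachIn_classUnion (hF : ∀ c, IsMaximalForest (weightClass G w c) (F c)) (g : β) (a b : α)
    (hab : G.IsLink g a b) : ReachIn G ({f | w f ≤ w g} ∩ classUnion w F) a b := by
  induction h : ({f | w f < w g} : Finset β).card using Nat.strong_induction_on generalizing g a b with
  | _ k ih =>
    obtain ⟨h1, -, h3⟩ := isMaximalForest_weightClass_iff.1 (hF (w g))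
    refine (h3 g rfl a b hab).lift ?_
    rintro f x y (hf | hf) hxy
    · have hf : w f < w g := hf
      refine (ih _ ?_ f x y hxy rfl).mono ?_
      · rw [← h]
        refine Finset.card_lt_card ⟨fun i hi ↦ ?_, fun hs ↦ ?_⟩
        · simp only [Finset.mem_filter, Finset.mem_univ, true_and] at hi ⊢
          exact hi.trans hf
        · simpa using hs (show f ∈ ({f | w f < w g} : Finset β) by simpa using hf)
      · rintro i ⟨hi, hi'⟩
        exact ⟨le_trans hi hf.le, hi'⟩
    · have hw := (h1 f hf).2
      exact reachIn_of_isLink hxy ⟨hw.le, by simpa [classUnion, hw] using hf⟩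

/-- A cycle in the union is impossible because of its heaviest edge: the rest of the cycle would
connect the ends of this edge through lighter edges and edges of its own forest. -/
theorem isSpanningTree_classUnion (hV : V(G) = Set.univ) (hG : Connected G)
    (hF : ∀ c, IsMaximalForest (weightClass G w c) (F c)) :
    IsSpanningTree G (classUnion w F) := by
  obtain ⟨v, -⟩ := hG.1
  have : Nonempty α := ⟨v⟩
  have hE : ∀ e ∈ classUnion w F, e ∈ E(G) := fun e he ↦
    ((isMaximalForest_weightClass_iff.1 (hF (w e))).1 e (mem_classUnion.1 he)).1
  have hs : ∀ e ∈ classUnion w F, ∀ x y, G.IsLink e x y →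
      ¬ ReachIn G (({f | w f ≤ w e} ∩ classUnion w F) \ {e}) x y := by
    intro e he x y hxy hr
    refine (isMaximalForest_weightClass_iff.1 (hF (w e))).2.1 e (mem_classUnion.1 he) x y hxy
      (hr.mono ?_)
    rintro f ⟨⟨hf, hfT⟩, hfe⟩
    rcases lt_or_eq_of_le (show w f ≤ w e from hf) with h | h
    · exact .inl h
    · exact .inr ⟨h ▸ mem_classUnion.1 hfT, hfe⟩
  rw [isSpanningTree_iff hV]
  refine ⟨hE, fun x y ↦ ?_, fun e he x y hxy hr ↦ ?_⟩
  · refine Reachable.lift (hG.2 x (by simp [hV]) y (by simp [hV])) (by simp [hV]) fun e a b hab ↦ ?_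
    exact (reachIn_classUnion hF e a b hab).mono Set.inter_subset_right
  · obtain ⟨l, hn, hl⟩ := hr.exists_trail
    rw [isWalk_restrict] at hl
    obtain ⟨f, hf, hmax⟩ := Finset.exists_max_image (insert e l.toFinset) w ⟨e, by simp⟩
    have hl' : IsWalk (G.restrict ({g | w g ≤ w f} ∩ (classUnion w F \ {e}))) x l y :=
      isWalk_restrict.2 ⟨hl.1, fun g hg ↦ ⟨hmax g (by simp [hg]), hl.2 g hg⟩⟩
    by_cases hfe : f = e
    · subst hfe
      refine hs f he x y hxy (ReachIn.mono ?_ ⟨l, hl'⟩)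
      rintro g ⟨h1, h2, h3⟩
      exact ⟨⟨h1, h2⟩, h3⟩
    · have hfl : f ∈ l := by simpa [hfe] using hf
      obtain ⟨a, b, hab, hxa, hby⟩ := hl'.split_trail hn hfl
      have hm : ({g | w g ≤ w f} ∩ ((classUnion w F : Set β) \ {e})) \ {f} ⊆
          ({g | w g ≤ w f} ∩ classUnion w F) \ {f} := by
        rintro g ⟨⟨h1, h2, -⟩, h4⟩
        exact ⟨⟨h1, h2⟩, h4⟩
      refine hs f (hl.2 f hfl).1 a b hab ?_
      have he' : ReachIn G (({g | w g ≤ w f} ∩ classUnion w F) \ {f}) x y :=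
        reachIn_of_isLink hxy ⟨⟨hmax e (by simp), he⟩, fun h ↦ hfe h.symm⟩
      exact ((hxa.mono hm).symm.trans he').trans (hby.mono hm).symm

theorem classUnion_mem_minSpanningTrees (hV : V(G) = Set.univ) (hG : Connected G)
    (hF : ∀ c, IsMaximalForest (weightClass G w c) (F c)) :
    classUnion w F ∈ minSpanningTrees G w :=
  mem_minSpanningTrees_of_reachIn hV (isSpanningTree_classUnion hV hG hF) (reachIn_classUnion hF)

/-- By `isBridge_weightClass_iff`, the selected edges that are not bridges are the edges of the tree
`classUnion w F` that can be avoided. -/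
theorem IsForcingOutcome.isMinimumSet (hV : V(G) = Set.univ) (hG : Connected G) {S : Finset β}
    (hS : IsForcingOutcome G w S) : IsMinimumSet (IsForcingSet (minSpanningTrees G w)) S := by
  obtain ⟨F, hF, hS⟩ := hS
  refine isMinimumSet_isForcingSet hV (classUnion_mem_minSpanningTrees hV hG hF) fun e ↦ ?_
  rw [hS, mem_classUnion]
  constructor
  · rintro ⟨-, h, hb⟩
    exact ⟨h, fun x y hxy ↦ by rwa [isBridge_weightClass_iff hxy, not_not] at hb⟩
  · rintro ⟨h, hb⟩
    have he := ((isMaximalForest_weightClass_iff.1 (hF (w e))).1 e h).1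
    obtain ⟨x, y, hxy⟩ := Graph.exists_isLink_of_mem_edgeSet he
    exact ⟨he, h, by rw [isBridge_weightClass_iff hxy, not_not]; exact hb x y hxy⟩

/-- By `isLoop_weightClass_iff`, the edges chosen are those outside the tree `classUnion w F` that
belong to another minimum weight spanning tree. -/
theorem IsAntiForcingOutcome.isMinimumSet (hV : V(G) = Set.univ) (hG : Connected G) {S : Finset β}
    (hS : IsAntiForcingOutcome G w S) :
    IsMinimumSet (IsAntiForcingSet (minSpanningTrees G w)) S := by
  obtain ⟨F, hF, hS⟩ := hS
  refine isMinimumSet_isAntiForcingSet hV (classUnion_mem_minSpanningTrees hV hG hF) fun e ↦ ?_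
  rw [hS, mem_classUnion]
  refine and_congr_right fun he ↦ and_congr_right fun _ ↦ ?_
  obtain ⟨x, y, hxy⟩ := Graph.exists_isLink_of_mem_edgeSet he
  rw [isLoop_weightClass_iff hxy]
  refine ⟨fun h a b hab hr ↦ h ?_, fun h ↦ h x y hxy⟩
  rcases hxy.eq_and_eq_or_eq_and_eq hab with ⟨rfl, rfl⟩ | ⟨rfl, rfl⟩
  · exact hr
  · exact hr.symm

end Outcomes

/-! ### Reading the loops and bridges of all weight classes from one search order. -/

section SearchOrder

variable {α β : Type*} {G : Graph α β} {w : β → ℝ} {n : ℕ} {pos : α → ℕ} {te : ℕ → β}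
  {tl : ℕ → ℕ}

/-- A search order of the vertices: the vertex at position `p > 0` is reached through the edge `te p`
from the vertex at position `tl p < p`; this edge is a lightest edge between the vertices before
`p` and the others, with the latest possible tail. -/
structure IsSearchOrder (G : Graph α β) (w : β → ℝ) (n : ℕ) (pos : α → ℕ) (te : ℕ → β)
    (tl : ℕ → ℕ) : Prop where
  vertexSet_eq : V(G) = Set.univ
  injective : Function.Injective pos
  pos_lt : ∀ v, pos v < n
  surj : ∀ p < n, ∃ v, pos v = p
  link : ∀ p, 0 < p → p < n → ∃ x y, G.IsLink (te p) x y ∧ pos x = tl p ∧ pos y = p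
  tl_lt : ∀ p, 0 < p → p < n → tl p < p
  cut : ∀ f x y p, G.IsLink f x y → pos x < p → p ≤ pos y →
    w (te p) < w f ∨ (w (te p) = w f ∧ pos x ≤ tl p)

namespace IsSearchOrder

variable (h : IsSearchOrder G w n pos te tl)

include h

theorem weight_le {f : β} {x y : α} {p : ℕ} (hf : G.IsLink f x y) (hx : pos x < p) (hy : p ≤ pos y) :
    w (te p) ≤ w f := by
  rcases h.cut f x y p hf hx hy with h | h
  · exact h.le
  · exact h.1.le

theorem eq_of_isLink {x y : α} {p : ℕ} (h0 : 0 < p) (hp : p < n) (hf : G.IsLink (te p) x y)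
    (hxy : pos x ≤ pos y) : pos x = tl p ∧ pos y = p := by
  obtain ⟨a, b, hab, ha, hb⟩ := h.link p h0 hp
  have := h.tl_lt p h0 hp
  rcases hf.eq_and_eq_or_eq_and_eq hab with ⟨rfl, rfl⟩ | ⟨rfl, rfl⟩
  · exact ⟨ha, hb⟩
  · omega

theorem te_injective {p q : ℕ} (h0 : 0 < p) (hp : p < n) (h0' : 0 < q) (hq : q < n)
    (he : te p = te q) : p = q := by
  obtain ⟨a, b, hab, ha, hb⟩ := h.link p h0 hp
  have := h.tl_lt p h0 hp
  rw [he] at hab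
  exact (hb.symm.trans (h.eq_of_isLink h0' hq hab (by omega)).2)

/-- The vertices of a run of positions with light tree edges are connected by these edges. -/
theorem reachIn_of_run {P : ℝ → Prop} (hP : ∀ s t, s ≤ t → P t → P s) {x y : α}
    (hxy : pos x ≤ pos y) (hr : ∀ q, pos x < q → q ≤ pos y → P (w (te q))) :
    ReachIn G {e | ∃ q, 0 < q ∧ q ≤ pos y ∧ P (w (te q)) ∧ te q = e} x y := by
  classical
  have hex : ∃ r, ∀ q, r < q → q ≤ pos y → P (w (te q)) := ⟨pos x, hr⟩
  -- `r` is the start of the longest run that ends at `y`, so `te r` violates `P` unless `r = 0`. A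
  -- tree edge of the run cannot have its tail before `r`: it would cross `r`, so `te r` would be no
  -- heavier and satisfy `P` too.
  set r := Nat.find hex with hrdef
  have hr1 : ∀ q, r < q → q ≤ pos y → P (w (te q)) := Nat.find_spec hex
  have hrx : r ≤ pos x := Nat.find_min' hex hr
  have hr2 : 0 < r → ¬ P (w (te r)) := by
    intro h0 hPr
    refine Nat.find_min hex (m := r - 1) (by omega) fun q hq hqy ↦ ?_
    rcases eq_or_lt_of_le (show r ≤ q by omega) with rfl | hlt
    · exact hPr
    · exact hr1 q hlt hqy
  obtain ⟨z, hz⟩ := h.surj r (by have := h.pos_lt y; omega)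
  have key : ∀ k v, pos v = k → r ≤ k → k ≤ pos y →
      ReachIn G {e | ∃ q, 0 < q ∧ q ≤ pos y ∧ P (w (te q)) ∧ te q = e} z v := by
    intro k
    induction k using Nat.strong_induction_on with
    | _ k ih =>
      intro v hv hrk hky
      rcases eq_or_lt_of_le hrk with rfl | hlt
      · rw [h.injective (hz.trans hv.symm)]
        exact .refl (by simp [h.vertexSet_eq])
      · have hkn : k < n := by have := h.pos_lt y; omega
        obtain ⟨a, b, hab, ha, hb⟩ := h.link k (by omega) hkn
        have htl := h.tl_lt k (by omega) hkn
        obtain rfl := h.injective (hb.trans hv.symm)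
        have hPk := hr1 k hlt hky
        have htr : r ≤ tl k := by
          by_contra! hc
          exact hr2 (by omega) (hP _ _ (h.weight_le hab (by omega) (by omega)) hPk)
        exact (ih (tl k) htl a ha htr (by omega)).trans
          (reachIn_of_isLink hab ⟨k, by omega, hky, hPk, rfl⟩)
  exact (key _ x rfl hrx hxy).symm.trans (key _ y rfl (by omega) le_rfl)

theorem exists_weight_of_reachIn {A : Set β} {x y : α} {p : ℕ} (hr : ReachIn G A x y) (hx : pos x < p)
    (hy : p ≤ pos y) : ∃ f ∈ A, w (te p) ≤ w f := by
  obtain ⟨f, hf, a, b, hab, ha, hb⟩ := hr.exists_crossing (D := {v | pos v < p}) hx (by simpa using hy)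
  exact ⟨f, hf, h.weight_le hab ha (by simpa using hb)⟩

/-- An edge that crosses position `p` is never lighter than `te p`; conversely, a run of light tree
edges connects its vertices. So connectivity through light edges has intervals of positions as its
classes. -/
theorem reachIn_lt_iff {c : ℝ} {x y : α} (hxy : pos x ≤ pos y) :
    ReachIn G {f | w f < c} x y ↔ ∀ p, pos x < p → p ≤ pos y → w (te p) < c := by
  constructor
  · intro hr p hp hp'
    obtain ⟨f, hf, hle⟩ := h.exists_weight_of_reachIn hr hp hp'
    exact hle.trans_lt hf
  · intro hr
    refine (h.reachIn_of_run (P := (· < c)) (fun s t hst ht ↦ hst.trans_lt ht) hxy hr).mono ?_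
    rintro e ⟨q, -, -, hq, rfl⟩
    exact hq

/-- Deleting a tree edge from the tree separates its ends. -/
theorem not_reachIn_tree {p : ℕ} (h0 : 0 < p) (hp : p < n) {x y : α} (hxy : G.IsLink (te p) x y) :
    ¬ ReachIn G {e | (∃ q, 0 < q ∧ q < n ∧ te q = e) ∧ e ≠ te p} x y := by
  -- `R` is the parent relation of the search tree. No tree edge except `te p` leaves the set of
  -- descendants of `p`.
  set R : ℕ → ℕ → Prop := fun a b ↦ 0 < b ∧ b < n ∧ tl b = a
  have hle : ∀ q, Relation.ReflTransGen R p q → p ≤ q := by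
    intro q hq
    induction hq with
    | refl => exact le_rfl
    | tail _ hbc ih => have := h.tl_lt _ hbc.1 hbc.2.1; have := hbc.2.2; omega
  have hiff : ∀ q, 0 < q → q < n → q ≠ p →
      (Relation.ReflTransGen R p q ↔ Relation.ReflTransGen R p (tl q)) := by
    intro q h0 hq hne
    constructor
    · intro hr
      rcases hr.cases_tail with rfl | ⟨c, hc, hcq⟩
      · exact absurd rfl hne
      · rwa [← hcq.2.2] at hc
    · exact fun hr ↦ hr.tail ⟨h0, hq, rfl⟩
  have key : ∀ x y, G.IsLink (te p) x y → pos x = tl p → pos y = p →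
      ¬ ReachIn G {e | (∃ q, 0 < q ∧ q < n ∧ te q = e) ∧ e ≠ te p} x y := by
    intro x y hxy hx hy hr
    obtain ⟨f, ⟨⟨q, hq0, hqn, rfl⟩, hf⟩, a, b, hab, ha, hb⟩ := ReachIn.exists_crossing hr.symm
      (D := {v | Relation.ReflTransGen R p (pos v)}) (by simp [hy, Relation.ReflTransGen.refl])
      (fun hD ↦ by
        have := hle _ hD
        have := h.tl_lt p h0 hp
        omega)
    have hqp : q ≠ p := by rintro rfl; exact hf rfl
    have := hiff q hq0 hqn hqp
    obtain ⟨u, v, huv, hu, hv⟩ := h.link q hq0 hqn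
    simp only [Set.mem_ofPred_eq] at ha hb
    rcases hab.eq_and_eq_or_eq_and_eq huv with ⟨rfl, rfl⟩ | ⟨rfl, rfl⟩
    · rw [hu] at ha
      rw [hv] at hb
      tauto
    · rw [hv] at ha
      rw [hu] at hb
      tauto
  obtain ⟨a, b, hab, ha, hb⟩ := h.link p h0 hp
  rcases hxy.eq_and_eq_or_eq_and_eq hab with ⟨rfl, rfl⟩ | ⟨rfl, rfl⟩
  · exact key _ _ hab ha hb
  · exact fun hr ↦ key _ _ hab ha hb hr.symm

/-- There is no cycle, as lighter edges can be replaced by lighter tree edges, which are not `te p`.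
The forest is maximal, as an edge of weight `c` only crosses positions whose tree edges have weight
at most `c`. -/
theorem isMaximalForest [DecidableEq β] {c : ℝ} {F : Finset β}
    (hF : ∀ e, e ∈ F ↔ ∃ p, 0 < p ∧ p < n ∧ w (te p) = c ∧ te p = e) :
    IsMaximalForest (weightClass G w c) F := by
  rw [isMaximalForest_weightClass_iff]
  refine ⟨?_, ?_, ?_⟩
  · intro e he
    obtain ⟨p, h0, hp, hc, rfl⟩ := (hF e).1 he
    obtain ⟨a, b, hab, -, -⟩ := h.link p h0 hp
    exact ⟨hab.edge_mem, hc⟩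
  · intro e he x y hxy hr
    obtain ⟨p, h0, hp, hc, rfl⟩ := (hF e).1 he
    refine h.not_reachIn_tree h0 hp hxy (hr.lift ?_)
    rintro g a b (hg | hg) hab
    · have hlt : w g < c := hg
      have key : ∀ a b, G.IsLink g a b → pos a ≤ pos b →
          ReachIn G {e | (∃ q, 0 < q ∧ q < n ∧ te q = e) ∧ e ≠ te p} a b := by
        intro a b hab hle
        refine (h.reachIn_of_run (P := (· < c)) (fun s t hst ht ↦ hst.trans_lt ht) hle
          fun q hq hq' ↦ (h.weight_le hab hq hq').trans_lt hlt).mono ?_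
        rintro e ⟨q, hq0, hqb, hq, rfl⟩
        exact ⟨⟨q, hq0, by have := h.pos_lt b; omega, rfl⟩, fun he ↦ by rw [he, hc] at hq; exact lt_irrefl _ hq⟩
      rcases le_total (pos a) (pos b) with hle | hle
      · exact key a b hab hle
      · exact (key b a hab.symm hle).symm
    · obtain ⟨q, hq0, hq, -, rfl⟩ := (hF g).1 hg.1
      exact reachIn_of_isLink hab ⟨⟨q, hq0, hq, rfl⟩, hg.2⟩
  · intro e he x y hxy
    have key : ∀ a b, G.IsLink e a b → pos a ≤ pos b → ReachIn G ({f | w f < c} ∪ F) a b := by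
      intro a b hab hle
      refine (h.reachIn_of_run (P := (· ≤ c)) (fun s t hst ht ↦ hst.trans ht) hle
        fun q hq hq' ↦ (h.weight_le hab hq hq').trans_eq he).mono ?_
      rintro e ⟨q, hq0, hqb, hq, rfl⟩
      rcases lt_or_eq_of_le hq with hq | hq
      · exact .inl hq
      · exact .inr ((hF _).2 ⟨q, hq0, by have := h.pos_lt b; omega, hq, rfl⟩)
    rcases le_total (pos x) (pos y) with hle | hle
    · exact key x y hxy hle
    · exact (key y x hxy.symm hle).symm

omit h in
/-- The position `p` is on the search path to position `j` in the graph of its weight class. -/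
def Live (w : β → ℝ) (te : ℕ → β) (tl : ℕ → ℕ) (p j : ℕ) : Prop :=
  p ≤ j ∧ ∀ q, p < q → q ≤ j → w (te q) < w (te p) ∨ (w (te q) = w (te p) ∧ p ≤ tl q)

omit h in
/-- The edge `f` shows that the tree edge at position `p` is not a bridge in its weight class; its
earlier end has position `i`. -/
def Covers (G : Graph α β) (w : β → ℝ) (pos : α → ℕ) (te : ℕ → β) (tl : ℕ → ℕ) (f : β) (p i : ℕ) : Prop :=
  f ≠ te p ∧ w f = w (te p) ∧ ∃ x y, G.IsLink f x y ∧ pos x = i ∧ i < p ∧ p ≤ pos y ∧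
    Live w te tl p (pos y)

/-- Walk back along the tails. A tail before `p` is excluded for edges lighter than `te p`, because
such an edge would cross `p`, and for equally heavy ones by `Live`. Hence `te p` is not used. -/
theorem reachIn_tail {p q : ℕ} {x y : α} (h0 : 0 < p) (hx : pos x = p) (hy : pos y = q)
    (hl : Live w te tl p q) : ReachIn G ({f | w f ≤ w (te p)} \ {te p}) x y := by
  induction q using Nat.strong_induction_on generalizing y with
  | _ q ih =>
    rcases eq_or_lt_of_le hl.1 with rfl | hlt
    · rw [h.injective (hx.trans hy.symm)]
      exact .refl (by simp [h.vertexSet_eq])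
    · have hqn : q < n := hy ▸ h.pos_lt y
      obtain ⟨a, b, hab, ha, hb⟩ := h.link q (by omega) hqn
      have htl := h.tl_lt q (by omega) hqn
      obtain rfl := h.injective (hb.trans hy.symm)
      have h1 := hl.2 q hlt le_rfl
      have htp : p ≤ tl q := by
        rcases h1 with h1 | h1
        · by_contra! hc
          exact absurd (h.weight_le hab (p := p) (by omega) (by omega)) (not_le.2 h1)
        · exact h1.2
      refine (ih (tl q) htl ha ⟨htp, fun q' h1 h2 ↦ hl.2 q' h1 (by omega)⟩).trans
        (reachIn_of_isLink hab ⟨?_, fun he ↦ ?_⟩)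
      · exact h1.elim le_of_lt fun h ↦ h.1.le
      · have := h.te_injective (by omega) hqn h0 (by have := h.pos_lt x; omega) he
        omega

/-- This is the low point criterion of depth-first search. The positions `j` with `Live w te tl p j`
form the subtree of `p` in its contracted class, and the preference for late tails excludes edges
from this subtree to later positions outside it. -/
theorem reachIn_iff_exists_covers {p : ℕ} (h0 : 0 < p) {x y : α} (hxy : G.IsLink (te p) x y)
    (hx : pos x = tl p) (hy : pos y = p) :
    ReachIn G ({f | w f ≤ w (te p)} \ {te p}) x y ↔ ∃ f i, Covers G w pos te tl f p i := by
  have hpn : p < n := hy ▸ h.pos_lt y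
  have htl := h.tl_lt p h0 hpn
  constructor
  · intro hr
    obtain ⟨f, ⟨hf, hne⟩, a, b, hab, ha, hb⟩ := ReachIn.exists_crossing hr.symm
      (D := {v | Live w te tl p (pos v)}) ⟨hy.ge, fun q h1 h2 ↦ by omega⟩
      (fun hD ↦ by have := hD.1; omega)
    have hf : w f ≤ w (te p) := hf
    have ha : Live w te tl p (pos a) := ha
    have hb : ¬ Live w te tl p (pos b) := hb
    by_cases hbp : pos b < p
    · exact ⟨f, pos b, hne, hf.antisymm (h.weight_le hab.symm hbp ha.1), b, a, hab.symm, rfl, hbp,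
        ha.1, ha⟩
    · push Not at hbp
      exfalso
      -- At every position `q` between the ends of `f`, the edge `f` was available with a tail not
      -- before `p`. So `te q` is lighter or has a tail at least as late, and the later end stays in
      -- the subtree.
      refine hb ⟨hbp, fun q hq hqb ↦ ?_⟩
      rcases le_or_gt q (pos a) with hqa | hqa
      · exact ha.2 q hq hqa
      · rcases h.cut f a b q hab hqa hqb with hc | ⟨hc, hc'⟩
        · exact .inl (hc.trans_le hf)
        · rcases lt_or_eq_of_le hf with hf | hf
          · exact .inl (hc ▸ hf)
          · exact .inr ⟨hc.trans hf, ha.1.trans hc'⟩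
  · rintro ⟨f, i, hne, hw, a, b, hab, rfl, hap, hpb, hl⟩
    have h1 : ReachIn G ({f | w f ≤ w (te p)} \ {te p}) y b := h.reachIn_tail h0 hy rfl hl
    have h2 : ReachIn G ({f | w f ≤ w (te p)} \ {te p}) a b :=
      reachIn_of_isLink hab ⟨hw.le, hne⟩
    have key : ∀ a b : α, pos a ≤ pos b → pos b < p →
        (∀ q, pos a < q → q ≤ pos b → w (te q) ≤ w (te p)) →
        ReachIn G ({f | w f ≤ w (te p)} \ {te p}) a b := by
      intro a b hle hb hq
      refine (h.reachIn_of_run (P := (· ≤ w (te p))) (fun s t hst ht ↦ hst.trans ht) hle hq).mono ?_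
      rintro e ⟨q, hq0, hqb, hq, rfl⟩
      refine ⟨hq, fun he ↦ ?_⟩
      have := h.te_injective hq0 (by omega) h0 hpn he
      omega
    -- Both vertices lie before `p`, and the positions between them are crossed by `te p` or by `f`,
    -- so the tree edges there have weight at most `w (te p)`.
    have h3 : ReachIn G ({f | w f ≤ w (te p)} \ {te p}) x a := by
      rcases le_total (pos x) (pos a) with hle | hle
      · exact key x a hle (by omega) fun q hq hq' ↦ h.weight_le hxy hq (by omega)
      · exact (key a x hle (by omega) fun q hq hq' ↦
          (h.weight_le hab hq (by omega)).trans hw.le).symm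
    exact (h3.trans h2).trans h1.symm

omit h in
/-- `q` is the last position up to `j` at which the tree edge has weight at least `c`. -/
structure IsTop (w : β → ℝ) (te : ℕ → β) (c : ℝ) (j q : ℕ) : Prop where
  le : q ≤ j
  ge : 0 < q → c ≤ w (te q)
  lt : ∀ q', q < q' → q' ≤ j → w (te q') < c

omit h in
theorem IsTop.le_of_ge {c : ℝ} {j q p : ℕ} (ht : IsTop w te c j q) (hp : p ≤ j) (hc : c ≤ w (te p)) :
    p ≤ q := by
  by_contra! hlt
  exact absurd (ht.lt p hlt hp) (not_lt.2 hc)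

theorem not_reachIn_lt_iff {f : β} {x y : α} {q : ℕ} (hxy : pos x ≤ pos y)
    (ht : IsTop w te (w f) (pos y) q) : ¬ ReachIn G {g | w g < w f} x y ↔ pos x < q := by
  rw [h.reachIn_lt_iff hxy]
  push Not
  constructor
  · rintro ⟨p, h1, h2, h3⟩
    exact h1.trans_le (ht.le_of_ge h2 h3)
  · intro hq
    exact ⟨q, hq, ht.le, ht.ge (by omega)⟩

/-- A tree edge is found at the top position of its later end. -/
theorem te_eq_iff {f : β} {x y : α} {q : ℕ} (hf : G.IsLink f x y) (hxy : pos x ≤ pos y)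
    (ht : IsTop w te (w f) (pos y) q) (hq : pos x < q) :
    te q = f ↔ ∃ p, 0 < p ∧ p < n ∧ te p = f := by
  constructor
  · intro he
    exact ⟨q, by omega, by have := h.pos_lt y; have := ht.le; omega, he⟩
  · rintro ⟨p, h0, hp, rfl⟩
    have h1 := h.eq_of_isLink h0 hp hf hxy
    have h2 := ht.le_of_ge h1.2.ge le_rfl
    have h3 := ht.le
    rw [show q = p by omega]

omit h in
/-- The propagation of earlier ends of covering edges along the search tree. -/
inductive Marked (G : Graph α β) (pos : α → ℕ) (te : ℕ → β) (A B : β → ℕ) : ℕ → ℕ → Prop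
  | base {f : β} {x y : α} (hf : G.IsLink f x y) (hxy : pos x ≤ pos y) (hq : pos x < B f)
      (hne : te (B f) ≠ f) : Marked G pos te A B (B f) (pos x)
  | step {p i : ℕ} (hp : Marked G pos te A B p i) (hi : i < A (te p)) : Marked G pos te A B (A (te p)) i

/-- `B f` is the start of the interval that contains the later end of `f`, and `A (te p)` that of
the tail of `te p`. While `i < A (te p)`, the latter is the parent of `p` in the depth-first tree of
the class. A mark thus climbs this tree as long as its edge passes over the position. -/
theorem Marked.exists_covers {A B : β → ℕ}
    (hA : ∀ p, 0 < p → p < n → IsTop w te (w (te p)) (tl p) (A (te p)))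
    (hB : ∀ f x y, G.IsLink f x y → pos x ≤ pos y → IsTop w te (w f) (pos y) (B f)) {p i : ℕ}
    (hm : Marked G pos te A B p i) : ∃ f, Covers G w pos te tl f p i := by
  induction hm with
  | @base f x y hf hxy hq hne =>
    have ht := hB f x y hf hxy
    have hw : w f = w (te (B f)) := (ht.ge (by omega)).antisymm (h.weight_le hf hq ht.le)
    exact ⟨f, hne.symm, hw, x, y, hf, rfl, hq, ht.le, ht.le, fun q hq hqy ↦
      .inl ((ht.lt q hq hqy).trans_eq hw)⟩
  | @step p i hp hi ih =>
    obtain ⟨f, hne, hw, x, y, hf, rfl, hip, hpy, hl⟩ := ih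
    have hpn : p < n := by have := h.pos_lt y; omega
    have ht := hA p (by omega) hpn
    obtain ⟨a, b, hab, ha, hb⟩ := h.link p (by omega) hpn
    have htl := h.tl_lt p (by omega) hpn
    have hle := ht.le
    -- `f` crosses the position `A (te p)`, so the tree edge there is not heavier than `f`; at a top
    -- position it is not lighter either.
    have hq : w (te (A (te p))) = w (te p) :=
      ((h.weight_le hf hi (by omega)).trans hw.le).antisymm (ht.ge (by omega))
    refine ⟨f, fun he ↦ ?_, hw.trans hq.symm, x, y, hf, rfl, hi, by omega, by omega, fun q hq1 hq2 ↦ ?_⟩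
    · subst he
      have := h.eq_of_isLink (p := A (te p)) (by omega) (by omega) hf (by omega)
      omega
    · rw [hq]
      rcases le_or_gt q (tl p) with h1 | h1
      · exact .inl (ht.lt q hq1 h1)
      · rcases lt_trichotomy q p with h2 | rfl | h2
        · rcases h.cut _ a b q hab (by omega) (by omega) with h3 | h3
          · exact .inl h3
          · exact .inr ⟨h3.1, by omega⟩
        · exact .inr ⟨rfl, hle⟩
        · rcases hl.2 q h2 hq2 with h3 | h3
          · exact .inl h3
          · exact .inr ⟨h3.1, by omega⟩

/-- Climb from `B f` to `p`. Each position `q ≠ p` on the way satisfies `p ≤ tl q`, because the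
later end of `f` is in the subtree of `p`, so the next top position is not before `p`. -/
theorem Covers.marked {A B : β → ℕ}
    (hA : ∀ p, 0 < p → p < n → IsTop w te (w (te p)) (tl p) (A (te p)))
    (hB : ∀ f x y, G.IsLink f x y → pos x ≤ pos y → IsTop w te (w f) (pos y) (B f)) {f : β} {p i : ℕ}
    (hc : Covers G w pos te tl f p i) : Marked G pos te A B p i := by
  obtain ⟨hne, hw, x, y, hf, rfl, hip, hpy, hl⟩ := hc
  have ht := hB f x y hf (by omega)
  have hle := ht.le
  have hpq : p ≤ B f := ht.le_of_ge hpy hw.le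
  have hkq : w (te (B f)) = w (te p) :=
    ((h.weight_le hf (by omega) ht.le).antisymm (ht.ge (by omega))).trans hw
  have hb : Marked G pos te A B (B f) (pos x) := by
    -- `f` is not the tree edge at `B f`: this is assumed if `B f = p`, and if `B f > p`, the tail
    -- of this tree edge would lie before `p`, contrary to `Live`.
    refine .base hf (by omega) (by omega) fun he ↦ ?_
    rcases eq_or_lt_of_le hpq with h1 | h1
    · exact hne (by rw [h1, he])
    · have h2 := h.eq_of_isLink (p := B f) (by omega) (by have := h.pos_lt y; omega) (he.symm ▸ hf)
        (by omega)
      rcases hl.2 (B f) h1 hle with h3 | h3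
      · exact absurd h3 (by rw [hkq]; exact lt_irrefl _)
      · omega
  have key : ∀ q, p ≤ q → q ≤ pos y → w (te q) = w (te p) → Marked G pos te A B q (pos x) →
      Marked G pos te A B p (pos x) := by
    intro q
    induction q using Nat.strong_induction_on with
    | _ q ih =>
      intro hpq hqy hk hm
      rcases eq_or_lt_of_le hpq with rfl | hlt
      · exact hm
      · have hqn : q < n := by have := h.pos_lt y; omega
        have ht := hA q (by omega) hqn
        have htl := h.tl_lt q (by omega) hqn
        have hle := ht.le
        have h1 : p ≤ tl q := by
          rcases hl.2 q hlt hqy with h3 | h3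
          · exact absurd h3 (by rw [hk]; exact lt_irrefl _)
          · exact h3.2
        have h2 : p ≤ A (te q) := ht.le_of_ge h1 hk.le
        refine ih _ (by omega) h2 (by omega) ?_ (.step hm (by omega))
        refine le_antisymm ?_ (hk ▸ ht.ge (by omega))
        exact (h.weight_le hf (by omega) (by omega)).trans hw.le
  exact key _ hpq hle hkq hb

/-- The forests that are formed by the tree edges. -/
theorem exists_forests [Fintype β] : ∃ F : ℝ → Finset β,
    (∀ c, IsMaximalForest (weightClass G w c) (F c)) ∧
      ∀ e, e ∈ F (w e) ↔ ∃ p, 0 < p ∧ p < n ∧ te p = e := by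
  classical
  refine ⟨fun c ↦ {e | ∃ p, 0 < p ∧ p < n ∧ w (te p) = c ∧ te p = e}, fun c ↦
    h.isMaximalForest fun e ↦ by simp, fun e ↦ ?_⟩
  simp only [Finset.mem_filter, Finset.mem_univ, true_and]
  constructor
  · rintro ⟨p, h1, h2, -, h3⟩; exact ⟨p, h1, h2, h3⟩
  · rintro ⟨p, h1, h2, rfl⟩; exact ⟨p, h1, h2, rfl, rfl⟩

theorem isAntiForcingOutcome [Fintype β] {B : β → ℕ} {lo : β → ℕ} {S : Finset β}
    (hE : ∀ f, ∃ x y, G.IsLink f x y ∧ pos x ≤ pos y ∧ lo f = pos x ∧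
      IsTop w te (w f) (pos y) (B f))
    (hS : ∀ f, f ∈ S ↔ lo f < B f ∧ te (B f) ≠ f) : IsAntiForcingOutcome G w S := by
  obtain ⟨F, hF, hFe⟩ := h.exists_forests
  refine ⟨F, hF, fun f ↦ ?_⟩
  obtain ⟨x, y, hf, hxy, hlo, ht⟩ := hE f
  rw [hS, hFe, isLoop_weightClass_iff hf, h.not_reachIn_lt_iff hxy ht, hlo, and_comm]
  constructor
  · rintro ⟨h1, h2⟩
    exact ⟨hf.edge_mem, by rwa [← h.te_eq_iff hf hxy ht h2], h2⟩
  · rintro ⟨-, h1, h2⟩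
    exact ⟨by rwa [Ne, h.te_eq_iff hf hxy ht h2], h2⟩

theorem isForcingOutcome [Fintype β] {A B : β → ℕ} {S : Finset β}
    (hA : ∀ p, 0 < p → p < n → IsTop w te (w (te p)) (tl p) (A (te p)))
    (hB : ∀ f x y, G.IsLink f x y → pos x ≤ pos y → IsTop w te (w f) (pos y) (B f))
    (hS : ∀ f, f ∈ S ↔ ∃ p, 0 < p ∧ p < n ∧ te p = f ∧ ∃ i, Marked G pos te A B p i) :
    IsForcingOutcome G w S := by
  obtain ⟨F, hF, hFe⟩ := h.exists_forests
  refine ⟨F, hF, fun f ↦ ?_⟩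
  rw [hS, hFe]
  have key : ∀ p, 0 < p → p < n → ((∃ i, Marked G pos te A B p i) ↔
      ¬ IsBridge (weightClass G w (w (te p))) (te p)) := by
    intro p h0 hp
    obtain ⟨x, y, hxy, hx, hy⟩ := h.link p h0 hp
    rw [isBridge_weightClass_iff hxy, not_not, h.reachIn_iff_exists_covers h0 hxy hx hy]
    constructor
    · rintro ⟨i, hi⟩
      obtain ⟨f, hf⟩ := Marked.exists_covers h hA hB hi
      exact ⟨f, i, hf⟩
    · rintro ⟨f, i, hf⟩
      exact ⟨i, Covers.marked h hA hB hf⟩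
  constructor
  · rintro ⟨p, h0, hp, rfl, hm⟩
    obtain ⟨x, y, hxy, -, -⟩ := h.link p h0 hp
    exact ⟨hxy.edge_mem, ⟨p, h0, hp, rfl⟩, (key p h0 hp).1 hm⟩
  · rintro ⟨-, ⟨p, h0, hp, rfl⟩, hm⟩
    exact ⟨p, h0, hp, rfl, (key p h0 hp).2 hm⟩

end IsSearchOrder

end SearchOrder

/-! ### A calculus of step bounds for programs. -/

section Machine

@[simp] theorem State.setReg_reg (σ : State) (x v i : ℕ) :
    (σ.setReg x v).reg i = if i = x then v else σ.reg i := by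
  simp [State.setReg, Function.update_apply]

@[simp] theorem State.setReg_arr (σ : State) (x v : ℕ) : (σ.setReg x v).arr = σ.arr := rfl

@[simp] theorem State.setArr_reg (σ : State) (a i v : ℕ) : (σ.setArr a i v).reg = σ.reg := rfl

@[simp] theorem State.setArr_arr (σ : State) (a i v b : ℕ) :
    (σ.setArr a i v).arr b = if b = a then Function.update (σ.arr a) i v else σ.arr b := by
  simp [State.setArr, Function.update_apply]

/-- All registers and cells contain values up to `B`. -/
structure State.Bounded (B : ℕ) (σ : State) : Prop where
  reg : ∀ i, σ.reg i ≤ B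
  arr : ∀ a i, σ.arr a i ≤ B

/-- The condition under which an instruction does not leave the range of words up to `B`. -/
def Instr.Safe (B : ℕ) : Instr → State → Prop
  | .const _ c, _ => c ≤ B
  | .add _ y z, σ => σ.reg y + σ.reg z ≤ B
  | .mul _ y z, σ => σ.reg y * σ.reg z ≤ B
  | _, _ => True

theorem Instr.Safe.value_le {B : ℕ} {i : Instr} {σ : State} (h : i.Safe B σ) (hσ : σ.Bounded B) :
    i.value σ ≤ B := by
  cases i with
  | const x c => exact h
  | copy x y => exact hσ.reg y
  | add x y z => exact h
  | sub x y z => exact (Nat.sub_le _ _).trans (hσ.reg y)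
  | mul x y z => exact h
  | div x y z => exact (Nat.div_le_self _ _).trans (hσ.reg y)
  | load x a y => exact hσ.arr a _
  | store a x y => exact hσ.reg y

theorem Instr.bounded_run {B : ℕ} {i : Instr} {σ : State} (h : i.value σ ≤ B) (hσ : σ.Bounded B) :
    (i.run σ).Bounded B := by
  have hr : ∀ x v, v ≤ B → (σ.setReg x v).Bounded B := fun x v hv ↦
    ⟨fun i ↦ by simp only [State.setReg_reg]; split_ifs; exacts [hv, hσ.reg i], hσ.arr⟩
  cases i with
  | store a x y =>
    refine ⟨hσ.reg, fun b i ↦ ?_⟩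
    simp only [Instr.run, State.setArr_arr]
    split_ifs
    · rw [Function.update_apply]
      split_ifs
      exacts [h, hσ.arr a i]
    · exact hσ.arr b i
  | _ => exact hr _ _ h

variable {m : ℕ} {w : Fin m → ℝ} {B : ℕ} {P P' : Program} {b : Test} {σ τ : State} {t T T' : ℕ}
  {Q Q' : State → Prop}

theorem Exec.bounded (h : Exec w B P σ t τ) (hσ : σ.Bounded B) : τ.Bounded B := by
  induction h with
  | instr h => exact Instr.bounded_run h hσ
  | seq _ _ ih ih' => exact ih' (ih hσ)
  | iteTrue _ _ ih => exact ih hσ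
  | iteFalse _ _ ih => exact ih hσ
  | loopTrue _ _ _ ih ih' => exact ih' (ih hσ)
  | loopFalse _ => exact hσ

/-- Started in a bounded state, the program halts after at most `T` steps in a state that satisfies
`Q`. -/
def Halts (w : Fin m → ℝ) (B : ℕ) (P : Program) (σ : State) (T : ℕ) (Q : State → Prop) : Prop :=
  σ.Bounded B → ∃ t τ, Exec w B P σ t τ ∧ t ≤ T ∧ Q τ

theorem Halts.mono (h : Halts w B P σ T Q) (hT : T ≤ T') (hQ : ∀ τ, Q τ → Q' τ) :
    Halts w B P σ T' Q' := fun hσ ↦ by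
  obtain ⟨t, τ, h1, h2, h3⟩ := h hσ
  exact ⟨t, τ, h1, h2.trans hT, hQ τ h3⟩

theorem Halts.seq (h : Halts w B P σ T fun τ ↦ Halts w B P' τ T' Q) :
    Halts w B (.seq P P') σ (T + T') Q := fun hσ ↦ by
  obtain ⟨t, τ, h1, h2, h3⟩ := h hσ
  obtain ⟨t', τ', h1', h2', h3'⟩ := h3 (h1.bounded hσ)
  exact ⟨_, τ', .seq h1 h1', add_le_add h2 h2', h3'⟩

theorem Halts.ite (h : b.Holds w σ → Halts w B P σ T Q) (h' : ¬ b.Holds w σ → Halts w B P' σ T Q) :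
    Halts w B (.ite b P P') σ (T + 1) Q := fun hσ ↦ by
  by_cases hb : b.Holds w σ
  · obtain ⟨t, τ, h1, h2, h3⟩ := h hb hσ
    exact ⟨_, τ, .iteTrue hb h1, by omega, h3⟩
  · obtain ⟨t, τ, h1, h2, h3⟩ := h' hb hσ
    exact ⟨_, τ, .iteFalse hb h1, by omega, h3⟩

/-- A loop with an invariant `I` that is indexed by auxiliary data, and a potential `Φ` that pays
for the steps. -/
theorem Halts.loop {ι : Type*} (I : ι → State → Prop) (Φ : ι → ℕ)
    (hI : ∀ a σ, I a σ → b.Holds w σ → ∃ T, Halts w B P σ T fun τ ↦ ∃ a', I a' τ ∧ Φ a' + T + 1 ≤ Φ a)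
    (hQ : ∀ a σ, I a σ → ¬ b.Holds w σ → Q σ) {a : ι} (ha : I a σ) :
    Halts w B (.loop b P) σ (Φ a + 1) Q := by
  induction h : Φ a using Nat.strong_induction_on generalizing a σ with
  | _ k ih =>
    intro hσ
    by_cases hb : b.Holds w σ
    · obtain ⟨T, hT⟩ := hI a σ ha hb
      obtain ⟨t, τ, h1, h2, a', ha', hΦ⟩ := hT hσ
      obtain ⟨t', τ', h1', h2', h3'⟩ := ih (Φ a') (by omega) ha' rfl (h1.bounded hσ)
      exact ⟨_, τ', .loopTrue hb h1 h1', by omega, h3'⟩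
    · exact ⟨1, σ, .loopFalse hb, by omega, hQ a σ ha hb⟩

/-- A straight-line program. -/
def code : List Instr → Program
  -- The language has no empty program, so the end is an instruction without effect. It accounts for
  -- the extra step in `Halts.code`.
  | [] => .instr (.copy 0 0)
  | i :: l => .seq (.instr i) (code l)

def runAll : List Instr → State → State
  | [], σ => σ
  | i :: l, σ => runAll l (i.run σ)

def SafeAll (B : ℕ) : List Instr → State → Prop
  | [], _ => True
  | i :: l, σ => i.Safe B σ ∧ SafeAll B l (i.run σ)

theorem Halts.code {l : List Instr} (h : SafeAll B l σ) (hQ : Q (runAll l σ)) :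
    Halts w B (code l) σ (l.length + 1) Q := by
  induction l generalizing σ with
  | nil =>
    intro hσ
    have := Exec.instr (w := w) (i := .copy 0 0) (hσ.reg 0)
    have h0 : (Instr.copy 0 0).run σ = σ := by
      simp [Instr.run, Instr.value, State.setReg]
    rw [h0] at this
    exact ⟨1, σ, this, le_rfl, hQ⟩
  | cons i l ih =>
    intro hσ
    have h1 := Exec.instr (w := w) (h.1.value_le hσ)
    obtain ⟨t, τ, h2, h3, h4⟩ := ih h.2 hQ (h1.bounded hσ)
    exact ⟨_, τ, .seq h1 h2, by simp; omega, h4⟩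

/-- The weights, extended to all indices. -/
noncomputable def wt (w : Fin m → ℝ) (i : ℕ) : ℝ := if h : i < m then w ⟨i, h⟩ else 0

theorem wt_val (w : Fin m → ℝ) (e : Fin m) : wt w e = w e := by simp [wt]

/-- The test fails for an index out of range. So the index `m` can stand for the missing tree edge
at position 0. -/
theorem holds_weightLt {x y : ℕ} : (Test.weightLt x y).Holds w σ ↔
    σ.reg x < m ∧ σ.reg y < m ∧ wt w (σ.reg x) < wt w (σ.reg y) := by
  simp only [Test.Holds, wt]
  constructor
  · rintro ⟨hx, hy, h⟩
    exact ⟨hx, hy, by simpa [hx, hy] using h⟩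
  · rintro ⟨hx, hy, h⟩
    exact ⟨hx, hy, by simpa [hx, hy] using h⟩

/-- Registers 0, 1, 3, 4, 5 hold `n`, `m` and the constants 1, 2, 0. -/
structure Consts (n m : ℕ) (σ : State) : Prop where
  r0 : σ.reg 0 = n
  r1 : σ.reg 1 = m
  r3 : σ.reg 3 = 1
  r4 : σ.reg 4 = 2
  r5 : σ.reg 5 = 0

theorem Consts.congr {n m : ℕ} (h : Consts n m σ) (hr : ∀ i < 6, τ.reg i = σ.reg i) : Consts n m τ :=
  ⟨by rw [hr 0 (by norm_num), h.r0], by rw [hr 1 (by norm_num), h.r1],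
    by rw [hr 3 (by norm_num), h.r3], by rw [hr 4 (by norm_num), h.r4],
    by rw [hr 5 (by norm_num), h.r5]⟩

end Machine

/-! ### A tournament tree as the priority queue of the search. -/

section Tournament

variable {m : ℕ} {w : Fin m → ℝ} {B n : ℕ} {σ : State} {tail tail' : ℕ → ℕ} {a b c : ℕ}

/-- The candidate `a` is at least as good as `b`: it is lighter, or equally heavy with a later tail.
A candidate is `0` or the successor of an edge. -/
def Better (w : Fin m → ℝ) (tail : ℕ → ℕ) (a b : ℕ) : Prop :=
  b = 0 ∨ (a ≠ 0 ∧ (wt w (a - 1) < wt w (b - 1) ∨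
    (wt w (a - 1) = wt w (b - 1) ∧ tail (b - 1) ≤ tail (a - 1))))

theorem Better.refl (w : Fin m → ℝ) (tail : ℕ → ℕ) (a : ℕ) : Better w tail a a := by
  by_cases h : a = 0
  · exact .inl h
  · exact .inr ⟨h, .inr ⟨rfl, le_rfl⟩⟩

theorem Better.trans (h : Better w tail a b) (h' : Better w tail b c) : Better w tail a c := by
  rcases h' with h' | ⟨hb, h'⟩
  · exact .inl h'
  · rcases h with h | ⟨ha, h⟩
    · exact absurd h hb
    · refine .inr ⟨ha, ?_⟩
      rcases h with h | h <;> rcases h' with h' | h'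
      · exact .inl (h.trans h')
      · exact .inl (h'.1 ▸ h)
      · exact .inl (h.1 ▸ h')
      · exact .inr ⟨h.1.trans h'.1, h'.2.trans h.2⟩

/-- For use when the tail of an edge that is not a candidate is overwritten. -/
theorem Better.congr (h : Better w tail a b) (ha : a ≠ 0 → tail' (a - 1) = tail (a - 1))
    (hb : b ≠ 0 → tail' (b - 1) = tail (b - 1)) : Better w tail' a b := by
  by_cases hb0 : b = 0
  · exact .inl hb0
  · obtain ⟨ha0, h⟩ := h.resolve_left hb0
    exact .inr ⟨ha0, by rwa [ha ha0, hb hb0]⟩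

/-- Writes the better of the candidates in registers 25 and 26 into register 27. -/
def chooseProg : Program :=
  .ite (.eq 25 5) (code [.copy 27 26])
    (.ite (.eq 26 5) (code [.copy 27 25])
      (.seq (code [.sub 28 25 3, .sub 29 26 3])
        (.ite (.weightLt 28 29) (code [.copy 27 25])
          (.ite (.weightLt 29 28) (code [.copy 27 26])
            (.seq (code [.load 28 8 28, .load 29 8 29])
              (.ite (.lt 28 29) (code [.copy 27 26]) (code [.copy 27 25])))))))

theorem halts_chooseProg (hc : Consts n m σ) (hl : σ.reg 25 ≤ m) (hr : σ.reg 26 ≤ m) :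
    Halts w B chooseProg σ 13 fun τ ↦ τ.arr = σ.arr ∧ (∀ i < 27, τ.reg i = σ.reg i) ∧
      (τ.reg 27 = σ.reg 25 ∨ τ.reg 27 = σ.reg 26) ∧
      Better w (σ.arr 8) (τ.reg 27) (σ.reg 25) ∧ Better w (σ.arr 8) (τ.reg 27) (σ.reg 26) := by
  have h3 := hc.r3
  have h5 := hc.r5
  have left : ∀ {σ' : State}, σ'.arr = σ.arr → (∀ i < 27, σ'.reg i = σ.reg i) →
      Better w (σ.arr 8) (σ.reg 25) (σ.reg 26) → Halts w B (code [.copy 27 25]) σ' 2 fun τ ↦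
        τ.arr = σ.arr ∧ (∀ i < 27, τ.reg i = σ.reg i) ∧
        (τ.reg 27 = σ.reg 25 ∨ τ.reg 27 = σ.reg 26) ∧
        Better w (σ.arr 8) (τ.reg 27) (σ.reg 25) ∧ Better w (σ.arr 8) (τ.reg 27) (σ.reg 26) := by
    intro σ' ha hr hb
    have h25 := hr 25 (by norm_num)
    refine Halts.code (by simp [SafeAll, Instr.Safe]) ?_
    simp only [runAll, Instr.run, Instr.value, State.setReg_arr, State.setReg_reg, h25, if_true]
    refine ⟨ha, fun i hi ↦ ?_, .inl trivial, .refl _ _ _, hb⟩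
    rw [if_neg (by omega), hr i hi]
  have right : ∀ {σ' : State}, σ'.arr = σ.arr → (∀ i < 27, σ'.reg i = σ.reg i) →
      Better w (σ.arr 8) (σ.reg 26) (σ.reg 25) → Halts w B (code [.copy 27 26]) σ' 2 fun τ ↦
        τ.arr = σ.arr ∧ (∀ i < 27, τ.reg i = σ.reg i) ∧
        (τ.reg 27 = σ.reg 25 ∨ τ.reg 27 = σ.reg 26) ∧
        Better w (σ.arr 8) (τ.reg 27) (σ.reg 25) ∧ Better w (σ.arr 8) (τ.reg 27) (σ.reg 26) := by
    intro σ' ha hr hb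
    have h26 := hr 26 (by norm_num)
    refine Halts.code (by simp [SafeAll, Instr.Safe]) ?_
    simp only [runAll, Instr.run, Instr.value, State.setReg_arr, State.setReg_reg, h26, if_true]
    refine ⟨ha, fun i hi ↦ ?_, .inr trivial, hb, .refl _ _ _⟩
    rw [if_neg (by omega), hr i hi]
  refine Halts.ite (T := 12) (fun hb ↦ (right rfl (fun _ _ ↦ rfl) (.inl ?_)).mono (by omega) fun _ h ↦ h)
    fun h25 ↦ Halts.ite (T := 11) (fun hb ↦ (left rfl (fun _ _ ↦ rfl) (.inl ?_)).mono (by omega)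
      fun _ h ↦ h) fun h26 ↦ ?_
  · rwa [← h5]
  · rwa [← h5]
  have h25 : σ.reg 25 ≠ 0 := h5 ▸ h25
  have h26 : σ.reg 26 ≠ 0 := h5 ▸ h26
  refine Halts.seq (T := 3) (T' := 8) (Halts.code (by simp [SafeAll, Instr.Safe]) ?_)
  set σ₁ := runAll [.sub 28 25 3, .sub 29 26 3] σ with hσ₁
  have ha₁ : σ₁.arr = σ.arr := rfl
  have hr₁ : ∀ i < 28, σ₁.reg i = σ.reg i := fun i hi ↦ by
    simp [hσ₁, runAll, Instr.run, Instr.value, show i ≠ 28 by omega, show i ≠ 29 by omega]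
  have h28 : σ₁.reg 28 = σ.reg 25 - 1 := by simp [hσ₁, runAll, Instr.run, Instr.value, h3]
  have h29 : σ₁.reg 29 = σ.reg 26 - 1 := by simp [hσ₁, runAll, Instr.run, Instr.value, h3]
  refine Halts.ite (T := 7) (fun hb ↦ (left ha₁ (fun i hi ↦ hr₁ i (by omega))
    (.inr ⟨h25, .inl ?_⟩)).mono (by omega) fun _ h ↦ h) fun hn ↦
      Halts.ite (T := 6) (fun hb ↦ (right ha₁ (fun i hi ↦ hr₁ i (by omega))
        (.inr ⟨h26, .inl ?_⟩)).mono (by omega) fun _ h ↦ h) fun hn' ↦ ?_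
  · rw [holds_weightLt, h28, h29] at hb; exact hb.2.2
  · rw [holds_weightLt, h28, h29] at hb; exact hb.2.2
  rw [holds_weightLt, h28, h29] at hn hn'
  have heq : wt w (σ.reg 25 - 1) = wt w (σ.reg 26 - 1) := by
    refine le_antisymm ?_ ?_
    · by_contra! hlt; exact hn' ⟨by omega, by omega, hlt⟩
    · by_contra! hlt; exact hn ⟨by omega, by omega, hlt⟩
  refine Halts.seq (T := 3) (T' := 3) (Halts.code (by simp [SafeAll, Instr.Safe]) ?_)
  set σ₂ := runAll [.load 28 8 28, .load 29 8 29] σ₁ with hσ₂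
  have ha₂ : σ₂.arr = σ.arr := rfl
  have hr₂ : ∀ i < 28, σ₂.reg i = σ.reg i := fun i hi ↦ by
    rw [← hr₁ i hi]
    simp [hσ₂, runAll, Instr.run, Instr.value, show i ≠ 28 by omega, show i ≠ 29 by omega]
  have h28' : σ₂.reg 28 = σ.arr 8 (σ.reg 25 - 1) := by
    simp [hσ₂, runAll, Instr.run, Instr.value, h28, ha₁]
  have h29' : σ₂.reg 29 = σ.arr 8 (σ.reg 26 - 1) := by
    simp [hσ₂, runAll, Instr.run, Instr.value, h29, ha₁]
  refine Halts.ite (T := 2) (fun hb ↦ right ha₂ (fun i hi ↦ hr₂ i (by omega)) (.inr ⟨h26, .inr ?_⟩))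
    fun hb ↦ left ha₂ (fun i hi ↦ hr₂ i (by omega)) (.inr ⟨h25, .inr ?_⟩)
  · simp only [Test.Holds, h28', h29'] at hb
    exact ⟨heq.symm, hb.le⟩
  · simp only [Test.Holds, h28', h29', not_lt] at hb
    exact ⟨heq, hb⟩

/-- The inner node `i` of a tournament holds the better one of the candidates of its children. -/
def NodeOk (w : Fin m → ℝ) (tail t : ℕ → ℕ) (i : ℕ) : Prop :=
  (t i = t (2 * i) ∨ t i = t (2 * i + 1)) ∧
    Better w tail (t i) (t (2 * i)) ∧ Better w tail (t i) (t (2 * i + 1))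

/-- A tournament with the leaves `n, …, 2 n - 1`. -/
def IsTournament (w : Fin m → ℝ) (n : ℕ) (tail t : ℕ → ℕ) : Prop :=
  ∀ i, 0 < i → i < n → NodeOk w tail t i

/-- Descend to the child that supplied the winner. -/
theorem IsTournament.exists_leaf {t : ℕ → ℕ} (h : IsTournament w n tail t) {i : ℕ} (h0 : 0 < i)
    (hi : i < 2 * n) : ∃ x < n, t i = t (n + x) := by
  induction hk : 2 * n - i using Nat.strong_induction_on generalizing i with
  | _ k ih =>
    by_cases hn : n ≤ i
    · exact ⟨i - n, by omega, by congr 1; omega⟩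
    · rcases (h i h0 (by omega)).1 with he | he <;> rw [he]
      · exact ih (2 * n - 2 * i) (by omega) (by omega) (by omega) rfl
      · exact ih (2 * n - (2 * i + 1)) (by omega) (by omega) (by omega) rfl

theorem IsTournament.better_root {t : ℕ → ℕ} (h : IsTournament w n tail t) {i : ℕ} (h0 : 0 < i)
    (hi : i < 2 * n) : Better w tail (t 1) (t i) := by
  induction i using Nat.strong_induction_on with
  | _ i ih =>
    by_cases h1 : i = 1
    · subst h1; exact .refl _ _ _
    · have hp := h (i / 2) (by omega) (by omega)
      refine (ih (i / 2) (by omega) (by omega) (by omega)).trans ?_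
      rcases Nat.mod_two_eq_zero_or_one i with hm | hm
      · have := hp.2.1; rwa [show 2 * (i / 2) = i by omega] at this
      · have := hp.2.2; rwa [show 2 * (i / 2) + 1 = i by omega] at this

/-- Recomputes the tournament above the leaf of the vertex in register 19. -/
def updateProg : Program :=
  .seq (code [.add 20 0 19, .div 20 20 4])
    (.loop (.ne 20 5)
      (.seq (code [.mul 21 20 4, .load 25 9 21, .add 21 21 3, .load 26 9 21])
        (.seq chooseProg (code [.store 9 20 27, .div 20 20 4]))))

/-- A changed leaf can spoil only its parent. Each round repairs one node, after which at most the
ancestors of this node are wrong. The bound `2 ^ d` on the current node limits the number of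
remaining rounds. -/
theorem halts_updateProg (hc : Consts n m σ) (hB : 2 * n ≤ B) {x L : ℕ} (hx : σ.reg 19 = x)
    (hxn : x < n) (hL : n ≤ 2 ^ L) (ht : ∀ i, σ.arr 9 i ≤ m)
    (hok : ∀ i, 0 < i → i < n → i ≠ (n + x) / 2 → NodeOk w (σ.arr 8) (σ.arr 9) i) :
    Halts w B updateProg σ (22 * L + 4) fun τ ↦ (∀ a ≠ 9, τ.arr a = σ.arr a) ∧
      (∀ i < 20, τ.reg i = σ.reg i) ∧ IsTournament w n (σ.arr 8) (τ.arr 9) ∧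
      (∀ i, n ≤ i → τ.arr 9 i = σ.arr 9 i) ∧ ∀ i, τ.arr 9 i ≤ m := by
  have h0 := hc.r0
  have h4 := hc.r4
  refine (Halts.seq (T := 3) (T' := 22 * L + 1) (Halts.code ?_ ?_)).mono (by omega) fun _ h ↦ h
  · simp [SafeAll, Instr.Safe, h0, hx]; omega
  refine Halts.loop (fun (d : ℕ) (ρ : State) ↦ (∀ a ≠ 9, ρ.arr a = σ.arr a) ∧
    (∀ i < 20, ρ.reg i = σ.reg i) ∧ ρ.reg 20 < n ∧ ρ.reg 20 < 2 ^ d ∧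
    (∀ i, 0 < i → i < n → (∀ k, ρ.reg 20 / 2 ^ k ≠ i) → NodeOk w (σ.arr 8) (ρ.arr 9) i) ∧
      (∀ i, n ≤ i → ρ.arr 9 i = σ.arr 9 i) ∧ ∀ i, ρ.arr 9 i ≤ m) (fun d ↦ 22 * d) ?_ ?_ ?_
  · rintro d ρ ⟨ha, hr, hn, hd, hok, hlf, hm⟩ hb
    have hcρ : Consts n m ρ := hc.congr fun i hi ↦ hr i (by omega)
    have h3 := hcρ.r3
    have h4 := hcρ.r4
    have h5 := hcρ.r5
    simp only [Test.Holds, h5] at hb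
    refine ⟨21, (Halts.seq (T := 5) (T' := 16) (Halts.code ?_ ?_)).mono (by omega) fun _ h ↦ h⟩
    · simp [SafeAll, Instr.Safe, Instr.run, Instr.value, h3, h4]; omega
    set ρ₁ := runAll [.mul 21 20 4, .load 25 9 21, .add 21 21 3, .load 26 9 21] ρ with hρ₁
    have ha₁ : ρ₁.arr = ρ.arr := rfl
    have hr₁ : ∀ i < 21, ρ₁.reg i = ρ.reg i := fun i hi ↦ by
      simp [hρ₁, runAll, Instr.run, Instr.value, show i ≠ 21 by omega, show i ≠ 25 by omega,
        show i ≠ 26 by omega]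
    have h25 : ρ₁.reg 25 = ρ.arr 9 (2 * ρ.reg 20) := by
      simp [hρ₁, runAll, Instr.run, Instr.value, h4, mul_comm]
    have h26 : ρ₁.reg 26 = ρ.arr 9 (2 * ρ.reg 20 + 1) := by
      simp [hρ₁, runAll, Instr.run, Instr.value, h4, h3, mul_comm]
    refine (Halts.seq (T := 13) (T' := 3) ((halts_chooseProg (n := n)
      (hcρ.congr fun i hi ↦ hr₁ i (by omega)) ?_ ?_).mono le_rfl ?_)).mono (by omega) fun _ h ↦ h
    · rw [h25]; exact hm _
    · rw [h26]; exact hm _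
    rintro ρ₂ ⟨ha₂, hr₂, hv, hb1, hb2⟩
    rw [ha₁, ha 8 (by norm_num), h25] at hb1
    rw [ha₁, ha 8 (by norm_num), h26] at hb2
    rw [h25, h26] at hv
    refine Halts.code (by simp [SafeAll, Instr.Safe]) ⟨d - 1, ?_, ?_⟩
    · have h20 : ρ₂.reg 20 = ρ.reg 20 := by rw [hr₂ 20 (by norm_num), hr₁ 20 (by norm_num)]
      have h24 : ρ₂.reg 4 = 2 := by rw [hr₂ 4 (by norm_num), hr₁ 4 (by norm_num), h4]
      simp only [runAll, Instr.run, Instr.value, State.setReg_arr, State.setReg_reg, State.setArr_arr,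
        State.setArr_reg, h20, h24, if_true, ha₂, ha₁]
      have hcur : ∀ i, i ≠ ρ.reg 20 → Function.update (ρ.arr 9) (ρ.reg 20) (ρ₂.reg 27) i = ρ.arr 9 i :=
        fun i hi ↦ Function.update_of_ne hi _ _
      refine ⟨fun a h ↦ ?_, fun i hi ↦ ?_, by omega, ?_, fun i hi0 hin hk ↦ ?_, fun i hi ↦ ?_, fun i ↦ ?_⟩
      · rw [if_neg h, ha a h]
      · rw [if_neg (by omega), hr₂ i (by omega), hr₁ i (by omega), hr i hi]
      · rcases d with _ | d
        · simp at hd; omega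
        · rw [pow_succ] at hd; simp; omega
      · by_cases hic : i = ρ.reg 20
        · subst hic
          rw [NodeOk, hcur (2 * ρ.reg 20) (by omega), hcur (2 * ρ.reg 20 + 1) (by omega),
            Function.update_self]
          exact ⟨hv, hb1, hb2⟩
        · have h1 : i ≠ ρ.reg 20 / 2 := fun h ↦ hk 0 (by simp [h])
          rw [NodeOk, hcur i hic, hcur (2 * i) (by omega), hcur (2 * i + 1) (by omega)]
          refine hok i hi0 hin fun k hk' ↦ ?_
          rcases k with _ | k
          · exact hic (by simpa using hk'.symm)
          · refine hk k ?_
            rw [Nat.div_div_eq_div_mul, ← pow_succ', hk']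
      · rw [hcur i (by omega), hlf i hi]
      · by_cases hic : i = ρ.reg 20
        · subst hic
          rw [Function.update_self]
          rcases hv with hv | hv <;> rw [hv] <;> exact hm _
        · rw [hcur i hic]; exact hm i
    · have : d ≠ 0 := by rintro rfl; simp at hd; omega
      simp; omega
  · rintro d ρ ⟨ha, hr, hn, hd, hok, hlf, hm⟩ hb
    have h5 : ρ.reg 5 = 0 := (hc.congr fun i hi ↦ hr i (by omega) : Consts n m ρ).r5
    simp only [Test.Holds, h5, not_not] at hb
    refine ⟨ha, hr, fun i h0 hi ↦ hok i h0 hi fun k ↦ ?_, hlf, hm⟩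
    rw [hb, Nat.zero_div]
    omega
  · simp only [runAll, Instr.run, Instr.value, State.setReg_arr, State.setReg_reg, h0, h4, hx]
    simp
    have : (n + x) / 2 < n := by omega
    refine ⟨fun i hi ↦ ?_, this, this.trans_le hL, fun i hi0 hin hk ↦ hok i hi0 hin fun h ↦ ?_, ht⟩
    · rw [if_neg (by omega), if_neg (by omega)]
    · exact hk 0 (by simp [h])

end Tournament

/-! ### Half-edges, adjacency lists and their traversal. -/

section Adjacency

variable {m : ℕ} {w : Fin m → ℝ} {B n : ℕ} {σ : State} {U V hd nx : ℕ → ℕ} {h : ℕ} {H : Set ℕ}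

/-! The half-edges `h < m` and `m + h` are the two directions of the edge `h`. -/

def hEdge (m h : ℕ) : ℕ := if h < m then h else h - m

def hSrc (m : ℕ) (U V : ℕ → ℕ) (h : ℕ) : ℕ := if h < m then U h else V (h - m)

def hDst (m : ℕ) (U V : ℕ → ℕ) (h : ℕ) : ℕ := if h < m then V h else U (h - m)

theorem hEdge_lt (hh : h < 2 * m) : hEdge m h < m := by
  unfold hEdge; split_ifs <;> omega

/-- Two half-edges of the same edge are equal or opposite. -/
theorem eq_or_opposite {h' : ℕ} (he : hEdge m h = hEdge m h') :
    h = h' ∨ (hSrc m U V h = hDst m U V h' ∧ hDst m U V h = hSrc m U V h') := by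
  unfold hEdge at he
  unfold hSrc hDst
  split_ifs at he ⊢ <;> simp_all
  omega

/-- The linked list that starts with the entry `c` of `l`; `0` is the end, and `h + 1` stands for
the half-edge `h`. -/
def IsChain (nx : ℕ → ℕ) : ℕ → List ℕ → Prop
  | c, [] => c = 0
  | c, h :: l => c = h + 1 ∧ IsChain nx (nx h) l

theorem IsChain.update {v : ℕ} : ∀ {c : ℕ} {l : List ℕ}, IsChain nx c l → h ∉ l →
    IsChain (Function.update nx h v) c l
  | _, [], hc, _ => hc
  | _, a :: l, hc, hl => by
    rw [List.mem_cons, not_or] at hl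
    refine ⟨hc.1, ?_⟩
    rw [Function.update_of_ne (Ne.symm hl.1)]
    exact hc.2.update hl.2

/-- The linked lists contain the half-edges in `H`, ordered by their sources. -/
def IsAdjacency (m : ℕ) (U V : ℕ → ℕ) (H : Set ℕ) (hd nx : ℕ → ℕ) : Prop :=
  ∀ x, ∃ l, IsChain nx (hd x) l ∧ l.Nodup ∧ ∀ h, h ∈ l ↔ h ∈ H ∧ hSrc m U V h = x

theorem IsAdjacency.insert (ha : IsAdjacency m U V H hd nx) (hh : h ∉ H) {x : ℕ}
    (hx : hSrc m U V h = x) : IsAdjacency m U V (insert h H) (Function.update hd x (h + 1))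
      (Function.update nx h (hd x)) := by
  intro y
  obtain ⟨l, h1, h2, h3⟩ := ha y
  have hl : h ∉ l := fun hl ↦ hh ((h3 h).1 hl).1
  by_cases hy : y = x
  · subst hy
    refine ⟨h :: l, ⟨by simp, ?_⟩, List.nodup_cons.2 ⟨hl, h2⟩, fun h' ↦ ?_⟩
    · rw [Function.update_self]
      exact h1.update hl
    · rw [List.mem_cons, h3, Set.mem_insert_iff]
      constructor
      · rintro (rfl | h')
        · exact ⟨.inl rfl, hx⟩
        · exact ⟨.inr h'.1, h'.2⟩
      · rintro ⟨rfl | h', hs⟩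
        · exact .inl rfl
        · exact .inr ⟨h', hs⟩
  · refine ⟨l, ?_, h2, fun h' ↦ ?_⟩
    · rw [Function.update_of_ne hy]
      exact h1.update hl
    · rw [h3, Set.mem_insert_iff]
      constructor
      · exact fun h' ↦ ⟨.inr h'.1, h'.2⟩
      · rintro ⟨rfl | h', hs⟩
        · exact absurd (hs.symm.trans hx) hy
        · exact ⟨h', hs⟩

/-- Builds the adjacency lists in the arrays 3 and 4. -/
def buildProg : Program :=
  .loop (.lt 6 1) (code [.load 7 0 6, .load 8 3 7, .store 4 6 8, .add 9 6 3, .store 3 7 9,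
    .load 7 1 6, .load 8 3 7, .add 10 6 1, .store 4 10 8, .add 10 10 3, .store 3 7 10, .add 6 6 3])

theorem halts_buildProg (hc : Consts n m σ) (hB : 2 * m ≤ B) (h6 : σ.reg 6 = 0)
    (hU : σ.arr 0 = U) (hV : σ.arr 1 = V) (hz : ∀ i, σ.arr 3 i = 0) :
    Halts w B buildProg σ (14 * m + 1) fun τ ↦ (∀ i < 6, τ.reg i = σ.reg i) ∧
      (∀ a, a ≠ 3 → a ≠ 4 → τ.arr a = σ.arr a) ∧
      IsAdjacency m U V {h | h < 2 * m} (τ.arr 3) (τ.arr 4) := by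
  refine (Halts.loop (fun (e : ℕ) (ρ : State) ↦ (∀ i < 6, ρ.reg i = σ.reg i) ∧
    (∀ a, a ≠ 3 → a ≠ 4 → ρ.arr a = σ.arr a) ∧ ρ.reg 6 = e ∧ e ≤ m ∧
      IsAdjacency m U V {h | h < e ∨ (m ≤ h ∧ h < m + e)} (ρ.arr 3) (ρ.arr 4))
      (fun e ↦ 14 * (m - e)) (a := 0) ?_ ?_ ?_).mono (by simp) fun _ h ↦ h
  · rintro e ρ ⟨hr, ha, h6, he, had⟩ hb
    have hcρ := hc.congr hr
    have h1 := hcρ.r1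
    have h3 := hcρ.r3
    simp only [Test.Holds, h6, h1] at hb
    refine ⟨13, Halts.code ?_ ⟨e + 1, ?_, by omega⟩⟩
    · simp [SafeAll, Instr.Safe, Instr.run, Instr.value, h1, h3, h6]; omega
    · have h0 : ρ.arr 0 = U := (ha 0 (by norm_num) (by norm_num)).trans hU
      have h1' : ρ.arr 1 = V := (ha 1 (by norm_num) (by norm_num)).trans hV
      simp only [runAll, Instr.run, Instr.value, State.setReg_arr, State.setReg_reg, State.setArr_arr,
        State.setArr_reg, h1, h3, h6, h0, h1']
      simp only [Nat.reduceEqDiff, if_true, if_false]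
      refine ⟨fun i hi ↦ ?_, fun a ha3 ha4 ↦ ?_, trivial, hb, ?_⟩
      · simp [show i ≠ 6 by omega, show i ≠ 7 by omega, show i ≠ 8 by omega, show i ≠ 9 by omega,
          show i ≠ 10 by omega, hr i hi]
      · simp [ha3, ha4, ha a ha3 ha4]
      · have h2 := had.insert (h := e) (x := U e) (by simp; omega) (by simp [hSrc, hb])
        have h3 := h2.insert (h := e + m) (x := V e) (by simp; omega) (by simp [hSrc])
        convert h3 using 1
        ext i
        simp
        omega
  · rintro e ρ ⟨hr, ha, h6, he, had⟩ hb
    simp only [Test.Holds, h6, (hc.congr hr).r1] at hb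
    refine ⟨hr, ha, ?_⟩
    convert had using 1
    ext i
    simp
    omega
  · refine ⟨fun _ _ ↦ rfl, fun _ _ _ ↦ rfl, h6, by omega, fun x ↦ ⟨[], hz x, by simp, by simp⟩⟩

/-- Runs `body` for all half-edges with the source in register 7. During the run of `body`, the
registers 11, 12, 13 hold the half-edge, its edge and its target. -/
def scanProg (body : Program) : Program :=
  .seq (code [.load 10 3 7]) (.loop (.ne 10 5) (.seq (code [.sub 11 10 3])
    (.seq (.ite (.lt 11 1) (code [.copy 12 11, .load 13 1 11]) (code [.sub 12 11 1, .load 13 0 12]))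
      (.seq body (code [.load 10 4 11])))))

/-- The arrays that hold the graph are unchanged. -/
def SameGraph (σ τ : State) : Prop :=
  τ.arr 0 = σ.arr 0 ∧ τ.arr 1 = σ.arr 1 ∧ τ.arr 3 = σ.arr 3 ∧ τ.arr 4 = σ.arr 4

theorem SameGraph.trans {σ τ ρ : State} (h : SameGraph σ τ) (h' : SameGraph τ ρ) : SameGraph σ ρ :=
  ⟨h'.1.trans h.1, h'.2.1.trans h.2.1, h'.2.2.1.trans h.2.2.1, h'.2.2.2.trans h.2.2.2⟩

theorem SameGraph.of_eq {σ τ : State} (h : τ.arr = σ.arr) : SameGraph σ τ := by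
  simp [SameGraph, h]

/-- The set in the invariant collects the half-edges treated so far, so that the body can use that
the current one is new. The invariant may depend only on the arrays and on registers below 10; the
scan itself needs registers 10 to 13. -/
theorem halts_scanProg (hc : Consts n m σ) {body : Program} {T : ℕ} {l : List ℕ} {H₀ : Set ℕ}
    (I : Set ℕ → State → Prop)
    (hI : ∀ H ρ τ, τ.arr = ρ.arr → (∀ i < 10, τ.reg i = ρ.reg i) → I H ρ → I H τ)
    (hl : IsChain (σ.arr 4) (σ.arr 3 (σ.reg 7)) l) (hn : l.Nodup) (hd : ∀ h ∈ l, h ∉ H₀)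
    (hbody : ∀ h ∈ l, ∀ H ρ, h ∉ H → I H ρ → SameGraph σ ρ → (∀ i < 10, ρ.reg i = σ.reg i) →
      ρ.reg 12 = hEdge m h → ρ.reg 13 = hDst m (σ.arr 0) (σ.arr 1) h →
      Halts w B body ρ T fun τ ↦ I (insert h H) τ ∧ SameGraph ρ τ ∧ ∀ i < 12, τ.reg i = ρ.reg i)
    (h0 : I H₀ σ) :
    Halts w B (scanProg body) σ ((T + 9) * l.length + 3) fun τ ↦
      I (H₀ ∪ {h | h ∈ l}) τ ∧ SameGraph σ τ ∧ ∀ i < 10, τ.reg i = σ.reg i := by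
  refine (Halts.seq (T := 2) (T' := (T + 9) * l.length + 1) (Halts.code ?_ ?_)).mono (by omega)
    fun _ h ↦ h
  · simp [SafeAll, Instr.Safe]
  refine (Halts.loop (fun (a : Set ℕ × List ℕ) (ρ : State) ↦ I a.1 ρ ∧ SameGraph σ ρ ∧
    (∀ i < 10, ρ.reg i = σ.reg i) ∧ IsChain (σ.arr 4) (ρ.reg 10) a.2 ∧ a.2.Nodup ∧
      (∀ h ∈ a.2, h ∉ a.1 ∧ h ∈ l) ∧ a.1 ∪ {h | h ∈ a.2} = H₀ ∪ {h | h ∈ l})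
      (fun a ↦ (T + 9) * a.2.length) (a := (H₀, l)) ?_ ?_ ?_).mono le_rfl fun _ h ↦ h
  · rintro ⟨H, l'⟩ ρ ⟨hIρ, hG, hr, hch, hnd, hdis, hun⟩ hb
    have hcρ := hc.congr fun i hi ↦ hr i (by omega)
    have h1 := hcρ.r1
    have h3 := hcρ.r3
    have h5 := hcρ.r5
    simp only [Test.Holds, h5] at hb
    obtain _ | ⟨h, l'⟩ := l'
    · exact absurd hch hb
    obtain ⟨h10, hch⟩ := hch
    rw [List.nodup_cons] at hnd
    refine ⟨T + 8, (Halts.seq (T := 2) (T' := T + 6) (Halts.code ?_ ?_)).mono (by omega) fun _ h ↦ h⟩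
    · simp [SafeAll, Instr.Safe]
    set ρ₁ := runAll [.sub 11 10 3] ρ with hρ₁
    have ha₁ : ρ₁.arr = ρ.arr := rfl
    have h11 : ρ₁.reg 11 = h := by simp [hρ₁, runAll, Instr.run, Instr.value, h10, h3]
    have hr₁ : ∀ i < 11, ρ₁.reg i = ρ.reg i := fun i hi ↦ by
      simp [hρ₁, runAll, Instr.run, Instr.value, show i ≠ 11 by omega]
    have h11' : ρ₁.reg 1 = m := by rw [hr₁ 1 (by norm_num), h1]
    refine (Halts.seq (T := 4) (T' := T + 2) (Halts.mono (T := 4) (Q := fun τ ↦ τ.arr = ρ.arr ∧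
      (∀ i < 12, τ.reg i = ρ₁.reg i) ∧ τ.reg 12 = hEdge m h ∧
        τ.reg 13 = hDst m (σ.arr 0) (σ.arr 1) h) ?_ le_rfl ?_)).mono (by omega) fun _ h ↦ h
    · refine Halts.ite (T := 3) (fun hb ↦ Halts.code (by simp [SafeAll, Instr.Safe]) ?_)
        fun hb ↦ Halts.code (by simp [SafeAll, Instr.Safe]) ?_ <;>
      simp only [Test.Holds, h11, h11'] at hb
      · simp [runAll, Instr.run, Instr.value, h11, ha₁, hEdge, hDst, hb, hG.2.1]
        exact fun i hi ↦ by rw [if_neg (by omega), if_neg (by omega)]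
      · simp [runAll, Instr.run, Instr.value, h11, h11', ha₁, hEdge, hDst, hb, hG.1]
        exact fun i hi ↦ by rw [if_neg (by omega), if_neg (by omega)]
    rintro ρ₂ ⟨ha₂, hr₂, h12, h13⟩
    have hr₂' : ∀ i < 10, ρ₂.reg i = ρ.reg i := fun i hi ↦ by
      rw [hr₂ i (by omega), hr₁ i (by omega)]
    have hd' := hdis h (by simp)
    refine (Halts.seq (T := T) (T' := 2) ((hbody h hd'.2 H ρ₂ hd'.1 (hI H ρ ρ₂ ha₂ hr₂' hIρ)
      (hG.trans (.of_eq ha₂)) (fun i hi ↦ (hr₂' i hi).trans (hr i hi)) h12 h13).mono le_rfl ?_)).mono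
      (by omega) fun _ h ↦ h
    rintro ρ₃ ⟨hI₃, hG₃, hr₃⟩
    have hG' : SameGraph σ ρ₃ := (hG.trans (.of_eq ha₂)).trans hG₃
    refine Halts.code (by simp [SafeAll, Instr.Safe]) ⟨(insert h H, l'), ?_, ?_⟩
    · have hrr : ∀ i < 10, (runAll [.load 10 4 11] ρ₃).reg i = ρ₃.reg i := fun i hi ↦ by
        simp [runAll, Instr.run, Instr.value, show i ≠ 10 by omega]
      refine ⟨hI _ ρ₃ _ rfl hrr hI₃, hG'.trans (.of_eq rfl), fun i hi ↦ ?_, ?_, hnd.2, ?_, ?_⟩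
      · rw [hrr i hi, hr₃ i (by omega), hr₂' i hi, hr i hi]
      · have : ρ₃.reg 11 = h := by rw [hr₃ 11 (by norm_num), hr₂ 11 (by norm_num), h11]
        simp only [runAll, Instr.run, Instr.value, State.setReg_reg, if_true, this, hG'.2.2.2]
        exact hch
      · intro h' hh'
        have := hdis h' (by simp [hh'])
        refine ⟨?_, this.2⟩
        rintro (rfl | hH)
        · exact hnd.1 hh'
        · exact this.1 hH
      · rw [← hun]
        ext i
        simp
        tauto
    · simp only [List.length_cons]
      ring_nf
      omega
  · rintro ⟨H, l'⟩ ρ ⟨hIρ, hG, hr, hch, hnd, hdis, hun⟩ hb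
    simp only [Test.Holds, (hc.congr fun i hi ↦ hr i (by omega) : Consts n m ρ).r5, not_not] at hb
    obtain _ | ⟨h, l'⟩ := l'
    · rw [← hun]
      exact ⟨by simpa using hIρ, hG, hr⟩
    · exact absurd (hch.1.symm.trans hb) (Nat.succ_ne_zero h)
  · have hrr : ∀ i < 10, (runAll [.load 10 3 7] σ).reg i = σ.reg i := fun i hi ↦ by
      simp [runAll, Instr.run, Instr.value, show i ≠ 10 by omega]
    refine ⟨hI _ σ _ rfl hrr h0, .of_eq rfl, hrr, ?_, hn, fun h hh ↦ ⟨hd h hh, hh⟩, rfl⟩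
    simpa [runAll, Instr.run, Instr.value] using hl

end Adjacency

/-! ### Invariants of the Prim search and their preservation. -/

section Search

variable {m : ℕ} {w : Fin m → ℝ} {B n : ℕ} {U V P ord te tl tail tail' t t' : ℕ → ℕ} {j x y h : ℕ}
  {H : Set ℕ}

/-- The state of the search with respect to the vertices that are not yet visited; `H` is the set of
the half-edges that have been scanned, `P` is `0` on the vertices that are not yet visited, and
elsewhere the successor of the position. -/
structure Frontier (w : Fin m → ℝ) (n : ℕ) (U V P tail t : ℕ → ℕ) (H : Set ℕ) : Prop where
  mem : ∀ h ∈ H, h < 2 * m ∧ P (hSrc m U V h) ≠ 0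
  visited : ∀ x < n, P x ≠ 0 → t (n + x) = 0
  best : ∀ h ∈ H, P (hDst m U V h) = 0 → t (n + hDst m U V h) ≠ 0 ∧
    (wt w (t (n + hDst m U V h) - 1) < wt w (hEdge m h) ∨
      (wt w (t (n + hDst m U V h) - 1) = wt w (hEdge m h) ∧
        P (hSrc m U V h) ≤ tail (t (n + hDst m U V h) - 1)))
  source : ∀ x < n, t (n + x) ≠ 0 → ∃ h ∈ H, hDst m U V h = x ∧ t (n + x) = hEdge m h + 1 ∧
    tail (hEdge m h) = P (hSrc m U V h)
  tournament : IsTournament w n tail t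
  le : ∀ i, t i ≤ m

/-- The search has visited `j` vertices; the arrays describe their order, the edges through which
they have been reached and the tails of these edges. -/
structure Searched (w : Fin m → ℝ) (n : ℕ) (U V P ord te tl : ℕ → ℕ) (j : ℕ) : Prop where
  pos_le : ∀ x < n, P x ≤ j
  ord_lt : ∀ p < j, ord p < n ∧ P (ord p) = p + 1
  ord_pos : ∀ x < n, P x ≠ 0 → ord (P x - 1) = x
  zero : 0 < j → te 0 = m
  edge : ∀ p, 0 < p → p < j → ∃ h < 2 * m, hEdge m h = te p ∧ P (hDst m U V h) = p + 1 ∧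
    P (hSrc m U V h) = tl p + 1 ∧ tl p < p
  cut : ∀ h < 2 * m, ∀ p, 0 < p → p < j → P (hSrc m U V h) ≠ 0 → P (hSrc m U V h) ≤ p →
    (P (hDst m U V h) = 0 ∨ p < P (hDst m U V h)) →
      wt w (te p) < wt w (hEdge m h) ∨ (wt w (te p) = wt w (hEdge m h) ∧ P (hSrc m U V h) - 1 ≤ tl p)

/-- Of the inner nodes only the parent sees the changed leaf, and a change of tails is harmless if
it does not affect candidates. -/
theorem IsTournament.nodeOk_update (ht : IsTournament w n tail t) {v : ℕ}
    (htail : ∀ i, 0 < i → i < 2 * n → t i ≠ 0 → tail' (t i - 1) = tail (t i - 1)) {i : ℕ} (h0 : 0 < i)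
    (hi : i < n) (hne : i ≠ (n + y) / 2) : NodeOk w tail' (Function.update t (n + y) v) i := by
  obtain ⟨h1, h2, h3⟩ := ht i h0 hi
  rw [NodeOk, Function.update_of_ne (by omega), Function.update_of_ne (by omega),
    Function.update_of_ne (by omega)]
  have := htail i h0 (by omega)
  exact ⟨h1, h2.congr this (htail _ (by omega) (by omega)),
    h3.congr this (htail _ (by omega) (by omega))⟩

/-- `x` receives its position before its own half-edges are scanned, so no half-edge in `H` has
source `x`. Its leaf is emptied because it is no longer a target. -/
theorem Frontier.visit (hF : Frontier w n U V P tail t H) (hx : x < n) (hPx : P x = 0)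
    (ht : IsTournament w n tail t') (hle : ∀ i, t' i ≤ m) (hx0 : t' (n + x) = 0)
    (hleaf : ∀ y, y ≠ x → t' (n + y) = t (n + y)) :
    Frontier w n U V (Function.update P x (j + 1)) tail t' H := by
  have hsrc : ∀ h ∈ H, hSrc m U V h ≠ x := by
    rintro h hh rfl
    exact (hF.mem h hh).2 hPx
  refine ⟨fun h hh ↦ ?_, fun z hz hPz ↦ ?_, fun h hh hd ↦ ?_, fun z hz htz ↦ ?_, ht, hle⟩
  · rw [Function.update_of_ne (hsrc h hh)]
    exact hF.mem h hh
  · by_cases hzx : z = x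
    · rw [hzx, hx0]
    · rw [Function.update_of_ne hzx] at hPz
      rw [hleaf z hzx, hF.visited z hz hPz]
  · have hdx : hDst m U V h ≠ x := by
      rintro hdx
      rw [hdx, Function.update_self] at hd
      omega
    rw [Function.update_of_ne hdx] at hd
    rw [hleaf _ hdx, Function.update_of_ne (hsrc h hh)]
    exact hF.best h hh hd
  · by_cases hzx : z = x
    · rw [hzx] at htz
      exact absurd hx0 htz
    · rw [hleaf z hzx] at htz ⊢
      obtain ⟨h, hh, h1, h2, h3⟩ := hF.source z hz htz
      exact ⟨h, hh, h1, h2, by rw [h3, Function.update_of_ne (hsrc h hh)]⟩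

/-- The edge of a new half-edge is not yet a candidate. -/
theorem Frontier.ne_candidate (hF : Frontier w n U V P tail t H) (hh : h ∉ H)
    (hd : P (hDst m U V h) = 0) {i : ℕ} (h0 : 0 < i) (hi : i < 2 * n) :
    t i ≠ hEdge m h + 1 := by
  intro he
  obtain ⟨x, hx, hix⟩ := hF.tournament.exists_leaf h0 hi
  rw [hix] at he
  obtain ⟨h', hh', -, h2, -⟩ := hF.source x hx (by omega)
  rcases eq_or_opposite (U := U) (V := V) (show hEdge m h = hEdge m h' by omega) with rfl | hop
  · exact hh hh'
  · exact (hF.mem h' hh').2 (hop.2 ▸ hd)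

theorem Frontier.insert_of_visited (hF : Frontier w n U V P tail t H) (hh : h < 2 * m)
    (hs : P (hSrc m U V h) ≠ 0) (hd : P (hDst m U V h) ≠ 0) :
    Frontier w n U V P tail t (insert h H) := by
  refine ⟨?_, hF.visited, ?_, fun x hx htx ↦ ?_, hF.tournament, hF.le⟩
  · rintro h' (rfl | hh')
    exacts [⟨hh, hs⟩, hF.mem h' hh']
  · rintro h' (rfl | hh') hd'
    exacts [absurd hd' hd, hF.best h' hh' hd']
  · obtain ⟨h', hh', h1⟩ := hF.source x hx htx
    exact ⟨h', .inr hh', h1⟩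

/-- Overwriting the tail of the new edge does no harm, since by `Frontier.ne_candidate` it is not
yet a candidate anywhere. The new entry at `y` is at least as good as the old one and hence as all
earlier half-edges to `y`. -/
theorem Frontier.relax (hF : Frontier w n U V P tail t H)
    (hn : ∀ h < 2 * m, hDst m U V h < n) (hh : h < 2 * m) (hH : h ∉ H)
    (hs : P (hSrc m U V h) ≠ 0) (hd : P (hDst m U V h) = 0) (hy : hDst m U V h = y) (hyn : y < n)
    {c : ℕ} (hc : c = t (n + y) ∨ c = hEdge m h + 1)
    (hb : Better w (Function.update tail (hEdge m h) (P (hSrc m U V h))) c (t (n + y)))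
    (hb' : Better w (Function.update tail (hEdge m h) (P (hSrc m U V h))) c (hEdge m h + 1))
    (ht : IsTournament w n (Function.update tail (hEdge m h) (P (hSrc m U V h))) t')
    (hle : ∀ i, t' i ≤ m) (hc' : t' (n + y) = c) (hleaf : ∀ x, x ≠ y → t' (n + x) = t (n + x)) :
    Frontier w n U V P (Function.update tail (hEdge m h) (P (hSrc m U V h))) t' (insert h H) := by
  have htl : ∀ x < n, t (n + x) ≠ 0 →
      Function.update tail (hEdge m h) (P (hSrc m U V h)) (t (n + x) - 1) = tail (t (n + x) - 1) := by
    intro x hx h0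
    have := hF.ne_candidate hH hd (i := n + x) (by omega) (by omega)
    exact Function.update_of_ne (by omega) _ _
  have hsrc : ∀ x < n, t (n + x) ≠ 0 → ∃ h' ∈ insert h H, hDst m U V h' = x ∧
      t (n + x) = hEdge m h' + 1 ∧
        Function.update tail (hEdge m h) (P (hSrc m U V h)) (hEdge m h') = P (hSrc m U V h') := by
    intro x hx htx
    obtain ⟨h', hh', h1, h2, h3⟩ := hF.source x hx htx
    have := htl x hx htx
    rw [h2, Nat.add_sub_cancel, h3] at this
    exact ⟨h', .inr hh', h1, h2, this⟩
  refine ⟨?_, fun x hx hPx ↦ ?_, ?_, fun x hx htx ↦ ?_, ht, hle⟩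
  · rintro h' (rfl | hh')
    exacts [⟨hh, hs⟩, hF.mem h' hh']
  · rw [hleaf x (by rintro rfl; exact hPx (hy ▸ hd)), hF.visited x hx hPx]
  · rintro h' (rfl | hh') hd'
    · rw [hy, hc']
      have := hb'.resolve_left (Nat.succ_ne_zero _)
      rwa [Nat.add_sub_cancel, Function.update_self] at this
    · obtain ⟨h1, h2⟩ := hF.best h' hh' hd'
      by_cases hdy : hDst m U V h' = y
      · rw [hdy] at h1 h2 ⊢
        rw [hc']
        obtain ⟨h3, h4⟩ := hb.resolve_left h1
        rw [htl y hyn h1] at h4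
        refine ⟨h3, ?_⟩
        rcases h4 with h4 | h4 <;> rcases h2 with h2 | h2
        · exact .inl (h4.trans h2)
        · exact .inl (h2.1 ▸ h4)
        · exact .inl (h4.1 ▸ h2)
        · exact .inr ⟨h4.1.trans h2.1, h2.2.trans h4.2⟩
      · rw [hleaf _ hdy]
        rw [htl _ (hn h' (hF.mem h' hh').1) h1]
        exact ⟨h1, h2⟩
  · by_cases hxy : x = y
    · subst hxy
      rw [hc'] at htx ⊢
      rcases hc with rfl | rfl
      · exact hsrc x hx htx
      · exact ⟨h, .inl rfl, hy, rfl, Function.update_self _ _ _⟩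
    · rw [hleaf x hxy] at htx ⊢
      exact hsrc x hx htx

/-- The choice of `e` matters only for the cut at the new position `j`. At earlier positions, a
half-edge to `x` already counted as one to an unvisited vertex. -/
theorem Searched.step (hS : Searched w n U V P ord te tl j)
    (hn : ∀ h < 2 * m, hDst m U V h < n) (hx : x < n) (hPx : P x = 0) {e k : ℕ}
    (h0 : j = 0 → e = m)
    (he : 0 < j → k < j ∧ ∃ h < 2 * m, hEdge m h = e ∧ hDst m U V h = x ∧ P (hSrc m U V h) = k + 1)
    (hcut : 0 < j → ∀ h < 2 * m, P (hSrc m U V h) ≠ 0 → P (hDst m U V h) = 0 →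
      wt w e < wt w (hEdge m h) ∨ (wt w e = wt w (hEdge m h) ∧ P (hSrc m U V h) - 1 ≤ k)) :
    Searched w n U V (Function.update P x (j + 1)) (Function.update ord j x)
      (Function.update te j e) (Function.update tl j k) (j + 1) := by
  have hup : ∀ z, P z ≠ 0 → Function.update P x (j + 1) z = P z := fun z hz ↦
    Function.update_of_ne (by rintro rfl; exact hz hPx) _ _
  refine ⟨fun z hz ↦ ?_, fun p hp ↦ ?_, fun z hz hPz ↦ ?_, fun _ ↦ ?_, fun p hp hpj ↦ ?_,
    fun h hh p hp hpj hs hsp hd ↦ ?_⟩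
  · by_cases hzx : z = x
    · rw [hzx, Function.update_self]
    · rw [Function.update_of_ne hzx]
      exact (hS.pos_le z hz).trans (by omega)
  · by_cases hpj : p = j
    · rw [hpj, Function.update_self, Function.update_self]
      exact ⟨hx, rfl⟩
    · rw [Function.update_of_ne hpj]
      obtain ⟨h1, h2⟩ := hS.ord_lt p (by omega)
      exact ⟨h1, by rw [hup _ (by omega), h2]⟩
  · by_cases hzx : z = x
    · rw [hzx, Function.update_self, Nat.add_sub_cancel, Function.update_self]
    · rw [Function.update_of_ne hzx] at hPz ⊢
      have := hS.pos_le z hz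
      rw [Function.update_of_ne (by omega), hS.ord_pos z hz hPz]
  · by_cases hj : j = 0
    · rw [hj, Function.update_self, h0 hj]
    · rw [Function.update_of_ne (Ne.symm hj), hS.zero (by omega)]
  · by_cases hpj' : p = j
    · subst hpj'
      obtain ⟨hk, h, hh, h1, h2, h3⟩ := he hp
      rw [Function.update_self, Function.update_self]
      exact ⟨h, hh, h1, by rw [h2, Function.update_self], by rw [hup _ (by omega), h3], hk⟩
    · obtain ⟨h, hh, h1, h2, h3, h4⟩ := hS.edge p hp (by omega)
      rw [Function.update_of_ne hpj', Function.update_of_ne hpj']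
      exact ⟨h, hh, h1, by rw [hup _ (by omega), h2], by rw [hup _ (by omega), h3], h4⟩
  · have hsx : hSrc m U V h ≠ x := by
      intro hsx
      rw [hsx, Function.update_self] at hsp
      omega
    rw [Function.update_of_ne hsx] at hs hsp ⊢
    by_cases hdx : hDst m U V h = x
    · by_cases hpj' : p = j
      · subst hpj'
        rw [Function.update_self, Function.update_self]
        exact hcut hp h hh hs (hdx ▸ hPx)
      · rw [Function.update_of_ne hpj', Function.update_of_ne hpj']
        exact hS.cut h hh p hp (by omega) hs hsp (.inl (hdx ▸ hPx))
    · rw [Function.update_of_ne hdx] at hd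
      by_cases hpj' : p = j
      · subst hpj'
        rw [Function.update_self, Function.update_self]
        refine hcut hp h hh hs ?_
        rcases hd with hd | hd
        · exact hd
        · have := hS.pos_le _ (hn h hh)
          omega
      · rw [Function.update_of_ne hpj', Function.update_of_ne hpj']
        exact hS.cut h hh p hp (by omega) hs hsp hd

end Search

/-! ### Relaxing a half-edge and visiting a vertex. -/

section SearchProgram

variable {m : ℕ} {w : Fin m → ℝ} {B n k : ℕ} {U V : ℕ → ℕ} {j x h L : ℕ} {σ τ : State} {H : Set ℕ}

/-- Treats the edge in register 12 that leads to the vertex in register 13; register 9 holds the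
successor of the current position. -/
def relaxProg : Program :=
  .seq (code [.load 14 5 13])
    (.ite (.eq 14 5)
      (.seq (code [.store 8 12 9, .add 15 0 13, .load 25 9 15, .add 26 12 3])
        (.seq chooseProg (.seq (code [.store 9 15 27, .copy 19 13]) updateProg)))
      (code []))

theorem halts_relaxProg (hc : Consts n m σ) (hB : 2 * n + m ≤ B) (hL : n ≤ 2 ^ L)
    (hn : ∀ h < 2 * m, hDst m U V h < n) (hF : Frontier w n U V (σ.arr 5) (σ.arr 8) (σ.arr 9) H)
    (hh : h < 2 * m) (hH : h ∉ H) (h12 : σ.reg 12 = hEdge m h) (h13 : σ.reg 13 = hDst m U V h)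
    (h9 : σ.reg 9 = σ.arr 5 (hSrc m U V h)) (h0 : σ.arr 5 (hSrc m U V h) ≠ 0) :
    Halts w B relaxProg σ (22 * L + 28) fun τ ↦
      Frontier w n U V (σ.arr 5) (τ.arr 8) (τ.arr 9) (insert h H) ∧
      (∀ a, a ≠ 8 → a ≠ 9 → τ.arr a = σ.arr a) ∧ ∀ i < 14, τ.reg i = σ.reg i := by
  have hy := hn h hh
  have he := hEdge_lt hh
  refine (Halts.seq (T := 2) (T' := 22 * L + 26) (Halts.code (by simp [SafeAll, Instr.Safe]) ?_)).mono
    (by omega) fun _ h ↦ h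
  set σ₁ := runAll [.load 14 5 13] σ with hσ₁
  have ha₁ : σ₁.arr = σ.arr := rfl
  have h14 : σ₁.reg 14 = σ.arr 5 (hDst m U V h) := by simp [hσ₁, runAll, Instr.run, Instr.value, h13]
  have hr₁ : ∀ i, i ≠ 14 → σ₁.reg i = σ.reg i := fun i hi ↦ by
    simp [hσ₁, runAll, Instr.run, Instr.value, hi]
  have hc₁ : Consts n m σ₁ := hc.congr fun i hi ↦ hr₁ i (by omega)
  refine Halts.ite (T := 22 * L + 25) (fun hb ↦ ?_) fun hb ↦
    (Halts.code (l := []) trivial ?_).mono (by simp) fun _ h ↦ h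
  rotate_left
  · simp only [Test.Holds, h14, hc₁.r5] at hb
    exact ⟨hF.insert_of_visited hh h0 hb, fun a _ _ ↦ rfl, fun i hi ↦ hr₁ i (by omega)⟩
  simp only [Test.Holds, h14, hc₁.r5] at hb
  refine (Halts.seq (T := 5) (T' := 22 * L + 20) (Halts.code ?_ ?_)).mono (by omega) fun _ h ↦ h
  · simp [SafeAll, Instr.Safe, Instr.run, Instr.value, hr₁, hc.r0, hc.r3, h12, h13]
    omega
  set σ₂ := runAll [.store 8 12 9, .add 15 0 13, .load 25 9 15, .add 26 12 3] σ₁ with hσ₂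
  have ha8 : σ₂.arr 8 = Function.update (σ.arr 8) (hEdge m h) (σ.arr 5 (hSrc m U V h)) := by
    simp [hσ₂, runAll, Instr.run, Instr.value, hr₁, h12, h9, ha₁]
  have ha₂ : ∀ a, a ≠ 8 → σ₂.arr a = σ.arr a := fun a ha ↦ by
    simp [hσ₂, runAll, Instr.run, Instr.value, ha, ha₁]
  have hr₂ : ∀ i < 14, σ₂.reg i = σ.reg i := fun i hi ↦ by
    simp [hσ₂, runAll, Instr.run, Instr.value, hr₁ i (by omega), show i ≠ 15 by omega,
      show i ≠ 25 by omega, show i ≠ 26 by omega]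
  have h15 : σ₂.reg 15 = n + hDst m U V h := by
    simp [hσ₂, runAll, Instr.run, Instr.value, hr₁, h13, hc.r0]
  have h25 : σ₂.reg 25 = σ.arr 9 (n + hDst m U V h) := by
    simp [hσ₂, runAll, Instr.run, Instr.value, hr₁, h13, hc.r0, ha₁]
  have h26 : σ₂.reg 26 = hEdge m h + 1 := by
    simp [hσ₂, runAll, Instr.run, Instr.value, hr₁, h12, hc.r3]
  have hc₂ : Consts n m σ₂ := hc.congr fun i hi ↦ hr₂ i (by omega)
  refine (Halts.seq (T := 13) (T' := 22 * L + 7) ((halts_chooseProg hc₂ (h25 ▸ hF.le _)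
    (h26 ▸ he)).mono le_rfl ?_)).mono (by omega) fun _ h ↦ h
  rintro σ₃ ⟨ha₃, hr₃, hv, hb1, hb2⟩
  rw [h25, h26] at hv
  rw [h25, ha8] at hb1
  rw [h26, ha8] at hb2
  refine (Halts.seq (T := 3) (T' := 22 * L + 4) (Halts.code (by simp [SafeAll, Instr.Safe]) ?_)).mono
    (by omega) fun _ h ↦ h
  set σ₄ := runAll [.store 9 15 27, .copy 19 13] σ₃ with hσ₄
  have ha9 : σ₄.arr 9 = Function.update (σ.arr 9) (n + hDst m U V h) (σ₃.reg 27) := by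
    simp [hσ₄, runAll, Instr.run, Instr.value, ha₃, ha₂, hr₃, h15]
  have ha₄ : ∀ a, a ≠ 9 → σ₄.arr a = σ₂.arr a := fun a ha ↦ by
    simp [hσ₄, runAll, Instr.run, Instr.value, ha, ha₃]
  have hr₄ : ∀ i < 14, σ₄.reg i = σ.reg i := fun i hi ↦ by
    rw [← hr₂ i hi, ← hr₃ i (by omega)]
    simp [hσ₄, runAll, Instr.run, Instr.value, show i ≠ 19 by omega]
  have h19 : σ₄.reg 19 = hDst m U V h := by
    simp [hσ₄, runAll, Instr.run, Instr.value, hr₃, hr₂, h13]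
  have hvm : σ₃.reg 27 ≤ m := by
    rcases hv with hv | hv <;> rw [hv]
    · exact hF.le _
    · exact he
  refine (halts_updateProg (hc.congr fun i hi ↦ hr₄ i (by omega)) (by omega) h19 hy hL ?_ ?_).mono le_rfl ?_
  · intro i
    rw [ha9, Function.update_apply]
    split_ifs
    · exact hvm
    · exact hF.le i
  · intro i hi0 hin hne
    rw [ha9, ha₄ 8 (by norm_num), ha8]
    refine hF.tournament.nodeOk_update (fun i hi0 hin hti ↦ ?_) hi0 hin hne
    have := hF.ne_candidate hH hb hi0 hin
    exact Function.update_of_ne (by omega) _ _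
  · rintro τ ⟨haτ, hrτ, ht, hleaf, hle⟩
    have h8 : τ.arr 8 = Function.update (σ.arr 8) (hEdge m h) (σ.arr 5 (hSrc m U V h)) := by
      rw [haτ 8 (by norm_num), ha₄ 8 (by norm_num), ha8]
    refine ⟨?_, fun a h8 h9 ↦ by rw [haτ a h9, ha₄ a h9, ha₂ a h8], fun i hi ↦ by
      rw [hrτ i (by omega), hr₄ i hi]⟩
    rw [h8]
    rw [ha₄ 8 (by norm_num), ha8] at ht
    refine hF.relax hn hh hH h0 hb rfl hy hv hb1 hb2 ht hle ?_ fun z hz ↦ ?_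
    · rw [hleaf _ (by omega), ha9, Function.update_self]
    · rw [hleaf _ (by omega), ha9, Function.update_of_ne (by omega)]

/-- The input graph, given by the ends `U`, `V` of its edges. -/
structure IsConnectedInput (n m : ℕ) (U V : ℕ → ℕ) : Prop where
  lt : ∀ h < 2 * m, hDst m U V h < n
  -- Connectedness in terms of cuts, as the search needs it to find a next edge.
  conn : ∀ D : Set ℕ, (∃ x < n, x ∈ D) → (∃ x < n, x ∉ D) →
    ∃ h < 2 * m, hSrc m U V h ∈ D ∧ hDst m U V h ∉ D

theorem hSrc_eq_hDst (U V : ℕ → ℕ) (hh : h < 2 * m) : ∃ h' < 2 * m, hSrc m U V h = hDst m U V h' ∧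
    hDst m U V h = hSrc m U V h' ∧ hEdge m h = hEdge m h' := by
  by_cases hm : h < m
  · refine ⟨m + h, by omega, ?_⟩
    simp [hSrc, hDst, hEdge, hm]
  · refine ⟨h - m, by omega, ?_⟩
    simp [hSrc, hDst, hEdge, hm, show h - m < m by omega]

theorem IsConnectedInput.src_lt (hI : IsConnectedInput n m U V) (hh : h < 2 * m) :
    hSrc m U V h < n := by
  obtain ⟨h', hh', h1, -⟩ := hSrc_eq_hDst U V hh
  exact h1 ▸ hI.lt h' hh'

/-- The invariant of the search after `j` vertices have been visited. -/
structure SearchInv (w : Fin m → ℝ) (n k : ℕ) (U V : ℕ → ℕ) (j : ℕ) (σ : State) : Prop where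
  consts : Consts n m σ
  r2 : σ.reg 2 = k
  r6 : σ.reg 6 = j
  arr0 : σ.arr 0 = U
  arr1 : σ.arr 1 = V
  adj : IsAdjacency m U V {h | h < 2 * m} (σ.arr 3) (σ.arr 4)
  zero : ∀ a, a = 2 ∨ 10 ≤ a → ∀ i, σ.arr a i = 0
  -- The tails by position exist only in the proof; the machine keeps the tails of edges in array 8.
  searched : ∃ tl, Searched w n U V (σ.arr 5) (σ.arr 6) (σ.arr 7) tl j
  frontier : Frontier w n U V (σ.arr 5) (σ.arr 8) (σ.arr 9)
    {h | h < 2 * m ∧ σ.arr 5 (hSrc m U V h) ≠ 0}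

/-- The number of half-edges that have not been scanned. -/
noncomputable def unscanned (m : ℕ) (U V P : ℕ → ℕ) : ℕ :=
  ((Finset.range (2 * m)).filter fun h ↦ P (hSrc m U V h) = 0).card

noncomputable def degree (m : ℕ) (U V : ℕ → ℕ) (x : ℕ) : ℕ :=
  ((Finset.range (2 * m)).filter fun h ↦ hSrc m U V h = x).card

/-- Visits the vertex in register 7 through the edge in register 8. -/
def visitProg : Program :=
  .seq (code [.add 9 6 3, .store 5 7 9, .store 6 6 7, .store 7 6 8, .add 14 0 7, .store 9 14 5,
      .copy 19 7])
    (.seq updateProg (.seq (scanProg relaxProg) (code [.copy 6 9])))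

/-- The cost is proportional to the degree of `x`, apart from one update. The scanned half-edges are
subtracted from `unscanned`, which bounds the total cost of all visits. -/
theorem halts_visitProg (hI : IsConnectedInput n m U V) (hB : 2 * n + m ≤ B) (hL : n ≤ 2 ^ L)
    (hσ : SearchInv w n k U V j σ) (hj : j < n) (h7 : σ.reg 7 = x) (hx : x < n)
    (hPx : σ.arr 5 x = 0) {e q : ℕ} (h8 : σ.reg 8 = e) (h0 : j = 0 → e = m)
    (he : 0 < j → ∃ h < 2 * m, hEdge m h = e ∧ hDst m U V h = x ∧
      σ.arr 5 (hSrc m U V h) = q + 1)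
    (hcut : 0 < j → ∀ h < 2 * m, σ.arr 5 (hSrc m U V h) ≠ 0 → σ.arr 5 (hDst m U V h) = 0 →
      wt w e < wt w (hEdge m h) ∨
        (wt w e = wt w (hEdge m h) ∧ σ.arr 5 (hSrc m U V h) - 1 ≤ q)) :
    Halts w B visitProg σ ((22 * L + 37) * degree m U V x + 22 * L + 17) fun τ ↦
      SearchInv w n k U V (j + 1) τ ∧
        unscanned m U V (τ.arr 5) + degree m U V x ≤ unscanned m U V (σ.arr 5) := by
  obtain ⟨tl, hS⟩ := hσ.searched
  obtain ⟨l, hl, hnd, hlm⟩ := hσ.adj x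
  have hc := hσ.consts
  have hF := hσ.frontier
  have hdeg : degree m U V x = l.length := by
    rw [degree, ← List.toFinset_card_of_nodup hnd]
    congr 1
    ext h
    simp [hlm]
  rw [hdeg]
  refine (Halts.seq (T := 8) (T' := (22 * L + 37) * l.length + 22 * L + 9)
    (Halts.code ?_ ?_)).mono (by omega) fun _ h ↦ h
  · simp [SafeAll, Instr.Safe, Instr.run, Instr.value, hc.r0, hc.r3, hσ.r6, h7]
    omega
  set σ₁ := runAll [.add 9 6 3, .store 5 7 9, .store 6 6 7, .store 7 6 8, .add 14 0 7, .store 9 14 5,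
      .copy 19 7] σ with hσ₁
  have hr₁ : ∀ i < 9, σ₁.reg i = σ.reg i := fun i hi ↦ by
    simp [hσ₁, runAll, Instr.run, Instr.value, show i ≠ 9 by omega, show i ≠ 14 by omega,
      show i ≠ 19 by omega]
  have ha₁ : ∀ a, a ≠ 5 → a ≠ 6 → a ≠ 7 → a ≠ 9 → σ₁.arr a = σ.arr a := fun a h5 h6 h7 h9 ↦ by
    simp [hσ₁, runAll, Instr.run, Instr.value, h5, h6, h7, h9]
  have ha5 : σ₁.arr 5 = Function.update (σ.arr 5) x (j + 1) := by
    simp [hσ₁, runAll, Instr.run, Instr.value, h7, hσ.r6, hc.r3]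
  have ha6 : σ₁.arr 6 = Function.update (σ.arr 6) j x := by
    simp [hσ₁, runAll, Instr.run, Instr.value, h7, hσ.r6]
  have ha7 : σ₁.arr 7 = Function.update (σ.arr 7) j e := by
    simp [hσ₁, runAll, Instr.run, Instr.value, h8, hσ.r6]
  have ha9 : σ₁.arr 9 = Function.update (σ.arr 9) (n + x) 0 := by
    simp [hσ₁, runAll, Instr.run, Instr.value, h7, hc.r0, hc.r5]
  have h9 : σ₁.reg 9 = j + 1 := by
    simp [hσ₁, runAll, Instr.run, Instr.value, hσ.r6, hc.r3]
  have h19 : σ₁.reg 19 = x := by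
    simp [hσ₁, runAll, Instr.run, Instr.value, h7]
  have hc₁ : Consts n m σ₁ := hc.congr fun i hi ↦ hr₁ i (by omega)
  refine (Halts.seq (T := 22 * L + 4) (T' := (22 * L + 37) * l.length + 5)
    ((halts_updateProg hc₁ (by omega) h19 hx hL ?_ ?_).mono le_rfl ?_)).mono (by omega) fun _ h ↦ h
  · intro i
    rw [ha9, Function.update_apply]
    split_ifs
    · exact Nat.zero_le _
    · exact hF.le i
  · intro i hi0 hin hne
    rw [ha9, ha₁ 8 (by norm_num) (by norm_num) (by norm_num) (by norm_num)]
    exact hF.tournament.nodeOk_update (fun _ _ _ _ ↦ rfl) hi0 hin hne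
  rintro σ₂ ⟨ha₂, hr₂, ht₂, hleaf, hle⟩
  rw [ha₁ 8 (by norm_num) (by norm_num) (by norm_num) (by norm_num)] at ht₂
  have hF₂ : Frontier w n U V (σ₂.arr 5) (σ₂.arr 8) (σ₂.arr 9)
      {h | h < 2 * m ∧ σ.arr 5 (hSrc m U V h) ≠ 0} := by
    rw [ha₂ 5 (by norm_num), ha5, ha₂ 8 (by norm_num),
      ha₁ 8 (by norm_num) (by norm_num) (by norm_num) (by norm_num)]
    refine hF.visit hx hPx ht₂ hle ?_ fun y hy ↦ ?_
    · rw [hleaf _ (by omega), ha9, Function.update_self]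
    · rw [hleaf _ (by omega), ha9, Function.update_of_ne (by omega)]
  have hG₂ : ∀ a, a < 5 ∨ 10 ≤ a → σ₂.arr a = σ.arr a := fun a ha ↦ by
    rw [ha₂ a (by omega), ha₁ a (by omega) (by omega) (by omega) (by omega)]
  have hr₂' : ∀ i < 9, σ₂.reg i = σ.reg i := fun i hi ↦ by rw [hr₂ i (by omega), hr₁ i hi]
  have hP₂ : σ₂.arr 5 = Function.update (σ.arr 5) x (j + 1) := by rw [ha₂ 5 (by norm_num), ha5]
  have hc₂ : Consts n m σ₂ := hc.congr fun i hi ↦ hr₂' i (by omega)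
  refine (Halts.seq (T := (22 * L + 37) * l.length + 3) (T' := 2) ((halts_scanProg hc₂
    (T := 22 * L + 28) (H₀ := {h | h < 2 * m ∧ σ.arr 5 (hSrc m U V h) ≠ 0}) (l := l)
    (fun H ρ ↦ Frontier w n U V (ρ.arr 5) (ρ.arr 8) (ρ.arr 9) H ∧
      ∀ a, a ≠ 8 → a ≠ 9 → ρ.arr a = σ₂.arr a) ?_ ?_ hnd ?_ ?_ ⟨hF₂, fun _ _ _ ↦ rfl⟩).mono
      le_rfl ?_)).mono (by omega) fun _ h ↦ h
  · rintro H ρ τ ha - hρ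
    rwa [ha]
  · rw [hG₂ 4 (by norm_num), hG₂ 3 (by norm_num), hr₂' 7 (by norm_num), h7]
    exact hl
  · rintro h hh ⟨-, hs⟩
    rw [((hlm h).1 hh).2] at hs
    exact hs hPx
  · rintro h hh H ρ hH ⟨hFρ, haρ⟩ hG hr h12 h13
    obtain ⟨hhm, hsx⟩ := (hlm h).1 hh
    have h5 : ρ.arr 5 (hSrc m U V h) = j + 1 := by
      rw [haρ 5 (by norm_num) (by norm_num), hP₂, hsx, Function.update_self]
    rw [hG₂ 0 (by norm_num), hG₂ 1 (by norm_num), hσ.arr0, hσ.arr1] at h13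
    refine (halts_relaxProg (hc₂.congr fun i hi ↦ hr i (by omega)) hB hL hI.lt hFρ hhm hH h12 h13
      ?_ (by omega)).mono le_rfl ?_
    · rw [h5, hr 9 (by norm_num), hr₂ 9 (by norm_num), h9]
    · rintro τ ⟨h1, h2, h3⟩
      refine ⟨⟨by rwa [h2 5 (by norm_num) (by norm_num)], fun a h8 h9 ↦ by
        rw [h2 a h8 h9, haρ a h8 h9]⟩, ?_, fun i hi ↦ h3 i (by omega)⟩
      exact ⟨h2 0 (by norm_num) (by norm_num), h2 1 (by norm_num) (by norm_num),
        h2 3 (by norm_num) (by norm_num), h2 4 (by norm_num) (by norm_num)⟩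
  · rintro σ₃ ⟨⟨hF₃, ha₃⟩, -, hr₃⟩
    refine Halts.code (by simp [SafeAll, Instr.Safe]) ⟨?_, ?_⟩
    · set τ := runAll [.copy 6 9] σ₃ with hτ
      have haτ : τ.arr = σ₃.arr := rfl
      have hrτ : ∀ i < 6, τ.reg i = σ.reg i := fun i hi ↦ by
        rw [← hr₂' i (by omega), ← hr₃ i (by omega)]
        simp [hτ, runAll, Instr.run, Instr.value, show i ≠ 6 by omega]
      have hA : ∀ a, a < 5 ∨ 10 ≤ a → τ.arr a = σ.arr a := fun a ha ↦ by
        rw [haτ, ha₃ a (by omega) (by omega), hG₂ a ha]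
      have hP : τ.arr 5 = Function.update (σ.arr 5) x (j + 1) := by
        rw [haτ, ha₃ 5 (by norm_num) (by norm_num), hP₂]
      refine ⟨hc.congr hrτ, by rw [hrτ 2 (by norm_num), hσ.r2], ?_, by rw [hA 0 (by norm_num), hσ.arr0],
        by rw [hA 1 (by norm_num), hσ.arr1], ?_, fun a ha i ↦ ?_,
        ⟨Function.update tl j q, ?_⟩, ?_⟩
      · simp [hτ, runAll, Instr.run, Instr.value, hr₃, hr₂, h9]
      · rw [hA 3 (by norm_num), hA 4 (by norm_num)]
        exact hσ.adj
      · rw [hA a (by omega), hσ.zero a ha]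
      · rw [hP, haτ, ha₃ 6 (by norm_num) (by norm_num), ha₃ 7 (by norm_num) (by norm_num),
          ha₂ 6 (by norm_num), ha₂ 7 (by norm_num), ha6, ha7]
        refine hS.step hI.lt hx hPx h0 (fun hj0 ↦ ?_) hcut
        obtain ⟨h, hh, h1, h2, h3⟩ := he hj0
        exact ⟨by have := hS.pos_le _ (hI.src_lt hh); omega, h, hh, h1, h2, h3⟩
      · rw [haτ]
        -- The half-edges with visited source are now the old ones together with the list of `x`.
        convert hF₃ using 1
        rw [← haτ, hP]
        ext h
        simp only [Set.mem_ofPred_eq, Set.mem_union, hlm]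
        by_cases hsx : hSrc m U V h = x
        · simp only [hsx, Function.update_self, and_true]
          tauto
        · simp [hsx]
    · have hP : (runAll [.copy 6 9] σ₃).arr 5 = Function.update (σ.arr 5) x (j + 1) := by
        rw [← hP₂, ← ha₃ 5 (by norm_num) (by norm_num)]
        rfl
      rw [hP, unscanned, unscanned, ← List.toFinset_card_of_nodup hnd, ← Finset.card_union_of_disjoint]
      · refine Finset.card_le_card fun h hh ↦ ?_
        simp only [Finset.mem_union, Finset.mem_filter, Finset.mem_range, List.mem_toFinset, hlm,
          Set.mem_ofPred_eq] at hh ⊢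
        rcases hh with ⟨h1, h2⟩ | ⟨h1, h2⟩
        · refine ⟨h1, ?_⟩
          rw [Function.update_apply] at h2
          split_ifs at h2
          exact h2
        · rw [h2]
          exact ⟨h1, hPx⟩
      · rw [Finset.disjoint_left]
        intro h h1 h2
        simp only [Finset.mem_filter, List.mem_toFinset, hlm] at h1 h2
        rw [h2.2, Function.update_self] at h1
        omega

end SearchProgram

/-! ### The complete search. -/

section SearchLoop

variable {m : ℕ} {w : Fin m → ℝ} {B n k : ℕ} {U V P ord te tl tail t : ℕ → ℕ} {j x h L : ℕ} {σ τ : State}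

theorem Searched.exists_unvisited (hS : Searched w n U V P ord te tl j) (hj : j < n) :
    ∃ x < n, P x = 0 := by
  by_contra! hc
  have := Finset.card_le_card_of_injOn (s := Finset.range n) (t := Finset.range j) (fun x ↦ P x - 1)
    (fun x hx ↦ by
      simp only [Finset.coe_range, Set.mem_Iio] at hx ⊢
      have := hS.pos_le x hx
      have := hc x hx
      omega)
    (fun x hx y hy hxy ↦ by
      simp only [Finset.coe_range, Set.mem_Iio] at hx hy hxy
      rw [← hS.ord_pos x hx (hc x hx), hxy, hS.ord_pos y hy (hc y hy)])
  simp at this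
  omega

/-- The root of the tournament is a best edge that leaves the set of visited vertices. -/
theorem Frontier.root (hI : IsConnectedInput n m U V) (hj0 : 0 < j) (hj : j < n)
    (hS : Searched w n U V P ord te tl j)
    (hF : Frontier w n U V P tail t {h | h < 2 * m ∧ P (hSrc m U V h) ≠ 0}) :
    ∃ h < 2 * m, t 1 = hEdge m h + 1 ∧ P (hDst m U V h) = 0 ∧ P (hSrc m U V h) ≠ 0 ∧
      ∀ h' < 2 * m, P (hSrc m U V h') ≠ 0 → P (hDst m U V h') = 0 →
        wt w (hEdge m h) < wt w (hEdge m h') ∨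
          (wt w (hEdge m h) = wt w (hEdge m h') ∧ P (hSrc m U V h') ≤ P (hSrc m U V h)) := by
  obtain ⟨z, hz, hPz⟩ := hS.exists_unvisited hj
  have h0 := hS.ord_lt 0 hj0
  obtain ⟨h, hh, hs, hd⟩ := hI.conn {x | P x ≠ 0} ⟨_, h0.1, by simp [h0.2]⟩ ⟨z, hz, by simpa using hPz⟩
  have hd : P (hDst m U V h) = 0 := by simpa using hd
  have hroot : ∀ x < n, Better w tail (t 1) (t (n + x)) := fun x hx ↦
    hF.tournament.better_root (by omega) (by omega)
  obtain ⟨x, hx, h1x⟩ := hF.tournament.exists_leaf (i := 1) (by omega) (by omega)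
  have h1 : t 1 ≠ 0 :=
    ((hroot _ (hI.lt h hh)).resolve_left (hF.best h ⟨hh, hs⟩ hd).1).1
  obtain ⟨h₁, ⟨hh₁, hs₁⟩, hd₁, ht₁, htl₁⟩ := hF.source x hx (h1x ▸ h1)
  have hPx : P x = 0 := by
    by_contra hPx
    exact h1 (h1x.trans (hF.visited x hx hPx))
  have he : t 1 = hEdge m h₁ + 1 := h1x.trans ht₁
  refine ⟨h₁, hh₁, he, hd₁ ▸ hPx, hs₁, fun h' hh' hs' hd' ↦ ?_⟩
  obtain ⟨h2, h3⟩ := hF.best h' ⟨hh', hs'⟩ hd'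
  obtain ⟨-, h4⟩ := (hroot _ (hI.lt h' hh')).resolve_left h2
  rw [he, Nat.add_sub_cancel, htl₁] at h4
  rcases h4 with h4 | h4 <;> rcases h3 with h3 | h3
  · exact .inl (h4.trans h3)
  · exact .inl (h3.1 ▸ h4)
  · exact .inl (h4.1 ▸ h3)
  · exact .inr ⟨h4.1.trans h3.1, h3.2.trans h4.2⟩

/-- Writes the next edge into register 8 and its unvisited end into register 7. -/
def extractProg : Program :=
  .seq (code [.load 8 9 3, .sub 8 8 3, .load 7 0 8, .load 14 5 7])
    (.ite (.eq 14 5) (code []) (code [.load 7 1 8]))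

/-- Vertex 0 is visited first with `m` in place of an edge, which puts the sentinel at position 0.
-/
def searchProg : Program :=
  .seq (code [.copy 8 1, .const 6 0, .const 7 0])
    (.seq visitProg (.loop (.lt 6 0) (.seq extractProg visitProg)))

theorem SearchInv.congr (hσ : SearchInv w n k U V j σ) (ha : τ.arr = σ.arr)
    (hr : ∀ i < 7, τ.reg i = σ.reg i) : SearchInv w n k U V j τ := by
  obtain ⟨h1, h2, h3, h4, h5, h6, h7, h8, h9⟩ := hσ
  refine ⟨h1.congr fun i hi ↦ hr i (by omega), by rw [hr 2 (by norm_num), h2],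
    by rw [hr 6 (by norm_num), h3], ?_, ?_, ?_, ?_, ?_, ?_⟩ <;> rw [ha] <;> assumption

/-- Exactly one end of the edge at the root has been visited, so testing its first end shows which
one is new. -/
theorem halts_extractProg (hU : σ.arr 0 = U) (hV : σ.arr 1 = V) (hc : Consts n m σ)
    (h1 : σ.arr 9 1 = hEdge m h + 1) (hd : σ.arr 5 (hDst m U V h) = 0)
    (hs : σ.arr 5 (hSrc m U V h) ≠ 0) :
    Halts w B extractProg σ 8 fun τ ↦ τ.arr = σ.arr ∧ (∀ i < 7, τ.reg i = σ.reg i) ∧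
      τ.reg 8 = hEdge m h ∧ τ.reg 7 = hDst m U V h := by
  refine Halts.seq (T := 5) (T' := 3) (Halts.code (by simp [SafeAll, Instr.Safe]) ?_)
  set σ₁ := runAll [.load 8 9 3, .sub 8 8 3, .load 7 0 8, .load 14 5 7] σ with hσ₁
  have ha₁ : σ₁.arr = σ.arr := rfl
  have hr₁ : ∀ i < 7, σ₁.reg i = σ.reg i := fun i hi ↦ by
    simp [hσ₁, runAll, Instr.run, Instr.value, show i ≠ 8 by omega, show i ≠ 7 by omega,
      show i ≠ 14 by omega]
  have h8 : σ₁.reg 8 = hEdge m h := by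
    simp [hσ₁, runAll, Instr.run, Instr.value, hc.r3, h1]
  have h7 : σ₁.reg 7 = U (hEdge m h) := by
    simp [hσ₁, runAll, Instr.run, Instr.value, hc.r3, h1, hU]
  have h14 : σ₁.reg 14 = σ.arr 5 (U (hEdge m h)) := by
    simp [hσ₁, runAll, Instr.run, Instr.value, hc.r3, h1, hU]
  have h5 : σ₁.reg 5 = 0 := by rw [hr₁ 5 (by norm_num), hc.r5]
  have hcase : (hDst m U V h = V (hEdge m h) ∧ hSrc m U V h = U (hEdge m h)) ∨
      (hDst m U V h = U (hEdge m h) ∧ hSrc m U V h = V (hEdge m h)) := by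
    unfold hDst hSrc hEdge
    split_ifs <;> simp
  refine Halts.ite (T := 2) (fun hb ↦ (Halts.code (l := []) trivial ?_).mono (by simp) fun _ h ↦ h)
    fun hb ↦ Halts.code (by simp [SafeAll, Instr.Safe]) ?_
  · simp only [Test.Holds, h14, h5] at hb
    refine ⟨ha₁, hr₁, h8, h7.trans ?_⟩
    rcases hcase with hcs | hcs
    · rw [hcs.2] at hs
      exact absurd hb hs
    · exact hcs.1.symm
  · simp only [Test.Holds, h14, h5] at hb
    refine ⟨ha₁, fun i hi ↦ ?_, ?_, ?_⟩
    · rw [← hr₁ i hi]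
      simp [runAll, Instr.run, Instr.value, show i ≠ 7 by omega]
    · simpa [runAll, Instr.run, Instr.value] using h8
    · simp [runAll, Instr.run, Instr.value, h8, ha₁, hV]
      rcases hcase with hcs | hcs
      · exact hcs.1.symm
      · rw [hcs.1] at hd
        exact absurd hd hb

theorem unscanned_le (m : ℕ) (U V P : ℕ → ℕ) : unscanned m U V P ≤ 2 * m :=
  (Finset.card_filter_le _ _).trans (by simp)

theorem halts_searchProg (hI : IsConnectedInput n m U V) (hB : 2 * n + m ≤ B) (hL : n ≤ 2 ^ L)
    (hn : 0 < n) (hc : Consts n m σ) (h2 : σ.reg 2 = k) (hU : σ.arr 0 = U) (hV : σ.arr 1 = V)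
    (hadj : IsAdjacency m U V {h | h < 2 * m} (σ.arr 3) (σ.arr 4))
    (hz : ∀ a, a = 2 ∨ 5 ≤ a → ∀ i, σ.arr a i = 0) :
    Halts w B searchProg σ ((22 * L + 37) * (2 * m) + (22 * L + 26) * n + 5) fun τ ↦
      SearchInv w n k U V n τ := by
  refine (Halts.seq (T := 4) (T' := (22 * L + 37) * (2 * m) + (22 * L + 26) * n + 1)
    (Halts.code (by simp [SafeAll, Instr.Safe]) ?_)).mono (by omega) fun _ h ↦ h
  set σ₁ := runAll [.copy 8 1, .const 6 0, .const 7 0] σ with hσ₁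
  have ha₁ : σ₁.arr = σ.arr := rfl
  have hr₁ : ∀ i < 6, σ₁.reg i = σ.reg i := fun i hi ↦ by
    simp [hσ₁, runAll, Instr.run, Instr.value, show i ≠ 8 by omega, show i ≠ 6 by omega,
      show i ≠ 7 by omega]
  have h8 : σ₁.reg 8 = m := by simp [hσ₁, runAll, Instr.run, Instr.value, hc.r1]
  have h7 : σ₁.reg 7 = 0 := by simp [hσ₁, runAll, Instr.run, Instr.value]
  have h6 : σ₁.reg 6 = 0 := by simp [hσ₁, runAll, Instr.run, Instr.value]
  have hz' : ∀ a, a = 2 ∨ 5 ≤ a → ∀ i, σ₁.arr a i = 0 := by rwa [ha₁]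
  have h₁ : SearchInv w n k U V 0 σ₁ := by
    refine ⟨hc.congr hr₁, by rw [hr₁ 2 (by norm_num), h2], h6, hU, hV, hadj,
      fun a ha ↦ hz' a (by omega), ⟨fun _ ↦ 0, ?_⟩, ?_⟩
    · exact ⟨fun x _ ↦ (hz' 5 (by norm_num) x).le, by simp, fun x _ hx ↦ absurd (hz' 5 (by norm_num) x) hx,
        by simp, by simp, by simp⟩
    · refine ⟨fun h hh ↦ hh, fun x _ _ ↦ hz' 9 (by norm_num) _,
        fun h hh ↦ absurd (hz' 5 (by norm_num) _) hh.2, fun x _ hx ↦ absurd (hz' 9 (by norm_num) _) hx,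
        fun i _ _ ↦ ?_, fun i ↦ by simp [hz' 9 (by norm_num) i]⟩
      simp [NodeOk, hz' 9 (by norm_num), Better]
  have hP0 : σ₁.arr 5 0 = 0 := hz' 5 (by norm_num) 0
  have hun := unscanned_le m U V (σ₁.arr 5)
  have hdeg : degree m U V 0 ≤ 2 * m := (Finset.card_filter_le _ _).trans (by simp)
  have hm : (22 * L + 37) * (2 * m) = (22 * L + 37) * degree m U V 0 +
      (22 * L + 37) * (2 * m - degree m U V 0) := by
    rw [← mul_add]; congr 1; omega
  have hn' : (22 * L + 26) * n = (22 * L + 26) * (n - 1) + (22 * L + 26) := by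
    conv_lhs => rw [show n = n - 1 + 1 by omega]
    ring
  refine (Halts.seq (T := (22 * L + 37) * degree m U V 0 + 22 * L + 17)
    (T' := (22 * L + 37) * (2 * m - degree m U V 0) + (22 * L + 26) * (n - 1) + 1)
    ((halts_visitProg (q := 0) hI hB hL h₁ hn h7 hn hP0 h8
      (fun _ ↦ rfl) (by simp) (by simp)).mono le_rfl ?_)).mono (by omega) fun _ h ↦ h
  rintro σ₂ ⟨hσ₂, hun₂⟩
  -- The index consists of the number of visited vertices and a bound on the number of unscanned
  -- half-edges; each remaining vertex and half-edge contributes logarithmic time to the potential.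
  refine (Halts.loop (fun (a : ℕ × ℕ) (ρ : State) ↦ SearchInv w n k U V a.1 ρ ∧ 0 < a.1 ∧ a.1 ≤ n ∧
    unscanned m U V (ρ.arr 5) ≤ a.2) (fun a ↦ (22 * L + 37) * a.2 + (22 * L + 26) * (n - a.1))
    (a := (1, 2 * m - degree m U V 0)) ?_ ?_ ⟨hσ₂, one_pos, hn, by simp only; omega⟩).mono le_rfl
    fun _ h ↦ h
  · rintro ⟨j, s⟩ ρ ⟨hρ, hj0, hjn, hs⟩ hb
    simp only [Test.Holds, hρ.r6, hρ.consts.r0] at hb hj0 hjn hs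
    obtain ⟨tl, hS⟩ := hρ.searched
    obtain ⟨h, hh, h1, hd, hsrc, hcut⟩ := hρ.frontier.root hI hj0 hb hS
    refine ⟨8 + ((22 * L + 37) * degree m U V (hDst m U V h) + 22 * L + 17),
      Halts.seq ((halts_extractProg hρ.arr0 hρ.arr1 hρ.consts h1 hd hsrc).mono le_rfl ?_)⟩
    rintro ρ₁ ⟨ha₁, hr₁, h8, h7⟩
    have hcut' : 0 < j → ∀ h' < 2 * m, ρ₁.arr 5 (hSrc m U V h') ≠ 0 → ρ₁.arr 5 (hDst m U V h') = 0 →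
        wt w (hEdge m h) < wt w (hEdge m h') ∨ (wt w (hEdge m h) = wt w (hEdge m h') ∧
          ρ₁.arr 5 (hSrc m U V h') - 1 ≤ ρ₁.arr 5 (hSrc m U V h) - 1) := by
      rw [ha₁]
      exact fun _ h' hh' hs' hd' ↦ (hcut h' hh' hs' hd').imp_right
        fun hc ↦ ⟨hc.1, Nat.sub_le_sub_right hc.2 1⟩
    refine (halts_visitProg (q := ρ₁.arr 5 (hSrc m U V h) - 1) hI hB hL (hρ.congr ha₁ hr₁) hb h7
      (hI.lt h hh) (ha₁ ▸ hd) h8 (fun h0 ↦ by omega) (fun _ ↦ ⟨h, hh, rfl, rfl, ?_⟩) hcut').mono le_rfl ?_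
    · rw [ha₁]; omega
    · rintro τ ⟨hτ, hun⟩
      rw [ha₁] at hun
      refine ⟨(j + 1, s - degree m U V (hDst m U V h)), ⟨hτ, by simp, hb, by simp only; omega⟩, ?_⟩
      simp only
      obtain ⟨s', rfl⟩ : ∃ s', s = s' + degree m U V (hDst m U V h) :=
        ⟨s - degree m U V (hDst m U V h), by omega⟩
      obtain ⟨q, rfl⟩ : ∃ q, n = j + 1 + q := ⟨n - (j + 1), by omega⟩
      rw [show j + 1 + q - (j + 1) = q by omega, show j + 1 + q - j = q + 1 by omega,
        Nat.add_sub_cancel]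
      apply le_of_eq
      ring
  · rintro ⟨j, s⟩ ρ ⟨hρ, hj0, hjn, hs⟩ hb
    simp only [Test.Holds, hρ.r6, hρ.consts.r0] at hb hjn
    obtain rfl : j = n := by omega
    exact hρ

end SearchLoop

/-! ### Top positions from a monotone stack and binary search. -/

section Tops

variable {m : ℕ} {w : Fin m → ℝ} {B n k : ℕ} {U V P ord te tl st A A' lo lo' C C' : ℕ → ℕ}
  {j x h L r g q : ℕ} {c : ℝ} {σ τ : State} {H : Set ℕ}

/-- The stack `st 0, …, st r` of the positions up to `j` that are not followed by a heavier one. -/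
structure IsStack (w : Fin m → ℝ) (te st : ℕ → ℕ) (r j : ℕ) : Prop where
  top : st r = j
  zero : st 0 = 0
  lt : ∀ g < r, st g < st (g + 1)
  light : ∀ g < r, ∀ q, st g < q → q ≤ j → wt w (te q) ≤ wt w (te (st (g + 1)))

theorem IsStack.lt_of_lt (hs : IsStack w te st r j) {g' : ℕ} (hg : g < g') (hr : g' ≤ r) :
    st g < st g' := by
  induction g', hg using Nat.le_induction with
  | base => exact hs.lt g (by omega)
  | succ i hi ih => exact (ih (by omega)).trans (hs.lt i (by omega))

theorem IsStack.le_top (hs : IsStack w te st r j) (hg : g ≤ r) : st g ≤ j := by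
  rcases eq_or_lt_of_le hg with rfl | hlt
  · exact hs.top.le
  · exact hs.top ▸ (hs.lt_of_lt hlt le_rfl).le

theorem IsStack.le_apply (hs : IsStack w te st r j) (hg : g ≤ r) : g ≤ st g := by
  induction g with
  | zero => exact Nat.zero_le _
  | succ g ih => have := ih (by omega); have := hs.lt g (by omega); omega

/-- By `light`, the entry after `st g` bounds the weights at all positions after `st g`. Hence it
suffices to look at two neighbouring entries. -/
theorem IsStack.isTop (hs : IsStack w te st r j) (hg : g ≤ r) (h1 : st g = 0 ∨ c ≤ wt w (te (st g)))
    (h2 : g = r ∨ wt w (te (st (g + 1))) < c) : IsSearchOrder.IsTop (wt w) te c j (st g) := by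
  refine ⟨hs.le_top hg, fun h0 ↦ h1.resolve_left (by omega), fun q hq hqj ↦ ?_⟩
  rcases h2 with rfl | h2
  · have := hs.top; omega
  · by_cases hgr : g = r
    · subst hgr; have := hs.top; omega
    · exact (hs.light g (by omega) q hq hqj).trans_lt h2

/-- The entries removed are lighter than the new position, and so are the positions that they
dominated. The entries kept are at least as heavy, apart from the bottom, so they go on dominating.
-/
theorem IsStack.push (hs : IsStack w te st r j) (hg : g ≤ r)
    (h1 : st g = 0 ∨ wt w (te (j + 1)) ≤ wt w (te (st g)))
    (h2 : ∀ i, g < i → i ≤ r → wt w (te (st i)) < wt w (te (j + 1))) :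
    IsStack w te (Function.update st (g + 1) (j + 1)) (g + 1) (j + 1) := by
  have hle := hs.le_top hg
  refine ⟨Function.update_self _ _ _, ?_, fun i hi ↦ ?_, fun i hi q hq hqj ↦ ?_⟩
  · rw [Function.update_of_ne (by omega), hs.zero]
  · rw [Function.update_of_ne (by omega)]
    by_cases hig : i = g
    · rw [hig, Function.update_self]; omega
    · rw [Function.update_of_ne (by omega)]
      exact hs.lt i (by omega)
  · rw [Function.update_of_ne (by omega)] at hq
    by_cases hig : i = g
    · subst hig
      rw [Function.update_self]
      rcases eq_or_lt_of_le hqj with rfl | hlt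
      · exact le_rfl
      · have hir : i < r := by
          by_contra hir
          have := hs.top
          rw [show r = i by omega] at this
          omega
        exact (hs.light i hir q hq (by omega)).trans (h2 (i + 1) (by omega) (by omega)).le
    · rw [Function.update_of_ne (by omega)]
      rcases eq_or_lt_of_le hqj with rfl | hlt
      · have h0 : st g ≠ 0 := by have := hs.le_apply hg; omega
        refine (h1.resolve_left h0).trans ?_
        exact hs.light i (by omega) (st g) (hs.lt_of_lt (by omega) hg) hle
      · exact hs.light i (by omega) q hq (by omega)

theorem IsStack.exists_pop (hs : IsStack w te st r j) (c : ℝ) : ∃ g ≤ r,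
    (st g = 0 ∨ c ≤ wt w (te (st g))) ∧ ∀ i, g < i → i ≤ r → wt w (te (st i)) < c := by
  classical
  set Q : ℕ → Prop := fun g ↦ st g = 0 ∨ c ≤ wt w (te (st g))
  refine ⟨Nat.findGreatest Q r, Nat.findGreatest_le r,
    Nat.findGreatest_spec (P := Q) (Nat.zero_le r) (.inl hs.zero), fun i hi hir ↦ ?_⟩
  have := Nat.findGreatest_is_greatest hi hir
  simp only [Q, not_or, not_le] at this
  exact this.2

/-- The tree edges are edges; position 0 has none. -/
structure IsTreeArray (n m : ℕ) (te : ℕ → ℕ) : Prop where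
  zero : te 0 = m
  lt : ∀ p, 0 < p → p < n → te p < m

/-- Pushes the position in register 6 on the stack, whose height is in register 9. -/
def pushProg : Program :=
  .seq (code [.load 8 7 6, .load 14 10 9, .load 14 7 14])
    (.seq (.loop (.weightLt 14 8) (code [.sub 9 9 3, .load 14 10 9, .load 14 7 14]))
      (code [.add 9 9 3, .store 10 9 6]))

/-- The new height `r'` is determined before the run, because the time depends on it: `r + 1 - r'`
entries are popped. -/
theorem halts_pushProg (hc : Consts n m σ) (hB : n ≤ B) (hte : IsTreeArray n m (σ.arr 7))
    (h6 : σ.reg 6 = j + 1) (hj : j + 1 < n) (h9 : σ.reg 9 = r)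
    (hs : IsStack w (σ.arr 7) (σ.arr 10) r j) :
    ∃ r' ≤ r + 1, Halts w B pushProg σ (5 * (r + 1 - r') + 8) fun τ ↦
      (∀ a ≠ 10, τ.arr a = σ.arr a) ∧ (∀ i < 8, τ.reg i = σ.reg i) ∧ τ.reg 9 = r' ∧
        IsStack w (σ.arr 7) (τ.arr 10) r' (j + 1) := by
  obtain ⟨g, hgr, hg1, hg2⟩ := hs.exists_pop (wt w (σ.arr 7 (j + 1)))
  refine ⟨g + 1, by omega, (Halts.seq (T := 4) (T' := 5 * (r - g) + 4)
    (Halts.code (by simp [SafeAll, Instr.Safe]) ?_)).mono (by omega) fun _ h ↦ h⟩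
  refine (Halts.seq (T := 5 * (r - g) + 1) (T' := 3) ((Halts.loop (fun (i : ℕ) (ρ : State) ↦
    ρ.arr = σ.arr ∧ (∀ i < 8, ρ.reg i = σ.reg i) ∧ ρ.reg 8 = σ.arr 7 (j + 1) ∧ ρ.reg 9 = i ∧
      ρ.reg 14 = σ.arr 7 (σ.arr 10 i) ∧ g ≤ i ∧ i ≤ r) (fun i ↦ 5 * (i - g))
      (Q := fun ρ ↦ ρ.arr = σ.arr ∧ (∀ i < 8, ρ.reg i = σ.reg i) ∧ ρ.reg 9 = g)
      (a := r) ?_ ?_ ?_).mono le_rfl ?_)).mono (by omega) fun _ h ↦ h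
  · rintro i ρ ⟨ha, hr, h8, h9, h14, hgi, hir⟩ hb
    rw [holds_weightLt, h14, h8] at hb
    have hne : i ≠ g := by
      rintro rfl
      rcases hg1 with hg1 | hg1
      -- The bottom entry carries the index `m`, for which the weight test fails, so it is never
      -- popped.
      · rw [hg1, hte.zero] at hb; omega
      · exact absurd hb.2.2 (not_lt.2 hg1)
    have h3 : ρ.reg 3 = 1 := (hr 3 (by norm_num)).trans hc.r3
    refine ⟨4, Halts.code (by simp [SafeAll, Instr.Safe]) ⟨i - 1, ⟨ha, fun i hi ↦ ?_, ?_, ?_, ?_, ?_, ?_⟩, ?_⟩⟩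
    · simp [runAll, Instr.run, Instr.value, show i ≠ 14 by omega, show i ≠ 9 by omega, hr i hi]
    · simp [runAll, Instr.run, Instr.value, h8]
    · simp [runAll, Instr.run, Instr.value, h9, h3]
    · simp [runAll, Instr.run, Instr.value, h9, h3, ha]
    · omega
    · omega
    · omega
  · rintro i ρ ⟨ha, hr, h8, h9, h14, hgi, hir⟩ hb
    rw [holds_weightLt, h14, h8] at hb
    refine ⟨ha, hr, h9.trans ?_⟩
    by_contra hne
    have h0 : σ.arr 10 i ≠ 0 := by have := hs.le_apply hir; omega
    have hle := hs.le_top hir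
    exact hb ⟨hte.lt _ (by omega) (by omega), hte.lt _ (by omega) hj, hg2 i (by omega) hir⟩
  · refine ⟨rfl, fun i hi ↦ ?_, ?_, ?_, ?_, hgr, le_rfl⟩
    · simp [runAll, Instr.run, Instr.value, show i ≠ 14 by omega, show i ≠ 8 by omega]
    · simp [runAll, Instr.run, Instr.value, h6]
    · simp [runAll, Instr.run, Instr.value, h9]
    · simp [runAll, Instr.run, Instr.value, h9]
  · rintro ρ ⟨ha, hr, h9⟩
    have h3 : ρ.reg 3 = 1 := (hr 3 (by norm_num)).trans hc.r3
    have h6 : ρ.reg 6 = j + 1 := (hr 6 (by norm_num)).trans h6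
    have := hs.le_apply hgr
    have := hs.le_top hgr
    refine Halts.code ?_ ⟨fun a ha' ↦ ?_, fun i hi ↦ ?_, ?_, ?_⟩
    · simp [SafeAll, Instr.Safe, h9, h3]; omega
    · simp [runAll, Instr.run, Instr.value, ha', ha]
    · simp [runAll, Instr.run, Instr.value, show i ≠ 9 by omega, hr i hi]
    · simp [runAll, Instr.run, Instr.value, h9, h3]
    · simp only [runAll, Instr.run, Instr.value, State.setArr_arr, State.setReg_arr, State.setReg_reg,
        if_true, h9, h3, h6, ha, Nat.reduceEqDiff, if_false]
      exact hs.push hgr hg1 hg2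

/-- The results of the queries for the half-edges in `H`: for an edge, `A` is the top position at
its earlier end, `C` is the top position at its later end, and `lo` is the position of the earlier
end. -/
def IsTopsArray (w : Fin m → ℝ) (U V P te A C lo : ℕ → ℕ) (H : Set ℕ) : Prop :=
  ∀ h ∈ H, (P (hSrc m U V h) < P (hDst m U V h) →
      IsSearchOrder.IsTop (wt w) te (wt w (hEdge m h)) (P (hSrc m U V h) - 1) (A (hEdge m h))) ∧
    (P (hDst m U V h) ≤ P (hSrc m U V h) →
      IsSearchOrder.IsTop (wt w) te (wt w (hEdge m h)) (P (hSrc m U V h) - 1) (C (hEdge m h)) ∧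
        lo (hEdge m h) = P (hDst m U V h) - 1)

/-- The two half-edges of an edge write to different arrays, since only one of them starts at the
earlier end. Both write to `C` and `lo` only for a loop, and then the new values serve both. -/
theorem IsTopsArray.insert_halfEdge (hT : IsTopsArray w U V P te A C lo H)
    (hq : IsSearchOrder.IsTop (wt w) te (wt w (hEdge m h)) (P (hSrc m U V h) - 1) q)
    (h1 : P (hSrc m U V h) < P (hDst m U V h) →
      A' = Function.update A (hEdge m h) q ∧ C' = C ∧ lo' = lo)
    (h2 : P (hDst m U V h) ≤ P (hSrc m U V h) → A' = A ∧ C' = Function.update C (hEdge m h) q ∧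
      lo' = Function.update lo (hEdge m h) (P (hDst m U V h) - 1)) :
    IsTopsArray w U V P te A' C' lo' (insert h H) := by
  have hcase : ∀ h' ∈ insert h H, hEdge m h' = hEdge m h →
      (hSrc m U V h' = hSrc m U V h ∧ hDst m U V h' = hDst m U V h) ∨
      (hSrc m U V h' = hDst m U V h ∧ hDst m U V h' = hSrc m U V h) := by
    intro h' _ he
    rcases eq_or_opposite (U := U) (V := V) he with rfl | ho
    · exact .inl ⟨rfl, rfl⟩
    · exact .inr ho
  intro h' hh'
  by_cases he : hEdge m h' = hEdge m h
  · rcases hcase h' hh' he with hcs | hcs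
    · rw [hcs.1, hcs.2, he]
      refine ⟨fun hlt ↦ ?_, fun hle ↦ ?_⟩
      · rw [(h1 hlt).1, Function.update_self]; exact hq
      · rw [(h2 hle).2.1, (h2 hle).2.2, Function.update_self, Function.update_self]; exact ⟨hq, rfl⟩
    · by_cases heq : h' = h
      · subst heq
        refine ⟨fun hlt ↦ ?_, fun hle ↦ ?_⟩
        · rw [(h1 hlt).1, Function.update_self]; exact hq
        · rw [(h2 hle).2.1, (h2 hle).2.2, Function.update_self, Function.update_self]; exact ⟨hq, rfl⟩
      have hold := hT h' (hh'.resolve_left heq)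
      rw [hcs.1, hcs.2, he] at hold ⊢
      refine ⟨fun hlt ↦ ?_, fun hle ↦ ?_⟩
      · rw [(h2 hlt.le).1]; exact hold.1 hlt
      · rcases eq_or_lt_of_le hle with heq | hlt
        · rw [(h2 heq.ge).2.1, (h2 heq.ge).2.2, Function.update_self, Function.update_self, ← heq]
          exact ⟨hq, rfl⟩
        · rw [(h1 hlt).2.1, (h1 hlt).2.2]; exact hold.2 hle
  · have hh : h' ∈ H := hh'.resolve_left (by rintro rfl; exact he rfl)
    have hold := hT h' hh
    rcases lt_or_ge (P (hSrc m U V h)) (P (hDst m U V h)) with hlt | hle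
    · obtain ⟨rfl, rfl, rfl⟩ := h1 hlt
      rwa [Function.update_of_ne he]
    · obtain ⟨rfl, rfl, rfl⟩ := h2 hle
      rwa [Function.update_of_ne he, Function.update_of_ne he]

/-- Writes the top position for the weight of the edge in register 12 into register 18. -/
def topProg : Program :=
  .seq (code [.copy 14 5, .add 15 9 3, .add 16 14 3])
    (.seq (.loop (.lt 16 15) (.seq (code [.add 17 14 15, .div 17 17 4, .load 18 10 17, .load 18 7 18])
      (.seq (.ite (.weightLt 18 12) (code [.copy 15 17]) (code [.copy 14 17])) (code [.add 16 14 3]))))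
      (code [.load 18 10 14]))

/-- The lower bound of the search is the bottom or an entry that is heavy enough, the upper bound is
a lighter entry or lies beyond the stack. When they are adjacent, `IsStack.isTop` applies. At most
`n ≤ 2 ^ L` entries need at most `L` halvings. -/
theorem halts_topProg (hc : Consts n m σ) (hB : 2 * n ≤ B) (hL : n ≤ 2 ^ L)
    (hte : IsTreeArray n m (σ.arr 7)) (hj : j < n) (h9 : σ.reg 9 = r)
    (hs : IsStack w (σ.arr 7) (σ.arr 10) r j) (h12 : σ.reg 12 < m) :
    Halts w B topProg σ (11 * L + 7) fun τ ↦ τ.arr = σ.arr ∧ (∀ i < 14, τ.reg i = σ.reg i) ∧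
      IsSearchOrder.IsTop (wt w) (σ.arr 7) (wt w (σ.reg 12)) j (τ.reg 18) := by
  have hrn : r < n := by have := hs.le_apply le_rfl; have := hs.top; omega
  refine (Halts.seq (T := 4) (T' := 11 * L + 3) (Halts.code ?_ ?_)).mono (by omega) fun _ h ↦ h
  · simp [SafeAll, Instr.Safe, Instr.run, Instr.value, h9, hc.r3, hc.r5]; omega
  refine (Halts.seq (T := 11 * L + 1) (T' := 2) ((Halts.loop (fun (d : ℕ) (ρ : State) ↦
    ρ.arr = σ.arr ∧ (∀ i < 14, ρ.reg i = σ.reg i) ∧ ρ.reg 16 = ρ.reg 14 + 1 ∧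
      ρ.reg 14 < ρ.reg 15 ∧ ρ.reg 15 ≤ r + 1 ∧ ρ.reg 15 - ρ.reg 14 ≤ 2 ^ d ∧
      (σ.arr 10 (ρ.reg 14) = 0 ∨ wt w (σ.reg 12) ≤ wt w (σ.arr 7 (σ.arr 10 (ρ.reg 14)))) ∧
      (ρ.reg 15 = r + 1 ∨ wt w (σ.arr 7 (σ.arr 10 (ρ.reg 15))) < wt w (σ.reg 12)))
      (Q := fun ρ ↦ ρ.arr = σ.arr ∧ (∀ i < 14, ρ.reg i = σ.reg i) ∧
        IsSearchOrder.IsTop (wt w) (σ.arr 7) (wt w (σ.reg 12)) j (σ.arr 10 (ρ.reg 14)))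
      (fun d ↦ 11 * d) (a := L) ?_ ?_ ?_).mono le_rfl ?_)).mono (by omega) fun _ h ↦ h
  · rintro d ρ ⟨ha, hr, h16, hlt, hle, hd, h1, h2⟩ hb
    simp only [Test.Holds, h16] at hb
    have h3 : ρ.reg 3 = 1 := (hr 3 (by norm_num)).trans hc.r3
    have h4 : ρ.reg 4 = 2 := (hr 4 (by norm_num)).trans hc.r4
    obtain ⟨d, rfl⟩ : ∃ d', d = d' + 1 :=
      ⟨d - 1, by have : d ≠ 0 := by { rintro rfl; simp at hd; omega }
                 omega⟩
    rw [pow_succ] at hd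
    refine ⟨10, (Halts.seq (T := 5) (T' := 5) (Halts.code ?_ ?_))⟩
    · simp [SafeAll, Instr.Safe]; omega
    set ρ₁ := runAll [.add 17 14 15, .div 17 17 4, .load 18 10 17, .load 18 7 18] ρ with hρ₁
    have ha₁ : ρ₁.arr = σ.arr := ha
    have hr₁ : ∀ i < 17, ρ₁.reg i = ρ.reg i := fun i hi ↦ by
      simp [hρ₁, runAll, Instr.run, Instr.value, show i ≠ 17 by omega, show i ≠ 18 by omega]
    have h17 : ρ₁.reg 17 = (ρ.reg 14 + ρ.reg 15) / 2 := by
      simp [hρ₁, runAll, Instr.run, Instr.value, h4]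
    have h18 : ρ₁.reg 18 = σ.arr 7 (σ.arr 10 ((ρ.reg 14 + ρ.reg 15) / 2)) := by
      simp [hρ₁, runAll, Instr.run, Instr.value, h4, ha]
    set mid := (ρ.reg 14 + ρ.reg 15) / 2 with hmid
    have hml : ρ.reg 14 < mid := by omega
    have hmr : mid < ρ.reg 15 := by omega
    have h0 : σ.arr 10 mid ≠ 0 := by have := hs.le_apply (g := mid) (by omega); omega
    have hmj := hs.le_top (g := mid) (by omega)
    have htem : σ.arr 7 (σ.arr 10 mid) < m := hte.lt _ (by omega) (by omega)
    have hr12 : ρ₁.reg 12 = σ.reg 12 := by rw [hr₁ 12 (by norm_num), hr 12 (by norm_num)]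
    refine (Halts.seq (T := 3) (T' := 2) (Halts.mono (T := 3) (Q := fun ρ₂ ↦ ρ₂.arr = σ.arr ∧
      (∀ i < 14, ρ₂.reg i = σ.reg i) ∧ ρ₂.reg 14 < ρ₂.reg 15 ∧ ρ₂.reg 15 ≤ r + 1 ∧
      ρ₂.reg 15 - ρ₂.reg 14 ≤ 2 ^ d ∧
      (σ.arr 10 (ρ₂.reg 14) = 0 ∨ wt w (σ.reg 12) ≤ wt w (σ.arr 7 (σ.arr 10 (ρ₂.reg 14)))) ∧
      (ρ₂.reg 15 = r + 1 ∨ wt w (σ.arr 7 (σ.arr 10 (ρ₂.reg 15))) < wt w (σ.reg 12))) ?_ le_rfl ?_))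
    · refine Halts.ite (T := 2) (fun hb ↦ Halts.code (by simp [SafeAll, Instr.Safe]) ?_) fun hb ↦
        Halts.code (by simp [SafeAll, Instr.Safe]) ?_ <;>
      rw [holds_weightLt, h18, hr12] at hb
      · refine ⟨ha₁, fun i hi ↦ ?_, ?_⟩
        · simp [runAll, Instr.run, Instr.value, show i ≠ 15 by omega, hr₁ i (by omega), hr i hi]
        · simp [runAll, Instr.run, Instr.value, h17, hr₁]
          exact ⟨hml, by omega, by omega, h1, .inr hb.2.2⟩
      · refine ⟨ha₁, fun i hi ↦ ?_, ?_⟩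
        · simp [runAll, Instr.run, Instr.value, show i ≠ 14 by omega, hr₁ i (by omega), hr i hi]
        · simp [runAll, Instr.run, Instr.value, h17, hr₁]
          refine ⟨hmr, hle, by omega, .inr ?_, h2⟩
          by_contra! hlt
          exact hb ⟨htem, h12, hlt⟩
    · rintro ρ₂ ⟨ha₂, hr₂, h1, h2, h3', h4, h5⟩
      have h3 : ρ₂.reg 3 = 1 := (hr₂ 3 (by norm_num)).trans hc.r3
      refine Halts.code ?_ ⟨d, ⟨ha₂, fun i hi ↦ ?_, ?_⟩, ?_⟩
      · simp [SafeAll, Instr.Safe, h3]; omega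
      · simp [runAll, Instr.run, Instr.value, show i ≠ 16 by omega, hr₂ i hi]
      · simp [runAll, Instr.run, Instr.value, h3]
        exact ⟨h1, h2, by omega, h4, h5⟩
      · omega
  · rintro d ρ ⟨ha, hr, h16, hlt, hle, hd, h1, h2⟩ hb
    simp only [Test.Holds, h16] at hb
    refine ⟨ha, hr, hs.isTop (by omega) h1 ?_⟩
    rw [show ρ.reg 14 + 1 = ρ.reg 15 by omega]
    exact h2.imp_left fun h ↦ by omega
  · refine ⟨rfl, fun i hi ↦ ?_, ?_⟩
    · simp [runAll, Instr.run, Instr.value, show i ≠ 16 by omega, show i ≠ 15 by omega,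
        show i ≠ 14 by omega]
    · simp [runAll, Instr.run, Instr.value, h9, hc.r3, hc.r5]
      exact ⟨by omega, .inl hs.zero⟩
  · rintro ρ ⟨ha, hr, ht⟩
    refine Halts.code (by simp [SafeAll, Instr.Safe]) ⟨ha, fun i hi ↦ ?_, ?_⟩
    · simp [runAll, Instr.run, Instr.value, show i ≠ 18 by omega, hr i hi]
    · simpa [runAll, Instr.run, Instr.value, ha] using ht

/-- Stores the top position for the half-edge that is being scanned. -/
def queryProg : Program :=
  .seq topProg (.seq (code [.load 19 5 13, .add 20 6 3])
    (.ite (.lt 20 19) (code [.store 11 12 18]) (code [.store 12 12 18, .sub 19 19 3, .store 13 12 19])))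

theorem halts_queryProg (hc : Consts n m σ) (hB : 2 * n ≤ B) (hL : n ≤ 2 ^ L)
    (hte : IsTreeArray n m (σ.arr 7)) (hj : j < n) (h6 : σ.reg 6 = j) (h9 : σ.reg 9 = r)
    (hs : IsStack w (σ.arr 7) (σ.arr 10) r j) (hh : h < 2 * m) (h12 : σ.reg 12 = hEdge m h)
    (h13 : σ.reg 13 = hDst m U V h) (hsrc : σ.arr 5 (hSrc m U V h) = j + 1)
    (hT : IsTopsArray w U V (σ.arr 5) (σ.arr 7) (σ.arr 11) (σ.arr 12) (σ.arr 13) H) :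
    Halts w B queryProg σ (11 * L + 15) fun τ ↦
      (∀ a, a ≠ 11 → a ≠ 12 → a ≠ 13 → τ.arr a = σ.arr a) ∧ (∀ i < 14, τ.reg i = σ.reg i) ∧
      IsTopsArray w U V (σ.arr 5) (σ.arr 7) (τ.arr 11) (τ.arr 12) (τ.arr 13) (insert h H) := by
  refine (Halts.seq (T := 11 * L + 7) (T' := 8) ((halts_topProg hc hB hL hte hj h9 hs
    (h12 ▸ hEdge_lt hh)).mono le_rfl ?_)).mono (by omega) fun _ h ↦ h
  rintro σ₁ ⟨ha₁, hr₁, ht⟩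
  rw [h12] at ht
  refine (Halts.seq (T := 3) (T' := 5) (Halts.code ?_ ?_)).mono (by omega) fun _ h ↦ h
  · simp [SafeAll, Instr.Safe, Instr.run, hr₁, h6, hc.r3]; omega
  set σ₂ := runAll [.load 19 5 13, .add 20 6 3] σ₁ with hσ₂
  have ha₂ : σ₂.arr = σ.arr := ha₁
  have hr₂ : ∀ i < 14, σ₂.reg i = σ.reg i := fun i hi ↦ by
    simp [hσ₂, runAll, Instr.run, Instr.value, show i ≠ 19 by omega, show i ≠ 20 by omega, hr₁ i hi]
  have h18 : σ₂.reg 18 = σ₁.reg 18 := by simp [hσ₂, runAll, Instr.run, Instr.value]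
  have h19 : σ₂.reg 19 = σ.arr 5 (hDst m U V h) := by
    simp [hσ₂, runAll, Instr.run, Instr.value, ha₁, hr₁, h13]
  have h20 : σ₂.reg 20 = j + 1 := by simp [hσ₂, runAll, Instr.run, Instr.value, hr₁, h6, hc.r3]
  have ht' : IsSearchOrder.IsTop (wt w) (σ.arr 7) (wt w (hEdge m h)) (σ.arr 5 (hSrc m U V h) - 1) (σ₁.reg 18) := by
    rwa [hsrc, Nat.add_sub_cancel]
  refine Halts.ite (T := 4) (fun hb ↦ (Halts.code (l := [.store 11 12 18]) (by simp [SafeAll, Instr.Safe])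
    ?_).mono (by simp) fun _ h ↦ h) fun hb ↦ Halts.code (by simp [SafeAll, Instr.Safe]) ?_ <;>
    simp only [Test.Holds, h19, h20] at hb
  · refine ⟨fun a h1 h2 h3 ↦ ?_, fun i hi ↦ ?_, hT.insert_halfEdge ht' (fun _ ↦ ?_) fun hle ↦ ?_⟩
    · simp [runAll, Instr.run, Instr.value, h1, ha₂]
    · simp [runAll, Instr.run, Instr.value, hr₂ i hi]
    · simp [runAll, Instr.run, Instr.value, ha₂, h18, hr₂, h12]
    · omega
  · refine ⟨fun a h1 h2 h3 ↦ ?_, fun i hi ↦ ?_, hT.insert_halfEdge ht' (fun hlt ↦ ?_) fun _ ↦ ?_⟩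
    · simp [runAll, Instr.run, Instr.value, h2, h3, ha₂]
    · simp [runAll, Instr.run, Instr.value, hr₂ i hi, show i ≠ 19 by omega]
    · omega
    · simp [runAll, Instr.run, Instr.value, ha₂, h18, hr₂, h12, h19, hc.r3]

end Tops

/-! ### The queries for all half-edges. -/

section TopsLoop

variable {m : ℕ} {w : Fin m → ℝ} {B n k : ℕ} {U V P ord te tl : ℕ → ℕ} {j x h L r : ℕ}
  {σ σ₀ ρ : State}

theorem Searched.ne_zero (hS : Searched w n U V P ord te tl n) (hx : x < n) : P x ≠ 0 := by
  have hinj : Set.InjOn ord (Finset.range n : Set ℕ) := fun p hp q hq hpq ↦ by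
    simp only [Finset.coe_range, Set.mem_Iio] at hp hq
    have h1 := (hS.ord_lt p hp).2
    rw [hpq, (hS.ord_lt q hq).2] at h1
    omega
  have hmaps : Set.MapsTo ord (Finset.range n : Set ℕ) (Finset.range n : Set ℕ) := fun p hp ↦ by
    simp only [Finset.coe_range, Set.mem_Iio] at hp ⊢
    exact (hS.ord_lt p hp).1
  obtain ⟨p, hp, rfl⟩ := (Finset.surjOn_of_injOn_of_card_le ord hmaps hinj le_rfl)
    (show x ∈ (Finset.range n : Set ℕ) by simpa using hx)
  simp only [Finset.coe_range, Set.mem_Iio] at hp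
  rw [(hS.ord_lt p hp).2]
  exact Nat.succ_ne_zero p

theorem Searched.isTreeArray (hS : Searched w n U V P ord te tl n) (hn : 0 < n) :
    IsTreeArray n m te := by
  refine ⟨hS.zero hn, fun p h0 hp ↦ ?_⟩
  obtain ⟨h, hh, he, -⟩ := hS.edge p h0 hp
  exact he ▸ hEdge_lt hh

/-- The invariant of the query phase, when the half-edges from the vertices before position `i` have
been treated, and the stack consists of positions up to `j`; `σ₀` is the state before this phase. -/
structure TopsInv (w : Fin m → ℝ) (U V : ℕ → ℕ) (σ₀ : State) (i j r : ℕ) (σ : State) : Prop where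
  reg : ∀ i < 6, σ.reg i = σ₀.reg i
  arr : ∀ a, a < 10 ∨ 14 ≤ a → σ.arr a = σ₀.arr a
  r9 : σ.reg 9 = r
  stack : IsStack w (σ₀.arr 7) (σ.arr 10) r j
  tops : IsTopsArray w U V (σ₀.arr 5) (σ₀.arr 7) (σ.arr 11) (σ.arr 12) (σ.arr 13)
    {h | h < 2 * m ∧ σ₀.arr 5 (hSrc m U V h) ≤ i}

/-- Queries all half-edges from the vertex at the position in register 6. -/
def topsStep : Program := .seq (code [.load 7 6 6]) (scanProg queryProg)

theorem halts_topsStep (hI : IsConnectedInput n m U V) (hB : 2 * n ≤ B) (hL : n ≤ 2 ^ L)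
    (h₀ : SearchInv w n k U V n σ₀) (hσ : TopsInv w U V σ₀ j j r σ) (h6 : σ.reg 6 = j) (hj : j < n) :
    Halts w B topsStep σ ((11 * L + 24) * degree m U V (σ₀.arr 6 j) + 5) fun τ ↦
      TopsInv w U V σ₀ (j + 1) j r τ ∧ τ.reg 6 = j := by
  obtain ⟨tl, hS⟩ := h₀.searched
  obtain ⟨l, hl, hnd, hlm⟩ := h₀.adj (σ₀.arr 6 j)
  have hc : Consts n m σ := h₀.consts.congr hσ.reg
  obtain ⟨hox, hPo⟩ := hS.ord_lt j hj
  have hdeg : degree m U V (σ₀.arr 6 j) = l.length := by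
    rw [degree, ← List.toFinset_card_of_nodup hnd]
    congr 1
    ext h
    simp [hlm]
  rw [hdeg]
  refine (Halts.seq (T := 2) (T' := (11 * L + 24) * l.length + 3)
    (Halts.code (by simp [SafeAll, Instr.Safe]) ?_)).mono (by omega) fun _ h ↦ h
  set σ₁ := runAll [.load 7 6 6] σ with hσ₁
  have ha₁ : σ₁.arr = σ.arr := rfl
  have hr₁ : ∀ i, i ≠ 7 → σ₁.reg i = σ.reg i := fun i hi ↦ by
    simp [hσ₁, runAll, Instr.run, Instr.value, hi]
  have h7 : σ₁.reg 7 = σ₀.arr 6 j := by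
    simp [hσ₁, runAll, Instr.run, Instr.value, h6, hσ.arr]
  have hc₁ : Consts n m σ₁ := hc.congr fun i hi ↦ hr₁ i (by omega)
  have hU : σ₁.arr 0 = U := by rw [ha₁, hσ.arr 0 (by norm_num), h₀.arr0]
  have hV : σ₁.arr 1 = V := by rw [ha₁, hσ.arr 1 (by norm_num), h₀.arr1]
  refine (halts_scanProg hc₁ (T := 11 * L + 15)
    (H₀ := {h | h < 2 * m ∧ σ₀.arr 5 (hSrc m U V h) ≤ j}) (l := l)
    (fun H ρ ↦ (∀ a, a < 10 ∨ 14 ≤ a → ρ.arr a = σ₀.arr a) ∧ ρ.arr 10 = σ.arr 10 ∧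
      IsTopsArray w U V (σ₀.arr 5) (σ₀.arr 7) (ρ.arr 11) (ρ.arr 12) (ρ.arr 13) H) ?_ ?_ hnd ?_ ?_
      ⟨hσ.arr, rfl, hσ.tops⟩).mono le_rfl ?_
  · rintro H ρ τ ha - hρ
    rwa [ha]
  · rw [ha₁, hσ.arr 4 (by norm_num), hσ.arr 3 (by norm_num), h7]
    exact hl
  · rintro h hh ⟨-, hs⟩
    rw [((hlm h).1 hh).2, hPo] at hs
    omega
  · rintro h hh H ρ - ⟨ha, h10, hT⟩ - hr h12 h13
    obtain ⟨hhm, hsx⟩ := (hlm h).1 hh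
    rw [hU, hV] at h13
    have ha5 := ha 5 (by norm_num)
    have ha7 := ha 7 (by norm_num)
    refine (halts_queryProg (hc₁.congr fun i hi ↦ hr i (by omega)) hB hL (j := j) (r := r) (U := U) (V := V)
      (H := H) (ha7 ▸ hS.isTreeArray (by omega)) hj ?_ ?_ ?_ hhm h12 h13 ?_ ?_).mono le_rfl ?_
    · rw [hr 6 (by norm_num), hr₁ 6 (by norm_num), h6]
    · rw [hr 9 (by norm_num), hr₁ 9 (by norm_num), hσ.r9]
    · rw [ha7, h10]
      exact hσ.stack
    · rw [ha5, hsx, hPo]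
    · rwa [ha5, ha7]
    · rintro τ ⟨h1, h2, h3⟩
      rw [ha5, ha7] at h3
      exact ⟨⟨fun a h ↦ by rw [h1 a (by omega) (by omega) (by omega), ha a h],
        by rw [h1 10 (by norm_num) (by norm_num) (by norm_num), h10], h3⟩,
        ⟨h1 0 (by norm_num) (by norm_num) (by norm_num), h1 1 (by norm_num) (by norm_num) (by norm_num),
        h1 3 (by norm_num) (by norm_num) (by norm_num), h1 4 (by norm_num) (by norm_num) (by norm_num)⟩,
        fun i hi ↦ h2 i (by omega)⟩
  · rintro τ ⟨⟨ha, h10, hT⟩, -, hr⟩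
    refine ⟨⟨fun i hi ↦ ?_, ha, ?_, h10 ▸ hσ.stack, ?_⟩, ?_⟩
    · rw [hr i (by omega), hr₁ i (by omega), hσ.reg i hi]
    · rw [hr 9 (by norm_num), hr₁ 9 (by norm_num), hσ.r9]
    · convert hT using 1
      ext h
      simp only [Set.mem_ofPred_eq, Set.mem_union, hlm]
      constructor
      · rintro ⟨h1, h2⟩
        rcases Nat.le_succ_iff.1 h2 with h2 | h2
        · exact .inl ⟨h1, h2⟩
        · refine .inr ⟨h1, ?_⟩
          have := hS.ord_pos _ (hI.src_lt h1) (by omega)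
          rw [← this, h2, Nat.succ_sub_one]
      · rintro (⟨h1, h2⟩ | ⟨h1, h2⟩)
        · exact ⟨h1, by omega⟩
        · exact ⟨h1, by rw [h2, hPo]⟩
    · rw [hr 6 (by norm_num), hr₁ 6 (by norm_num), h6]

/-- Position 0 is treated ahead of the loop: with height 0 and array 10 still zero, the stack
already consists of position 0. -/
def topsProg : Program :=
  .seq (code [.const 6 0, .const 9 0])
    (.seq topsStep (.seq (code [.add 6 6 3])
      (.loop (.lt 6 0) (.seq pushProg (.seq topsStep (code [.add 6 6 3]))))))

/-- The number of half-edges from the vertices at the positions from `j` on. -/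
noncomputable def unqueried (m : ℕ) (U V P : ℕ → ℕ) (j : ℕ) : ℕ :=
  ((Finset.range (2 * m)).filter fun h ↦ j < P (hSrc m U V h)).card

theorem unqueried_succ_add_degree_le (hx : P x = j + 1) :
    unqueried m U V P (j + 1) + degree m U V x ≤ unqueried m U V P j := by
  rw [unqueried, degree, ← Finset.card_union_of_disjoint]
  · refine Finset.card_le_card fun h hh ↦ ?_
    simp only [Finset.mem_union, Finset.mem_filter] at hh ⊢
    rcases hh with ⟨h1, h2⟩ | ⟨h1, h2⟩
    · exact ⟨h1, by omega⟩
    · exact ⟨h1, by rw [h2, hx]; omega⟩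
  · rw [Finset.disjoint_left]
    intro h h1 h2
    simp only [Finset.mem_filter] at h1 h2
    rw [h2.2, hx] at h1
    omega

theorem halts_topsProg (hI : IsConnectedInput n m U V) (hB : 2 * n ≤ B) (hL : n ≤ 2 ^ L) (hn : 0 < n)
    (h₀ : SearchInv w n k U V n σ₀) :
    Halts w B topsProg σ₀ ((11 * L + 24) * (2 * m) + 21 * n + 11) fun τ ↦
      (∀ i < 6, τ.reg i = σ₀.reg i) ∧ (∀ a, a < 10 ∨ 14 ≤ a → τ.arr a = σ₀.arr a) ∧
      IsTopsArray w U V (σ₀.arr 5) (σ₀.arr 7) (τ.arr 11) (τ.arr 12) (τ.arr 13) {h | h < 2 * m} := by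
  obtain ⟨tl, hS⟩ := h₀.searched
  have hte := hS.isTreeArray hn
  set d := degree m U V (σ₀.arr 6 0) with hd
  have hun : unqueried m U V (σ₀.arr 5) 0 ≤ 2 * m := (Finset.card_filter_le _ _).trans (by simp)
  have hun' := unqueried_succ_add_degree_le (m := m) (U := U) (V := V) (hS.ord_lt 0 hn).2
  rw [← hd] at hun'
  have hm : (11 * L + 24) * (2 * m) = (11 * L + 24) * d + (11 * L + 24) * (2 * m - d) := by
    rw [← mul_add]; congr 1; omega
  refine (Halts.seq (T := 3) (T' := (11 * L + 24) * (2 * m) + 21 * n + 8)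
    (Halts.code (by simp [SafeAll, Instr.Safe]) ?_)).mono (by omega) fun _ h ↦ h
  set σ₁ := runAll [.const 6 0, .const 9 0] σ₀ with hσ₁
  have h₁ : TopsInv w U V σ₀ 0 0 0 σ₁ := by
    refine ⟨fun i hi ↦ ?_, fun _ _ ↦ rfl, ?_, ⟨?_, ?_, by simp, by simp⟩, ?_⟩
    · simp [hσ₁, runAll, Instr.run, Instr.value, show i ≠ 6 by omega, show i ≠ 9 by omega]
    · simp [hσ₁, runAll, Instr.run, Instr.value]
    · exact h₀.zero 10 (by norm_num) 0
    · exact h₀.zero 10 (by norm_num) 0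
    · rintro h ⟨hh, hle⟩
      have := hS.ne_zero (hI.src_lt hh)
      omega
  have h6 : σ₁.reg 6 = 0 := by simp [hσ₁, runAll, Instr.run, Instr.value]
  refine (Halts.seq (T := (11 * L + 24) * d + 5) (T' := (11 * L + 24) * (2 * m - d) + 21 * (n - 1) + 3)
    ((halts_topsStep hI hB hL h₀ h₁ h6 hn).mono le_rfl ?_)).mono (by omega) fun _ h ↦ h
  rintro σ₂ ⟨h₂, h6₂⟩
  have hnext : ∀ {i j r : ℕ} {ρ : State}, TopsInv w U V σ₀ i j r ρ → ρ.reg 6 = j →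
      TopsInv w U V σ₀ i j r (runAll [.add 6 6 3] ρ) ∧ (runAll [.add 6 6 3] ρ).reg 6 = j + 1 := by
    intro i j r ρ hρ h6
    refine ⟨⟨fun i hi ↦ ?_, hρ.arr, ?_, hρ.stack, hρ.tops⟩, ?_⟩
    · simp [runAll, Instr.run, Instr.value, show i ≠ 6 by omega, hρ.reg i hi]
    · simp [runAll, Instr.run, Instr.value, hρ.r9]
    · simp [runAll, Instr.run, Instr.value, h6, hρ.reg, h₀.consts.r3]
  have hsafe : ∀ {i j r : ℕ} {ρ : State}, TopsInv w U V σ₀ i j r ρ → ρ.reg 6 = j → j < n →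
      SafeAll B [.add 6 6 3] ρ := by
    intro i j r ρ hρ h6 hj
    simp [SafeAll, Instr.Safe, h6, hρ.reg, h₀.consts.r3]
    omega
  refine (Halts.seq (T := 2) (T' := (11 * L + 24) * (2 * m - d) + 21 * (n - 1) + 1)
    (Halts.code (hsafe h₂ h6₂ hn) ?_)).mono (by omega) fun _ h ↦ h
  -- The height of the stack is part of the potential, so that each entry pays at its insertion for
  -- its later removal. The 21 steps per position include these 5.
  refine (Halts.loop (fun (a : ℕ × ℕ × ℕ) (ρ : State) ↦ TopsInv w U V σ₀ (a.1 + 1) a.1 a.2.2 ρ ∧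
    ρ.reg 6 = a.1 + 1 ∧ a.1 < n ∧ unqueried m U V (σ₀.arr 5) (a.1 + 1) ≤ a.2.1)
    (fun a ↦ (11 * L + 24) * a.2.1 + 5 * a.2.2 + 21 * (n - (a.1 + 1)))
    (a := (0, 2 * m - d, 0)) ?_ ?_ ⟨(hnext h₂ h6₂).1, (hnext h₂ h6₂).2, hn, ?_⟩).mono
    (by simp) fun _ h ↦ h
  · rintro ⟨j, s, r⟩ ρ ⟨hρ, h6, hjn, hs⟩ hb
    have hcρ : Consts n m ρ := h₀.consts.congr hρ.reg
    simp only [Test.Holds, hcρ.r0] at hb h6 hjn hs hρ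
    rw [h6] at hb
    have hdeg := unqueried_succ_add_degree_le (m := m) (U := U) (V := V) (hS.ord_lt (j + 1) hb).2
    set d' := degree m U V (σ₀.arr 6 (j + 1)) with hd'
    have ha7 := hρ.arr 7 (by norm_num)
    obtain ⟨r', hr', hpush⟩ := halts_pushProg (B := B) hcρ (by omega) (ha7 ▸ hte) h6 hb hρ.r9
      (ha7 ▸ hρ.stack)
    refine ⟨5 * (r + 1 - r') + 8 + ((11 * L + 24) * d' + 5 + 2), Halts.seq (hpush.mono le_rfl ?_)⟩
    rintro ρ₁ ⟨ha₁, hr₁, h9₁, hs₁⟩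
    have hρ₁ : TopsInv w U V σ₀ (j + 1) (j + 1) r' ρ₁ := by
      refine ⟨fun i hi ↦ by rw [hr₁ i (by omega), hρ.reg i hi],
        fun a ha ↦ by rw [ha₁ a (by omega), hρ.arr a ha], h9₁, ha7 ▸ hs₁, ?_⟩
      rw [ha₁ 11 (by norm_num), ha₁ 12 (by norm_num), ha₁ 13 (by norm_num)]
      exact hρ.tops
    refine Halts.seq ((halts_topsStep hI hB hL h₀ hρ₁
      ((hr₁ 6 (by norm_num)).trans h6) hb).mono le_rfl ?_)
    rintro ρ₂ ⟨hρ₂, h6₂⟩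
    refine Halts.code (hsafe hρ₂ h6₂ hb) ⟨(j + 1, s - d', r'),
      ⟨(hnext hρ₂ h6₂).1, (hnext hρ₂ h6₂).2, hb, ?_⟩, ?_⟩
    · simp only
      omega
    · obtain ⟨s', rfl⟩ : ∃ s', s = s' + d' := ⟨s - d', by omega⟩
      simp only [Nat.add_sub_cancel]
      rw [mul_add]
      omega
  · rintro ⟨j, s, r⟩ ρ ⟨hρ, h6, hjn, hs⟩ hb
    have hcρ : Consts n m ρ := h₀.consts.congr hρ.reg
    simp only [Test.Holds, hcρ.r0] at hb h6 hjn hρ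
    rw [h6] at hb
    refine ⟨hρ.reg, hρ.arr, ?_⟩
    convert hρ.tops using 1
    ext h
    simp only [Set.mem_ofPred_eq]
    refine ⟨fun hh ↦ ⟨hh, ?_⟩, fun hh ↦ hh.1⟩
    have := hS.pos_le _ (hI.src_lt hh)
    omega
  · simp only
    omega

end TopsLoop

/-! ### The output phases: spare edges, low points, and the final count. -/

section Output

variable {m : ℕ} {w : Fin m → ℝ} {B n k : ℕ} {te A C lo : ℕ → ℕ} {f p q i : ℕ} {σ : State}

/-- Decides whether the output has at most `k` elements. -/
def countProg : Program :=
  .seq (code [.const 6 0, .const 7 0])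
    (.seq (.loop (.lt 6 1) (.seq (code [.load 8 2 6])
        (.seq (.ite (.eq 8 5) (code []) (code [.add 7 7 3])) (code [.add 6 6 3]))))
      (.ite (.lt 2 7) (code [.const 0 0]) (code [.const 0 1])))

theorem card_edgeOutput (σ : State) (m : ℕ) :
    (σ.edgeOutput m).card = ((Finset.range m).filter fun f ↦ σ.arr 2 f ≠ 0).card := by
  refine Finset.card_bij (fun e _ ↦ (e : ℕ)) (fun e he ↦ ?_) (fun e _ e' _ h ↦ Fin.ext h)
    fun f hf ↦ ?_
  · simpa [State.edgeOutput] using he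
  · simp only [Finset.mem_filter, Finset.mem_range] at hf
    exact ⟨⟨f, hf.1⟩, by simpa [State.edgeOutput] using hf.2, rfl⟩

theorem halts_countProg (hc : Consts n m σ) (h2 : σ.reg 2 = k) (hB : m + 1 ≤ B) :
    Halts w B countProg σ (8 * m + 7) fun τ ↦ τ.arr = σ.arr ∧
      (τ.reg 0 = 1 ↔ (τ.edgeOutput m).card ≤ k) := by
  refine (Halts.seq (T := 3) (T' := 8 * m + 4)
    (Halts.code (by simp [SafeAll, Instr.Safe]) ?_)).mono (by omega) fun _ h ↦ h
  refine (Halts.seq (T := 8 * m + 1) (T' := 3) ((Halts.loop (fun (e : ℕ) (ρ : State) ↦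
    ρ.arr = σ.arr ∧ (∀ i < 6, ρ.reg i = σ.reg i) ∧ ρ.reg 6 = e ∧ e ≤ m ∧
      ρ.reg 7 = ((Finset.range e).filter fun f ↦ σ.arr 2 f ≠ 0).card) (fun e ↦ 8 * (m - e))
      (Q := fun ρ ↦ ρ.arr = σ.arr ∧ ρ.reg 2 = k ∧ ρ.reg 7 = (ρ.edgeOutput m).card)
      (a := 0) ?_ ?_ ?_).mono le_rfl ?_)).mono (by omega) fun _ h ↦ h
  · rintro e ρ ⟨ha, hr, h6, he, h7⟩ hb
    have hcρ : Consts n m ρ := hc.congr hr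
    simp only [Test.Holds, h6, hcρ.r1] at hb
    have hle : ((Finset.range e).filter fun f ↦ σ.arr 2 f ≠ 0).card ≤ e :=
      (Finset.card_filter_le _ _).trans (by simp)
    refine ⟨2 + (3 + 2), Halts.seq (Halts.code (by simp [SafeAll, Instr.Safe]) (Halts.seq
      (Halts.mono (T := 3) (Q := fun ρ' ↦ ρ'.arr = σ.arr ∧ (∀ i < 6, ρ'.reg i = σ.reg i) ∧
        ρ'.reg 6 = e ∧ ρ'.reg 7 = ((Finset.range (e + 1)).filter fun f ↦ σ.arr 2 f ≠ 0).card)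
        ?_ le_rfl ?_)))⟩
    · refine Halts.ite (T := 2) (fun hb ↦ (Halts.code (l := []) trivial ?_).mono (by simp)
        fun _ h ↦ h) fun hb ↦ Halts.code ?_ ?_
      · have h0 : σ.arr 2 e = 0 := by
          simpa [Test.Holds, runAll, Instr.run, Instr.value, h6, ha, hcρ.r5] using hb
        refine ⟨ha, fun i hi ↦ ?_, ?_, ?_⟩
        · simp [runAll, Instr.run, Instr.value, show i ≠ 8 by omega, hr i hi]
        · simp [runAll, Instr.run, Instr.value, h6]
        · rw [Finset.range_add_one, Finset.filter_insert, if_neg (by simpa using h0)]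
          simp [runAll, Instr.run, Instr.value, h7]
      · simp [SafeAll, Instr.Safe, runAll, Instr.run, h7, hcρ.r3]
        have : ((Finset.range e).filter fun f ↦ ¬ σ.arr 2 f = 0).card ≤ e := hle
        omega
      · have h0 : σ.arr 2 e ≠ 0 := by
          simpa [Test.Holds, runAll, Instr.run, Instr.value, h6, ha, hcρ.r5] using hb
        refine ⟨ha, fun i hi ↦ ?_, ?_, ?_⟩
        · simp [runAll, Instr.run, Instr.value, show i ≠ 8 by omega, show i ≠ 7 by omega, hr i hi]
        · simp [runAll, Instr.run, Instr.value, h6]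
        · rw [Finset.range_add_one, Finset.filter_insert, if_pos h0,
            Finset.card_insert_of_notMem (by simp)]
          simp [runAll, Instr.run, Instr.value, h7, hcρ.r3]
    · rintro ρ' ⟨ha', hr', h6', h7'⟩
      have h3 : ρ'.reg 3 = 1 := (hr' 3 (by norm_num)).trans hc.r3
      refine Halts.code ?_ ⟨e + 1, ⟨ha', fun i hi ↦ ?_, ?_, hb, ?_⟩, ?_⟩
      · simp [SafeAll, Instr.Safe, h6', h3]; omega
      · simp [runAll, Instr.run, Instr.value, show i ≠ 6 by omega, hr' i hi]
      · simp [runAll, Instr.run, Instr.value, h6', h3]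
      · simp [runAll, Instr.run, Instr.value, h7']
      · omega
  · rintro e ρ ⟨ha, hr, h6, he, h7⟩ hb
    simp only [Test.Holds, h6, (hc.congr hr : Consts n m ρ).r1] at hb
    obtain rfl : e = m := by omega
    exact ⟨ha, (hr 2 (by norm_num)).trans h2, by rw [h7, card_edgeOutput, ha]⟩
  · refine ⟨rfl, fun i hi ↦ ?_, ?_, Nat.zero_le _, ?_⟩
    · simp [runAll, Instr.run, Instr.value, show i ≠ 6 by omega, show i ≠ 7 by omega]
    · simp [runAll, Instr.run, Instr.value]
    · simp [runAll, Instr.run, Instr.value]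
  · rintro ρ ⟨ha, h2, h7⟩
    refine Halts.ite (T := 2) (fun hb ↦ Halts.code (by simp [SafeAll, Instr.Safe]) ⟨ha, ?_⟩) fun hb ↦
      Halts.code (by simp [SafeAll, Instr.Safe]; omega) ⟨ha, ?_⟩ <;>
    change _ ↔ (ρ.edgeOutput m).card ≤ k <;>
    simp only [Test.Holds, h2, h7] at hb <;>
    simp [runAll, Instr.run, Instr.value] <;> omega

/-- The edge `f` is not in the tree, and it is not a loop of the graph of its weight class. -/
def IsSpare (te C lo : ℕ → ℕ) (f : ℕ) : Prop := lo f < C f ∧ te (C f) ≠ f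

/-- Runs `body` for all edges that satisfy `IsSpare`. -/
def spareProg (body : Program) : Program :=
  .seq (code [.const 6 0]) (.loop (.lt 6 1) (.seq (code [.load 8 12 6, .load 9 13 6, .load 10 7 8])
    (.seq (.ite (.lt 9 8) (.ite (.ne 10 6) body (code [])) (code [])) (code [.add 6 6 3]))))

theorem halts_spareProg (hc : Consts n m σ) (hB : m + 1 ≤ B) {body : Program} {T : ℕ} (hT : 1 ≤ T)
    (hte : σ.arr 7 = te) (hC : σ.arr 12 = C) (hlo : σ.arr 13 = lo) (I : ℕ → (ℕ → ℕ → ℕ) → Prop)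
    (hskip : ∀ e < m, ∀ a, ¬ IsSpare te C lo e → I e a → I (e + 1) a)
    (hbody : ∀ e < m, ∀ ρ, IsSpare te C lo e → Consts n m ρ → ρ.reg 6 = e → ρ.reg 8 = C e →
      ρ.reg 9 = lo e → I e ρ.arr → Halts w B body ρ T fun τ ↦ I (e + 1) τ.arr ∧
        (∀ a, a ≠ 2 → a ≠ 14 → τ.arr a = ρ.arr a) ∧ ∀ i < 7, τ.reg i = ρ.reg i)
    (h0 : I 0 σ.arr) :
    Halts w B (spareProg body) σ ((T + 9) * m + 3) fun τ ↦ I m τ.arr ∧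
      (∀ a, a ≠ 2 → a ≠ 14 → τ.arr a = σ.arr a) ∧ ∀ i < 6, τ.reg i = σ.reg i := by
  refine (Halts.seq (T := 2) (T' := (T + 9) * m + 1)
    (Halts.code (by simp [SafeAll, Instr.Safe]) ?_)).mono (by omega) fun _ h ↦ h
  refine (Halts.loop (fun (e : ℕ) (ρ : State) ↦ I e ρ.arr ∧
    (∀ a, a ≠ 2 → a ≠ 14 → ρ.arr a = σ.arr a) ∧ (∀ i < 6, ρ.reg i = σ.reg i) ∧ ρ.reg 6 = e ∧ e ≤ m)
      (fun e ↦ (T + 9) * (m - e)) (a := 0) ?_ ?_ ?_).mono (by simp) fun _ h ↦ h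
  · rintro e ρ ⟨hI, ha, hr, h6, he⟩ hb
    have hcρ : Consts n m ρ := hc.congr hr
    simp only [Test.Holds, h6, hcρ.r1] at hb
    refine ⟨4 + ((T + 2) + 2), Halts.seq (Halts.code (by simp [SafeAll, Instr.Safe]) ?_)⟩
    set ρ₁ := runAll [.load 8 12 6, .load 9 13 6, .load 10 7 8] ρ with hρ₁
    have ha₁ : ρ₁.arr = ρ.arr := rfl
    have hr₁ : ∀ i < 7, ρ₁.reg i = ρ.reg i := fun i hi ↦ by
      simp [hρ₁, runAll, Instr.run, Instr.value, show i ≠ 8 by omega, show i ≠ 9 by omega,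
        show i ≠ 10 by omega]
    have h8 : ρ₁.reg 8 = C e := by simp [hρ₁, runAll, Instr.run, Instr.value, h6, ha, hC]
    have h9 : ρ₁.reg 9 = lo e := by simp [hρ₁, runAll, Instr.run, Instr.value, h6, ha, hlo]
    have h10 : ρ₁.reg 10 = te (C e) := by
      simp [hρ₁, runAll, Instr.run, Instr.value, h6, ha, hC, hte]
    have h6₁ : ρ₁.reg 6 = e := (hr₁ 6 (by norm_num)).trans h6
    refine Halts.seq (Halts.mono (T := T + 2) (Q := fun τ ↦ I (e + 1) τ.arr ∧
        (∀ a, a ≠ 2 → a ≠ 14 → τ.arr a = ρ₁.arr a) ∧ ∀ i < 7, τ.reg i = ρ₁.reg i) ?_ le_rfl ?_)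
    · refine Halts.ite (T := T + 1) (fun hb₁ ↦ Halts.ite (T := T) (fun hb₂ ↦ ?_) fun hb₂ ↦ ?_)
        fun hb₁ ↦ ?_
      · simp only [Test.Holds, h8, h9, h10, h6₁] at hb₁ hb₂
        exact hbody e hb ρ₁ ⟨hb₁, hb₂⟩ (hcρ.congr fun i hi ↦ hr₁ i (by omega)) h6₁ h8 h9 hI
      · simp only [Test.Holds, h10, h6₁] at hb₂
        exact (Halts.code (l := []) trivial ⟨hskip e hb _ (fun h ↦ hb₂ h.2) hI, fun _ _ _ ↦ rfl,
          fun _ _ ↦ rfl⟩).mono (by simpa using hT) fun _ h ↦ h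
      · simp only [Test.Holds, h8, h9] at hb₁
        exact (Halts.code (l := []) trivial ⟨hskip e hb _ (fun h ↦ hb₁ h.1) hI, fun _ _ _ ↦ rfl,
          fun _ _ ↦ rfl⟩).mono (by simp) fun _ h ↦ h
    · rintro ρ₂ ⟨hI₂, ha₂, hr₂⟩
      have h3 : ρ₂.reg 3 = 1 := by rw [hr₂ 3 (by norm_num), hr₁ 3 (by norm_num), hcρ.r3]
      have h6₂ : ρ₂.reg 6 = e := by rw [hr₂ 6 (by norm_num), h6₁]
      refine Halts.code ?_ ⟨e + 1, ⟨hI₂, fun a h2 h14 ↦ ?_, fun i hi ↦ ?_, ?_, hb⟩, ?_⟩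
      · simp [SafeAll, Instr.Safe, h6₂, h3]; omega
      · exact (ha₂ a h2 h14).trans (ha a h2 h14)
      · simp [runAll, Instr.run, Instr.value, show i ≠ 6 by omega, hr₂ i (by omega),
          hr₁ i (by omega), hr i hi]
      · simp [runAll, Instr.run, Instr.value, h6₂, h3]
      · obtain ⟨s, rfl⟩ : ∃ s, m = e + 1 + s := ⟨m - (e + 1), by omega⟩
        rw [show e + 1 + s - (e + 1) = s by omega, show e + 1 + s - e = s + 1 by omega, mul_add]
        omega
  · rintro e ρ ⟨hI, ha, hr, h6, he⟩ hb
    simp only [Test.Holds, h6, (hc.congr hr : Consts n m ρ).r1] at hb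
    obtain rfl : e = m := by omega
    exact ⟨hI, ha, hr⟩
  · refine ⟨h0, fun _ _ _ ↦ rfl, fun i hi ↦ ?_, ?_, Nat.zero_le _⟩
    · simp [runAll, Instr.run, Instr.value, show i ≠ 6 by omega]
    · simp [runAll, Instr.run, Instr.value]

def antiOutputProg : Program := .seq (spareProg (code [.store 2 6 3])) countProg

theorem halts_antiOutputProg (hc : Consts n m σ) (h2 : σ.reg 2 = k) (hB : m + 1 ≤ B)
    (hte : σ.arr 7 = te) (hC : σ.arr 12 = C) (hlo : σ.arr 13 = lo) (hz : ∀ f, σ.arr 2 f = 0) :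
    Halts w B antiOutputProg σ (19 * m + 10) fun τ ↦
      (∀ f, τ.arr 2 f ≠ 0 ↔ f < m ∧ IsSpare te C lo f) ∧
      (τ.reg 0 = 1 ↔ (τ.edgeOutput m).card ≤ k) := by
  refine (Halts.seq (T := (2 + 9) * m + 3) (T' := 8 * m + 7) ((halts_spareProg hc hB (T := 2)
    (by norm_num) hte hC hlo (fun e a ↦ ∀ f, a 2 f ≠ 0 ↔ f < e ∧ IsSpare te C lo f)
    ?_ ?_ ?_).mono le_rfl ?_)).mono (by omega) fun _ h ↦ h
  · intro e _ a hs hI f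
    rw [hI f]
    refine ⟨fun h ↦ ⟨by omega, h.2⟩, fun h ↦ ⟨?_, h.2⟩⟩
    rcases Nat.lt_succ_iff_lt_or_eq.1 h.1 with h1 | rfl
    exacts [h1, absurd h.2 hs]
  · intro e _ ρ hs hcρ h6 _ _ hI
    refine Halts.code (by simp [SafeAll, Instr.Safe]) ⟨fun f ↦ ?_, fun a h2 _ ↦ ?_, fun i _ ↦ rfl⟩
    · simp only [runAll, Instr.run, Instr.value, State.setArr_arr, if_true, h6, hcρ.r3,
        Function.update_apply]
      split_ifs with hf
      · subst hf
        simpa using hs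
      · rw [hI f]
        exact ⟨fun h ↦ ⟨by omega, h.2⟩, fun h ↦ ⟨by omega, h.2⟩⟩
    · simp [runAll, Instr.run, Instr.value, h2]
  · intro f
    simp [hz]
  · rintro τ ⟨hI, -, hr⟩
    refine (halts_countProg (hc.congr hr) ((hr 2 (by norm_num)).trans h2) hB).mono le_rfl ?_
    rintro ρ ⟨ha, h⟩
    exact ⟨by rwa [ha], h⟩

/-- The pairs that arise from the edges with `IsSpare` by propagation along the tree edges. -/
inductive Propagated (m : ℕ) (te A C lo : ℕ → ℕ) : ℕ → ℕ → Prop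
  | base {f : ℕ} (hf : f < m) (hs : IsSpare te C lo f) : Propagated m te A C lo (C f) (lo f)
  | step {p i : ℕ} (hp : Propagated m te A C lo p i) (hi : i < A (te p)) :
    Propagated m te A C lo (A (te p)) i

theorem Propagated.lt (hC : ∀ f < m, C f < n) (hA : ∀ p, 0 < p → p < n → A (te p) < p)
    (h : Propagated m te A C lo p i) : i < p ∧ p < n := by
  induction h with
  | base hf hs => exact ⟨hs.1, hC _ hf⟩
  | step _ hi ih => exact ⟨hi, (hA _ (by omega) ih.2).trans ih.2⟩

/-- The largest values `n - i` for the pairs `(q, i)` are collected in the array `M`; the tree edges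
at positions above `p` have been taken into account. -/
structure Collected (n m : ℕ) (te A C lo : ℕ → ℕ) (p : ℕ) (M : ℕ → ℕ) : Prop where
  sound : ∀ q, M q ≠ 0 → ∃ i, Propagated m te A C lo q i ∧ M q = n - i
  base : ∀ f < m, IsSpare te C lo f → n - lo f ≤ M (C f)
  step : ∀ q, p < q → q < n → n - A (te q) < M q → M q ≤ M (A (te q))

/-- Only the smallest `i` per position is needed, because it meets the condition `i < A (te q)` for
propagation most easily. It is stored as `n - i`, so that the initial value 0 means that there is
none. -/
theorem Collected.ne_zero_iff {M : ℕ → ℕ} (h : Collected n m te A C lo 0 M)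
    (hC : ∀ f < m, C f < n) (hA : ∀ p, 0 < p → p < n → A (te p) < p) :
    M q ≠ 0 ↔ ∃ i, Propagated m te A C lo q i := by
  have hcol : ∀ {q i}, Propagated m te A C lo q i → n - i ≤ M q := fun hq ↦ by
    induction hq with
    | base hf hs => exact h.base _ hf hs
    | step hp hi ih =>
      have := hp.lt hC hA
      have hlt := hA _ (by omega) this.2
      exact ih.trans (h.step _ (by omega) this.2 (by omega))
  refine ⟨fun h0 ↦ ?_, fun ⟨i, hi⟩ ↦ ?_⟩
  · obtain ⟨i, hi, -⟩ := h.sound q h0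
    exact ⟨i, hi⟩
  · have := hcol hi
    have := hi.lt hC hA
    omega

theorem Collected.keep {M : ℕ → ℕ} (h : Collected n m te A C lo (p + 1) M)
    (hM : n - A (te (p + 1)) < M (p + 1) → M (p + 1) ≤ M (A (te (p + 1)))) :
    Collected n m te A C lo p M := by
  refine ⟨h.sound, h.base, fun q hq hqn ↦ ?_⟩
  rcases Nat.lt_or_eq_of_le hq with hq | rfl
  exacts [h.step q hq hqn, hM]

/-- The target `A (te (p + 1))` lies before `p + 1`, so the entries at the positions treated so far
do not change. -/
theorem Collected.raise {M : ℕ → ℕ} (h : Collected n m te A C lo (p + 1) M)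
    (hA : ∀ p, 0 < p → p < n → A (te p) < p) (hp : p + 1 < n)
    (h1 : n - A (te (p + 1)) < M (p + 1)) (h2 : M (A (te (p + 1))) < M (p + 1)) :
    Collected n m te A C lo p (Function.update M (A (te (p + 1))) (M (p + 1))) := by
  have hlt := hA (p + 1) (by omega) hp
  have hle : ∀ q, M q ≤ Function.update M (A (te (p + 1))) (M (p + 1)) q := fun q ↦ by
    rw [Function.update_apply]
    split_ifs with hq
    exacts [hq ▸ h2.le, le_rfl]
  refine ⟨fun q hq ↦ ?_, fun f hf hs ↦ (h.base f hf hs).trans (hle _), fun q hq hqn ↦ ?_⟩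
  · rw [Function.update_apply] at hq ⊢
    split_ifs at hq ⊢ with hqA
    · obtain ⟨i, hi, hMi⟩ := h.sound _ hq
      exact ⟨i, hqA ▸ hi.step (by omega), hMi⟩
    · exact h.sound q hq
  · rw [Function.update_of_ne (show q ≠ A (te (p + 1)) by omega)]
    intro hlt'
    rcases Nat.lt_or_eq_of_le hq with hq | rfl
    · exact (h.step q hq hqn hlt').trans (hle _)
    · rw [Function.update_self]

/-- Raises the entry of array 14 at the position in register 8. -/
def collectBody : Program :=
  .seq (code [.sub 11 0 9, .load 12 14 8]) (.ite (.lt 12 11) (code [.store 14 8 11]) (code []))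

/-- Treats the tree edge at the position in register 6. -/
def propagateBody : Program :=
  .seq (code [.load 7 7 6, .load 8 11 7, .load 9 14 6, .load 10 14 8, .sub 11 0 8])
    (.seq (.ite (.ne 9 5) (code [.store 2 7 3]) (code []))
      (.ite (.lt 11 9) (.ite (.lt 10 9) (code [.store 14 8 9]) (code [])) (code [])))

/-- The entry at `p + 1` is final when it is treated, so its tree edge can be marked at once. -/
theorem halts_propagateBody (hc : Consts n m σ) (hte : σ.arr 7 = te) (hA' : σ.arr 11 = A)
    (hA : ∀ p, 0 < p → p < n → A (te p) < p) (hp : p + 1 < n) (h6 : σ.reg 6 = p + 1)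
    (hM : Collected n m te A C lo (p + 1) (σ.arr 14))
    (hS : ∀ f, σ.arr 2 f ≠ 0 ↔ ∃ q, p + 1 < q ∧ q < n ∧ te q = f ∧ σ.arr 14 q ≠ 0) :
    Halts w B propagateBody σ 13 fun τ ↦ Collected n m te A C lo p (τ.arr 14) ∧
      (∀ f, τ.arr 2 f ≠ 0 ↔ ∃ q, p < q ∧ q < n ∧ te q = f ∧ τ.arr 14 q ≠ 0) ∧
      (∀ a, a ≠ 2 → a ≠ 14 → τ.arr a = σ.arr a) ∧ ∀ i < 7, τ.reg i = σ.reg i := by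
  have hlt := hA (p + 1) (by omega) hp
  refine Halts.seq (T := 6) (T' := 7) (Halts.code (by simp [SafeAll, Instr.Safe]) ?_)
  set σ₁ := runAll [.load 7 7 6, .load 8 11 7, .load 9 14 6, .load 10 14 8, .sub 11 0 8] σ with hσ₁
  have ha₁ : σ₁.arr = σ.arr := rfl
  have hr₁ : ∀ i < 7, σ₁.reg i = σ.reg i := fun i hi ↦ by
    simp [hσ₁, runAll, Instr.run, Instr.value, show i ≠ 7 by omega, show i ≠ 8 by omega,
      show i ≠ 9 by omega, show i ≠ 10 by omega, show i ≠ 11 by omega]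
  have h7 : σ₁.reg 7 = te (p + 1) := by simp [hσ₁, runAll, Instr.run, Instr.value, h6, hte]
  have h8 : σ₁.reg 8 = A (te (p + 1)) := by
    simp [hσ₁, runAll, Instr.run, Instr.value, h6, hte, hA']
  have h9 : σ₁.reg 9 = σ.arr 14 (p + 1) := by simp [hσ₁, runAll, Instr.run, Instr.value, h6]
  have h10 : σ₁.reg 10 = σ.arr 14 (A (te (p + 1))) := by
    simp [hσ₁, runAll, Instr.run, Instr.value, h6, hte, hA']
  have h11 : σ₁.reg 11 = n - A (te (p + 1)) := by
    simp [hσ₁, runAll, Instr.run, Instr.value, h6, hte, hA', hc.r0]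
  have hc₁ : Consts n m σ₁ := hc.congr fun i hi ↦ hr₁ i (by omega)
  refine Halts.seq (T := 3) (T' := 4) (Halts.mono (T := 3) (Q := fun τ ↦
    (∀ f, τ.arr 2 f ≠ 0 ↔ ∃ q, p < q ∧ q < n ∧ te q = f ∧ σ.arr 14 q ≠ 0) ∧
    (∀ a, a ≠ 2 → τ.arr a = σ.arr a) ∧ τ.reg = σ₁.reg) ?_ le_rfl ?_)
  · refine Halts.ite (T := 2) (fun hb ↦ Halts.code (by simp [SafeAll, Instr.Safe]) ?_)
      fun hb ↦ (Halts.code (l := []) trivial ?_).mono (by simp) fun _ h ↦ h <;>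
    simp only [Test.Holds, h9, hc₁.r5, ne_eq, not_not] at hb
    · refine ⟨fun f ↦ ?_, fun a ha ↦ ?_, rfl⟩
      · simp only [runAll, Instr.run, Instr.value, State.setArr_arr, if_true, h7, hc₁.r3,
          Function.update_apply, ha₁]
        split_ifs with hf
        · simp only [ne_eq, one_ne_zero, not_false_eq_true, true_iff]
          exact ⟨p + 1, by omega, hp, hf.symm, hb⟩
        · rw [hS f]
          refine exists_congr fun q ↦ ⟨fun h ↦ ⟨by omega, h.2⟩, fun h ↦ ⟨?_, h.2⟩⟩
          rcases Nat.lt_or_eq_of_le h.1 with h1 | rfl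
          exacts [h1, absurd h.2.2.1.symm hf]
      · simp [runAll, Instr.run, Instr.value, ha, ha₁]
    · refine ⟨fun f ↦ ?_, fun a _ ↦ rfl, rfl⟩
      change σ.arr 2 f ≠ 0 ↔ _
      rw [hS f]
      refine exists_congr fun q ↦ ⟨fun h ↦ ⟨by omega, h.2⟩, fun h ↦ ⟨?_, h.2⟩⟩
      rcases Nat.lt_or_eq_of_le h.1 with h1 | rfl
      exacts [h1, absurd hb h.2.2.2]
  · rintro τ ⟨hSτ, haτ, hrτ⟩
    have h14 := haτ 14 (by norm_num)
    have hkeep : (n - A (te (p + 1)) < σ.arr 14 (p + 1) →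
        σ.arr 14 (p + 1) ≤ σ.arr 14 (A (te (p + 1)))) →
        Collected n m te A C lo p (τ.arr 14) ∧
        (∀ f, τ.arr 2 f ≠ 0 ↔ ∃ q, p < q ∧ q < n ∧ te q = f ∧ τ.arr 14 q ≠ 0) ∧
        (∀ a, a ≠ 2 → a ≠ 14 → τ.arr a = σ.arr a) ∧ ∀ i < 7, τ.reg i = σ.reg i := fun h ↦
      ⟨h14 ▸ hM.keep h, h14 ▸ hSτ, fun a h _ ↦ haτ a h, fun i hi ↦ hrτ ▸ hr₁ i hi⟩
    refine Halts.ite (T := 3) (fun hb₁ ↦ Halts.ite (T := 2) (fun hb₂ ↦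
      Halts.code (by simp [SafeAll, Instr.Safe]) ?_) fun hb₂ ↦ ?_) fun hb₁ ↦ ?_
    · simp only [Test.Holds, hrτ, h9, h10, h11] at hb₁ hb₂
      have h14' : (runAll [.store 14 8 9] τ).arr 14 =
          Function.update (σ.arr 14) (A (te (p + 1))) (σ.arr 14 (p + 1)) := by
        simp [runAll, Instr.run, Instr.value, hrτ, h8, h9, h14]
      rw [h14']
      refine ⟨hM.raise hA hp hb₁ hb₂, fun f ↦ ?_, fun a h2 h14 ↦ ?_, fun i hi ↦ ?_⟩
      · change τ.arr 2 f ≠ 0 ↔ _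
        rw [hSτ f]
        refine exists_congr fun q ↦ and_congr_right fun hq ↦ ?_
        rw [Function.update_of_ne (by omega)]
      · simp [runAll, Instr.run, Instr.value, h14, haτ a h2]
      · exact hrτ ▸ hr₁ i hi
    · simp only [Test.Holds, hrτ, h9, h10] at hb₂
      exact (Halts.code (l := []) trivial (hkeep fun _ ↦ not_lt.1 hb₂)).mono (by simp) fun _ h ↦ h
    · simp only [Test.Holds, hrτ, h9, h11] at hb₁
      exact (Halts.code (l := []) trivial (hkeep fun h ↦ absurd h hb₁)).mono (by simp) fun _ h ↦ h

/-- The positions are treated from `n - 1` downwards, so that children precede their parents. -/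
def forcingOutputProg : Program :=
  .seq (spareProg collectBody) (.seq (code [.sub 6 0 3])
    (.seq (.loop (.ne 6 5) (.seq propagateBody (code [.sub 6 6 3]))) countProg))

theorem halts_forcingOutputProg (hc : Consts n m σ) (h2 : σ.reg 2 = k) (hB : m + 1 ≤ B) (hn : 0 < n)
    (hte : σ.arr 7 = te) (hA' : σ.arr 11 = A) (hC' : σ.arr 12 = C) (hlo : σ.arr 13 = lo)
    (hz : ∀ f, σ.arr 2 f = 0) (hz' : ∀ f, σ.arr 14 f = 0)
    (hC : ∀ f < m, C f < n) (hA : ∀ p, 0 < p → p < n → A (te p) < p) :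
    Halts w B forcingOutputProg σ (24 * m + 16 * n + 13) fun τ ↦
      (∀ f, τ.arr 2 f ≠ 0 ↔ ∃ q, 0 < q ∧ q < n ∧ te q = f ∧ ∃ i, Propagated m te A C lo q i) ∧
      (τ.reg 0 = 1 ↔ (τ.edgeOutput m).card ≤ k) := by
  refine (Halts.seq (T := (6 + 9) * m + 3) (T' := 2 + (16 * n + 1 + (8 * m + 7)))
    ((halts_spareProg hc hB (T := 6) (by norm_num) hte hC' hlo (fun e a ↦ (∀ f, a 2 f = 0) ∧
      (∀ q, a 14 q ≠ 0 → ∃ i, Propagated m te A C lo q i ∧ a 14 q = n - i) ∧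
      ∀ f < e, IsSpare te C lo f → n - lo f ≤ a 14 (C f)) ?_ ?_ ?_).mono le_rfl ?_)).mono (by omega)
      fun _ h ↦ h
  · rintro e - a hs ⟨h1, h2, h3⟩
    refine ⟨h1, h2, fun f hf hsf ↦ h3 f ?_ hsf⟩
    rcases Nat.lt_succ_iff_lt_or_eq.1 hf with h1 | rfl
    exacts [h1, absurd hsf hs]
  · rintro e he ρ hs hcρ h6 h8 h9 ⟨h1, h2, h3⟩
    refine Halts.seq (T := 3) (T' := 3) (Halts.code (by simp [SafeAll, Instr.Safe]) ?_)
    set ρ₁ := runAll [.sub 11 0 9, .load 12 14 8] ρ with hρ₁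
    have hr₁ : ∀ i < 11, ρ₁.reg i = ρ.reg i := fun i hi ↦ by
      simp [hρ₁, runAll, Instr.run, Instr.value, show i ≠ 11 by omega, show i ≠ 12 by omega]
    have h11 : ρ₁.reg 11 = n - lo e := by
      simp [hρ₁, runAll, Instr.run, Instr.value, hcρ.r0, h9]
    have h12 : ρ₁.reg 12 = ρ.arr 14 (C e) := by simp [hρ₁, runAll, Instr.run, Instr.value, h8]
    refine Halts.ite (T := 2) (fun hb ↦ Halts.code (by simp [SafeAll, Instr.Safe]) ?_)
      fun hb ↦ (Halts.code (l := []) trivial ?_).mono (by simp) fun _ h ↦ h <;>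
    simp only [Test.Holds, h11, h12] at hb
    · have h14 : (runAll [.store 14 8 11] ρ₁).arr 14 =
          Function.update (ρ.arr 14) (C e) (n - lo e) := by
        simp [runAll, Instr.run, Instr.value, hr₁, h8, h11]
        rfl
      refine ⟨⟨h1, fun q hq ↦ ?_, fun f hf hsf ↦ ?_⟩, fun a _ h14 ↦ ?_, fun i hi ↦ hr₁ i (by omega)⟩
      · rw [h14, Function.update_apply] at hq ⊢
        split_ifs at hq ⊢ with hqe
        · exact ⟨lo e, hqe ▸ .base he hs, rfl⟩
        · exact h2 q hq
      · rw [h14, Function.update_apply]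
        rcases Nat.lt_succ_iff_lt_or_eq.1 hf with hf | rfl
        · have := h3 f hf hsf
          split_ifs with hfe
          · rw [hfe] at this; omega
          · exact this
        · rw [if_pos rfl]
      · simp [runAll, Instr.run, Instr.value, h14]
        rfl
    · refine ⟨⟨h1, h2, fun f hf hsf ↦ ?_⟩, fun _ _ _ ↦ rfl, fun i hi ↦ hr₁ i (by omega)⟩
      rcases Nat.lt_succ_iff_lt_or_eq.1 hf with hf | rfl
      exacts [h3 f hf hsf, not_lt.1 hb]
  · exact ⟨hz, fun q hq ↦ absurd (hz' q) hq, by simp⟩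
  rintro σ₁ ⟨⟨hz₁, hs₁, hb₁⟩, ha₁, hr₁⟩
  have hc₁ : Consts n m σ₁ := hc.congr hr₁
  refine Halts.seq (Halts.code (by simp [SafeAll, Instr.Safe]) (Halts.seq ((Halts.loop
    (fun (p : ℕ) (ρ : State) ↦ (∀ i < 6, ρ.reg i = σ.reg i) ∧
      (∀ a, a ≠ 2 → a ≠ 14 → ρ.arr a = σ.arr a) ∧ ρ.reg 6 = p ∧ p < n ∧
      Collected n m te A C lo p (ρ.arr 14) ∧
      ∀ f, ρ.arr 2 f ≠ 0 ↔ ∃ q, p < q ∧ q < n ∧ te q = f ∧ ρ.arr 14 q ≠ 0) (fun p ↦ 16 * p)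
      (Q := fun ρ ↦ (∀ i < 6, ρ.reg i = σ.reg i) ∧
        ∀ f, ρ.arr 2 f ≠ 0 ↔ ∃ q, 0 < q ∧ q < n ∧ te q = f ∧ ∃ i, Propagated m te A C lo q i)
      (a := n - 1) ?_ ?_ ?_).mono (by omega) ?_)))
  · rintro p ρ ⟨hr, ha, h6, hpn, hM, hS⟩ hb
    have hcρ : Consts n m ρ := hc.congr hr
    simp only [Test.Holds, h6, hcρ.r5] at hb
    obtain ⟨p, rfl⟩ := Nat.exists_eq_succ_of_ne_zero hb
    refine ⟨13 + 2, Halts.seq ((halts_propagateBody hcρ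
      ((ha 7 (by norm_num) (by norm_num)).trans hte) ((ha 11 (by norm_num) (by norm_num)).trans hA')
      hA hpn h6 hM hS).mono le_rfl ?_)⟩
    rintro τ ⟨hMτ, hSτ, haτ, hrτ⟩
    refine Halts.code (by simp [SafeAll, Instr.Safe]) ⟨p, ⟨fun i hi ↦ ?_, fun a h2 h14 ↦ ?_, ?_, ?_,
      hMτ, hSτ⟩, ?_⟩
    · simp [runAll, Instr.run, Instr.value, show i ≠ 6 by omega, hrτ i (by omega), hr i hi]
    · exact (haτ a h2 h14).trans (ha a h2 h14)
    · simp [runAll, Instr.run, Instr.value, hrτ, h6, hcρ.r3]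
    · omega
    · omega
  · rintro p ρ ⟨hr, ha, h6, hpn, hM, hS⟩ hb
    simp only [Test.Holds, h6, (hc.congr hr : Consts n m ρ).r5, ne_eq, not_not] at hb
    subst hb
    refine ⟨hr, fun f ↦ ?_⟩
    simp only [hS f, hM.ne_zero_iff hC hA]
  · refine ⟨fun i hi ↦ ?_, ha₁, ?_, by omega, ⟨hs₁, hb₁, fun q hq hqn ↦ by omega⟩, fun f ↦ ?_⟩
    · simp [runAll, Instr.run, Instr.value, show i ≠ 6 by omega, hr₁ i hi]
    · simp [runAll, Instr.run, Instr.value, hc₁.r0, hc₁.r3]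
    · refine ⟨fun h ↦ absurd (hz₁ f) h, ?_⟩
      rintro ⟨q, h1, h2, -⟩
      omega
  · rintro τ ⟨hr, hS⟩
    refine (halts_countProg (hc.congr hr) ((hr 2 (by norm_num)).trans h2) hB).mono le_rfl ?_
    rintro ρ ⟨ha, h⟩
    exact ⟨by rwa [ha], h⟩

end Output

/-! ### From the arrays of the machine back to the graph. -/

section Instance

variable {n m k B L : ℕ} {G : Graph (Fin n) (Fin m)} {u v : Fin m → Fin n} {w : Fin m → ℝ}
  {P ord te tl A C lo : ℕ → ℕ} {j q : ℕ} {c : ℝ} {σ : State} {S : Finset (Fin m)}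

/-- The array that holds the values of a function on `Fin m`. -/
def toArray (u : Fin m → Fin n) (i : ℕ) : ℕ := if h : i < m then (u ⟨i, h⟩ : ℕ) else 0

theorem exists_halfEdge (hl : ∀ e, G.IsLink e (u e) (v e)) {f : Fin m} {x y : Fin n}
    (hf : G.IsLink f x y) : ∃ h < 2 * m, hEdge m h = f ∧ hSrc m (toArray u) (toArray v) h = x ∧
      hDst m (toArray u) (toArray v) h = y := by
  have hfm := f.2
  rcases hf.eq_and_eq_or_eq_and_eq (hl f) with ⟨rfl, rfl⟩ | ⟨rfl, rfl⟩
  · exact ⟨f, by omega, by simp [hEdge, hSrc, hDst, toArray]⟩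
  · exact ⟨m + f, by omega, by simp [hEdge, hSrc, hDst, toArray]⟩

theorem isLink_halfEdge (hl : ∀ e, G.IsLink e (u e) (v e)) {h : ℕ} (hh : h < 2 * m) :
    ∃ f x y, G.IsLink f x y ∧ hEdge m h = f ∧ hSrc m (toArray u) (toArray v) h = x ∧
      hDst m (toArray u) (toArray v) h = y := by
  by_cases hm : h < m
  · exact ⟨⟨h, hm⟩, _, _, hl _, by simp [hEdge, hSrc, hDst, toArray, hm]⟩
  · exact ⟨⟨h - m, by omega⟩, _, _, (hl _).symm, by
      simp [hEdge, hSrc, hDst, toArray, hm, show h - m < m by omega]⟩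

theorem isConnectedInput (hV : V(G) = Set.univ) (hG : Connected G)
    (hl : ∀ e, G.IsLink e (u e) (v e)) : IsConnectedInput n m (toArray u) (toArray v) := by
  refine ⟨fun h hh ↦ ?_, ?_⟩
  · obtain ⟨f, x, y, -, -, -, hy⟩ := isLink_halfEdge hl hh
    exact hy ▸ y.2
  · rintro D ⟨x, hx, hxD⟩ ⟨y, hy, hyD⟩
    by_contra! hc
    refine hyD (Reachable.induct (P := fun z : Fin n ↦ (z : ℕ) ∈ D)
      (hG.2 ⟨x, hx⟩ (by simp [hV]) ⟨y, hy⟩ (by simp [hV])) hxD fun e a b _ hab ha ↦ ?_)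
    obtain ⟨h, hh, -, h1, h2⟩ := exists_halfEdge hl hab
    have := hc h hh (h1 ▸ ha)
    rwa [h2] at this

/-- The tree edges as elements of `Fin m`. -/
def toEdge [NeZero m] (te : ℕ → ℕ) (p : ℕ) : Fin m := Fin.ofNat m (te p)

theorem val_toEdge [NeZero m] {p : ℕ} (hp : te p < m) : (toEdge te p : Fin m) = te p :=
  Nat.mod_eq_of_lt hp

/-- The entries of `P` are successors of positions and are all nonzero after the search, whence `P x
- 1`. -/
theorem isSearchOrder [NeZero m] (hn : 0 < n) (hV : V(G) = Set.univ)
    (hl : ∀ e, G.IsLink e (u e) (v e))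
    (hS : Searched w n (toArray u) (toArray v) P ord te tl n) :
    IsSearchOrder G w n (fun x ↦ P x - 1) (toEdge te) tl := by
  have hte := hS.isTreeArray hn
  have hP : ∀ x : Fin n, P x ≠ 0 := fun x ↦ hS.ne_zero x.2
  refine ⟨hV, fun x y hxy ↦ ?_, fun x ↦ ?_, fun p hp ↦ ?_, fun p h0 hp ↦ ?_, fun p h0 hp ↦ ?_,
    fun f x y p hf hx hy ↦ ?_⟩
  · have h1 := hS.ord_pos x x.2 (hP x)
    have h2 := hS.ord_pos y y.2 (hP y)
    rw [hxy, h2] at h1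
    exact (Fin.ext h1).symm
  · have := hS.pos_le x x.2
    have := hP x
    omega
  · obtain ⟨h1, h2⟩ := hS.ord_lt p hp
    exact ⟨⟨_, h1⟩, by simp [h2]⟩
  · obtain ⟨h, hh, he, hd, hs, -⟩ := hS.edge p h0 hp
    obtain ⟨f, x, y, hf, h1, h2, h3⟩ := isLink_halfEdge hl hh
    have hfe : toEdge te p = f := Fin.ext (by rw [val_toEdge (hte.lt p h0 hp), ← he, h1])
    rw [h2] at hs
    rw [h3] at hd
    exact ⟨x, y, hfe ▸ hf, by simp [hs], by simp [hd]⟩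
  · obtain ⟨h, hh, he, hd, hs, hlt⟩ := hS.edge p h0 hp
    exact hlt
  · obtain ⟨h, hh, h1, h2, h3⟩ := exists_halfEdge hl hf
    have hxP := hP x
    have hyP := hP y
    have := hS.pos_le y y.2
    have := hS.cut h hh p (by omega) (by omega) (h2 ▸ hxP) (by rw [h2]; omega)
      (by rw [h3]; right; omega)
    rw [h1, h2, ← val_toEdge (m := m) (hte.lt p (by omega) (by omega)), wt_val, wt_val] at this
    exact this

/-- `IsTop` only looks at positive positions, where `toEdge te` agrees with `te`. At position 0 it
has a meaningless value. -/
theorem isTop_toEdge [NeZero m] (hte : IsTreeArray n m te) (hj : j < n)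
    (h : IsSearchOrder.IsTop (wt w) te c j q) : IsSearchOrder.IsTop w (toEdge te) c j q := by
  have key : ∀ p, 0 < p → p ≤ j → w (toEdge te p) = wt w (te p) := fun p h0 hp ↦ by
    rw [← wt_val w, val_toEdge (hte.lt p h0 (by omega))]
  refine ⟨h.le, fun h0 ↦ ?_, fun q' hq hqj ↦ ?_⟩
  · rw [key q h0 h.le]
    exact h.ge h0
  · rw [key q' (by omega) hqj]
    exact h.lt q' hq hqj

/-- The state before the output phase. -/
structure Prepared (w : Fin m → ℝ) (n k : ℕ) (U V : ℕ → ℕ) (σ : State) : Prop where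
  consts : Consts n m σ
  r2 : σ.reg 2 = k
  zero : ∀ a, a = 2 ∨ 14 ≤ a → ∀ i, σ.arr a i = 0
  searched : ∃ ord tl, Searched w n U V (σ.arr 5) ord (σ.arr 7) tl n
  tops : IsTopsArray w U V (σ.arr 5) (σ.arr 7) (σ.arr 11) (σ.arr 12) (σ.arr 13) {h | h < 2 * m}

theorem exists_isLink_of_tops [NeZero m] (hn : 0 < n) (hl : ∀ e, G.IsLink e (u e) (v e))
    (hS : Searched w n (toArray u) (toArray v) P ord te tl n)
    (hT : IsTopsArray w (toArray u) (toArray v) P te A C lo {h | h < 2 * m}) (f : Fin m) :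
    ∃ x y, G.IsLink f x y ∧ P x - 1 ≤ P y - 1 ∧ lo f = P x - 1 ∧
      IsSearchOrder.IsTop w (toEdge te) (w f) (P y - 1) (C f) := by
  have key : ∀ x y, G.IsLink f x y → P x ≤ P y → ∃ x y, G.IsLink f x y ∧ P x - 1 ≤ P y - 1 ∧
      lo f = P x - 1 ∧ IsSearchOrder.IsTop w (toEdge te) (w f) (P y - 1) (C f) := by
    intro x y hf hle
    obtain ⟨h, hh, h1, h2, h3⟩ := exists_halfEdge hl hf.symm
    have := (hT h hh).2 (by rwa [h2, h3])
    rw [h1, h2, h3, wt_val] at this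
    have hy := hS.pos_le y y.2
    exact ⟨x, y, hf, by omega, this.2, isTop_toEdge (hS.isTreeArray hn) (by omega) this.1⟩
  rcases le_total (P (u f)) (P (v f)) with hle | hle
  · exact key _ _ (hl f) hle
  · exact key _ _ (hl f).symm hle

theorem isTop_of_tops [NeZero m] (hn : 0 < n)
    (hl : ∀ e, G.IsLink e (u e) (v e))
    (hS : Searched w n (toArray u) (toArray v) P ord te tl n)
    (hT : IsTopsArray w (toArray u) (toArray v) P te A C lo {h | h < 2 * m}) {f : Fin m}
    {x y : Fin n} (hf : G.IsLink f x y) (hxy : P x - 1 ≤ P y - 1) :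
    lo f = P x - 1 ∧ IsSearchOrder.IsTop w (toEdge te) (w f) (P y - 1) (C f) := by
  obtain ⟨a, b, hab, hle, h1, h2⟩ := exists_isLink_of_tops hn hl hS hT f
  rcases hf.eq_and_eq_or_eq_and_eq hab with ⟨rfl, rfl⟩ | ⟨rfl, rfl⟩
  · exact ⟨h1, h2⟩
  · have heq := le_antisymm hxy hle
    exact ⟨h1.trans heq.symm, heq ▸ h2⟩

theorem lt_of_tops [NeZero m] (hn : 0 < n) (hl : ∀ e, G.IsLink e (u e) (v e))
    (hS : Searched w n (toArray u) (toArray v) P ord te tl n)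
    (hT : IsTopsArray w (toArray u) (toArray v) P te A C lo {h | h < 2 * m}) {f : ℕ} (hf : f < m) :
    C f < n := by
  obtain ⟨x, y, -, -, -, ht⟩ := exists_isLink_of_tops hn hl hS hT ⟨f, hf⟩
  have := ht.le
  have := hS.pos_le y y.2
  simp only at *
  omega

theorem isSpare_iff [NeZero m] (hn : 0 < n) (hl : ∀ e, G.IsLink e (u e) (v e))
    (hS : Searched w n (toArray u) (toArray v) P ord te tl n)
    (hT : IsTopsArray w (toArray u) (toArray v) P te A C lo {h | h < 2 * m}) (f : Fin m) :
    IsSpare te C lo f ↔ lo f < C f ∧ toEdge te (C f) ≠ f := by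
  refine and_congr_right fun h ↦ not_congr ?_
  have hte := (hS.isTreeArray hn).lt (C f) (by omega) (lt_of_tops hn hl hS hT f.2)
  rw [Fin.ext_iff, val_toEdge hte]

theorem isAntiForcingOutcome_of_tops [NeZero m] (hn : 0 < n) (hV : V(G) = Set.univ)
    (hl : ∀ e, G.IsLink e (u e) (v e))
    (hS : Searched w n (toArray u) (toArray v) P ord te tl n)
    (hT : IsTopsArray w (toArray u) (toArray v) P te A C lo {h | h < 2 * m})
    (hout : ∀ f : Fin m, f ∈ S ↔ IsSpare te C lo f) : IsAntiForcingOutcome G w S :=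
  (isSearchOrder hn hV hl hS).isAntiForcingOutcome (B := fun f ↦ C f) (lo := fun f ↦ lo f)
    (exists_isLink_of_tops hn hl hS hT) fun f ↦ (hout f).trans (isSpare_iff hn hl hS hT f)

theorem isTop_edge_of_tops [NeZero m] (hn : 0 < n)
    (hS : Searched w n (toArray u) (toArray v) P ord te tl n)
    (hT : IsTopsArray w (toArray u) (toArray v) P te A C lo {h | h < 2 * m}) {p : ℕ} (h0 : 0 < p)
    (hp : p < n) : IsSearchOrder.IsTop w (toEdge te) (w (toEdge te p)) (tl p) (A (te p)) := by
  have hte := hS.isTreeArray hn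
  obtain ⟨h, hh, he, hd, hs, hlt⟩ := hS.edge p h0 hp
  have := (hT h hh).1 (by omega)
  rw [he, hs, Nat.add_sub_cancel, ← val_toEdge (m := m) (hte.lt p h0 hp), wt_val,
    val_toEdge (hte.lt p h0 hp)] at this
  exact isTop_toEdge hte (by omega) this

theorem apply_lt_of_tops [NeZero m] (hn : 0 < n)
    (hS : Searched w n (toArray u) (toArray v) P ord te tl n)
    (hT : IsTopsArray w (toArray u) (toArray v) P te A C lo {h | h < 2 * m}) {p : ℕ} (h0 : 0 < p)
    (hp : p < n) : A (te p) < p := by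
  obtain ⟨h, hh, he, hd, hs, hlt⟩ := hS.edge p h0 hp
  exact (isTop_edge_of_tops hn hS hT h0 hp).le.trans_lt hlt

theorem isForcingOutcome_of_tops [NeZero m] (hn : 0 < n) (hV : V(G) = Set.univ)
    (hl : ∀ e, G.IsLink e (u e) (v e))
    (hS : Searched w n (toArray u) (toArray v) P ord te tl n)
    (hT : IsTopsArray w (toArray u) (toArray v) P te A C lo {h | h < 2 * m})
    (hout : ∀ f : Fin m, f ∈ S ↔
      ∃ q, 0 < q ∧ q < n ∧ te q = f ∧ ∃ i, Propagated m te A C lo q i) :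
    IsForcingOutcome G w S := by
  have hte := hS.isTreeArray hn
  have hO := isSearchOrder hn hV hl hS
  have hval : ∀ p, 0 < p → p < n → ((toEdge te p : Fin m) : ℕ) = te p := fun p h0 hp ↦
    val_toEdge (hte.lt p h0 hp)
  have hB : ∀ f x y, G.IsLink f x y → P x - 1 ≤ P y - 1 → IsSearchOrder.IsTop w (toEdge te) (w f) (P y - 1) (C f) :=
    fun f x y hf hxy ↦ (isTop_of_tops hn hl hS hT hf hxy).2
  have hA : ∀ p, 0 < p → p < n → IsSearchOrder.IsTop w (toEdge te) (w (toEdge te p)) (tl p) (A (toEdge te p : Fin m)) :=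
    fun p h0 hp ↦ by rw [hval p h0 hp]; exact isTop_edge_of_tops hn hS hT h0 hp
  have hlt : ∀ {p i}, Propagated m te A C lo p i → i < p ∧ p < n := fun h ↦
    h.lt (fun f ↦ lt_of_tops hn hl hS hT) fun p ↦ apply_lt_of_tops hn hS hT
  refine hO.isForcingOutcome (A := fun f ↦ A f) (B := fun f ↦ C f) hA hB fun f ↦ (hout f).trans ?_
  refine exists_congr fun p ↦ and_congr_right fun h0 ↦ and_congr_right fun hp ↦ and_congr ?_ ?_
  · rw [Fin.ext_iff, hval p h0 hp]
  -- `Propagated` and `Marked` are generated by the same rules, over array indices and over `Fin m`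
  -- respectively.
  · refine exists_congr fun i ↦ ⟨fun h ↦ ?_, fun h ↦ ?_⟩
    · clear h0 hp
      induction h with
      | base hf hs =>
        obtain ⟨x, y, hxy, hle, h1, -⟩ := exists_isLink_of_tops hn hl hS hT ⟨_, hf⟩
        obtain ⟨h2, h3⟩ := (isSpare_iff hn hl hS hT ⟨_, hf⟩).1 hs
        simp only at h1 h2 h3
        rw [h1] at h2 ⊢
        exact IsSearchOrder.Marked.base (G := G) (pos := fun x : Fin n ↦ P x - 1) (te := toEdge te)
          (A := fun f ↦ A f) (B := fun f ↦ C f) hxy hle h2 h3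
      | step hp hi ih =>
        have := hlt hp
        have hv := hval _ (by omega) this.2
        rw [← hv] at hi ⊢
        exact IsSearchOrder.Marked.step ih hi
    · suffices ∀ {p i}, IsSearchOrder.Marked G (fun x ↦ P x - 1) (toEdge te) (fun f ↦ A f) (fun f ↦ C f) p i →
          Propagated m te A C lo p i from this h
      intro p i h
      induction h with
      | base hf hxy hq hne =>
        have h1 := (isTop_of_tops hn hl hS hT hf hxy).1
        rw [← h1] at hq ⊢
        exact .base (Fin.is_lt _) ((isSpare_iff hn hl hS hT _).2 ⟨hq, hne⟩)
      | step hp hi ih =>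
        have := hlt ih
        simp only [hval _ (show 0 < _ by omega) this.2] at hi ⊢
        exact ih.step hi

end Instance

/-! ### The complete program and its running time. -/

section Main

variable {n m k B L : ℕ} {G : Graph (Fin n) (Fin m)} {u v : Fin m → Fin n} {w : Fin m → ℝ}
  {σ : State} {S : Finset (Fin m)}

/-- A tree edge belongs to each position except the first. -/
theorem Searched.le_edges [NeZero m] {P ord te tl : ℕ → ℕ} (hn : 0 < n) (hV : V(G) = Set.univ)
    (hl : ∀ e, G.IsLink e (u e) (v e))
    (hS : Searched w n (toArray u) (toArray v) P ord te tl n) : n ≤ m + 1 := by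
  have hO := isSearchOrder hn hV hl hS
  have := Finset.card_le_card_of_injOn (s := Finset.Ioo 0 n) (t := (Finset.univ : Finset (Fin m)))
    (toEdge te) (by simp) fun p hp q hq hpq ↦ by
      simp only [Finset.coe_Ioo, Set.mem_Ioo] at hp hq
      exact hO.te_injective hp.1 hp.2 hq.1 hq.2 hpq
  simp at this
  omega

/-- The case `n = 1` is separate because `m * log n` vanishes: the time must be constant, so the
edges cannot even be read. -/
def mainProg (out : Program) : Program :=
  .seq (code [.const 3 1]) (.ite (.eq 0 3) (code []) (.seq (code [.const 4 2])
    (.seq buildProg (.seq searchProg (.seq topsProg out)))))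

/-- The time of the program, if the output phase takes the time `T`. -/
def mainTime (n m L T : ℕ) : ℕ :=
  2 + (2 + (14 * m + 1 + ((22 * L + 37) * (2 * m) + (22 * L + 26) * n + 5 +
    ((11 * L + 24) * (2 * m) + 21 * n + 11 + T))) + 1)

theorem halts_mainProg {out : Program} {T : ℕ} {Q : State → Prop}
    (hI : IsConnectedInput n m (toArray u) (toArray v)) (hn : 2 ≤ n) (hB : 2 * n + 2 * m ≤ B)
    (hL : n ≤ 2 ^ L)
    (hout : ∀ σ, Prepared w n k (toArray u) (toArray v) σ → Halts w B out σ T Q) :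
    Halts w B (mainProg out) (inputState u v k) (mainTime n m L T) Q := by
  refine Halts.seq (T := 2) (Halts.code (by simp [SafeAll, Instr.Safe]; omega)
    (Halts.ite (fun h ↦ ?_) fun _ ↦ ?_))
  · simp [Test.Holds, runAll, Instr.run, Instr.value, inputState] at h
    omega
  refine Halts.seq (T := 2) (Halts.code (by simp [SafeAll, Instr.Safe]; omega) ?_)
  set σ := runAll [.const 4 2] (runAll [.const 3 1] (inputState u v k)) with hσ
  have hc : Consts n m σ := by
    constructor <;> simp [hσ, runAll, Instr.run, Instr.value, inputState]
  have h2 : σ.reg 2 = k := by simp [hσ, runAll, Instr.run, Instr.value, inputState]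
  have hU : σ.arr 0 = toArray u := by
    funext i
    simp [hσ, runAll, Instr.run, inputState, toArray]
  have hV : σ.arr 1 = toArray v := by
    funext i
    simp [hσ, runAll, Instr.run, inputState, toArray]
  have hz : ∀ a, 2 ≤ a → ∀ i, σ.arr a i = 0 := fun a ha i ↦ by
    simp [hσ, runAll, Instr.run, inputState, show a ≠ 0 by omega, show a ≠ 1 by omega]
  refine Halts.seq ((halts_buildProg hc (by omega)
    (by simp [hσ, runAll, Instr.run, inputState]) hU hV (hz 3 (by norm_num))).mono le_rfl ?_)
  rintro σ₁ ⟨hr₁, ha₁, hadj⟩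
  refine Halts.seq ((halts_searchProg hI (by omega) hL (by omega) (hc.congr hr₁)
    ((hr₁ 2 (by norm_num)).trans h2) ((ha₁ 0 (by norm_num) (by norm_num)).trans hU)
    ((ha₁ 1 (by norm_num) (by norm_num)).trans hV) hadj fun a ha i ↦ ?_).mono le_rfl ?_)
  · rw [ha₁ a (by omega) (by omega), hz a (by omega)]
  rintro σ₂ h₂
  refine Halts.seq ((halts_topsProg hI (by omega) hL (by omega) h₂).mono le_rfl ?_)
  rintro σ₃ ⟨hr₃, ha₃, hT⟩
  obtain ⟨tl, hS⟩ := h₂.searched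
  refine hout σ₃ ⟨h₂.consts.congr hr₃, (hr₃ 2 (by norm_num)).trans h₂.r2, fun a ha i ↦ ?_,
    ⟨σ₂.arr 6, tl, ?_⟩, ?_⟩
  · rw [ha₃ a (by omega), h₂.zero a (by omega)]
  · rwa [ha₃ 5 (by norm_num), ha₃ 7 (by norm_num)]
  · rwa [ha₃ 5 (by norm_num), ha₃ 7 (by norm_num)]

/-- With `L` for the left side, `2 ^ (L - 1) ≤ n` gives `L ≤ 1 + log n / log 2 ≤ 2 * log n / log 2`,
and `2 / log 2 < 3`. -/
theorem clog_le (hn : 2 ≤ n) : (Nat.clog 2 n : ℝ) ≤ 3 * Real.log n := by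
  have h1 : (2 : ℝ) ^ (Nat.clog 2 n - 1) ≤ n := by
    have := Nat.pow_pred_clog_lt_self (b := 2) (x := n) (by norm_num) (by omega)
    exact_mod_cast this.le
  have h2 : 0 < Nat.clog 2 n := Nat.clog_pos (by norm_num) hn
  have h3 := Real.log_le_log (by positivity) h1
  rw [Real.log_pow, Nat.cast_sub (by omega), Nat.cast_one] at h3
  have h4 : Real.log 2 ≤ Real.log n := Real.log_le_log (by norm_num) (by exact_mod_cast hn)
  have h5 := Real.log_two_gt_d9
  have h6 : (1 : ℝ) ≤ Nat.clog 2 n := by exact_mod_cast h2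
  nlinarith

/-- Here `n ≤ m + 1 ≤ 2 * m`, so all terms with `n` are absorbed. The constants are `396 * 3` and
`35`, both below `2000`. -/
theorem mainTime_le (hn : 2 ≤ n) (hm : n ≤ m + 1) :
    (mainTime n m (Nat.clog 2 n) (24 * m + 16 * n + 13) : ℝ) ≤ 2000 * (m * Real.log n + 1) := by
  have hL : 0 < Nat.clog 2 n := Nat.clog_pos (by norm_num) hn
  have h1 : m ≤ m * Nat.clog 2 n := Nat.le_mul_of_pos_right m hL
  have h2 : n * Nat.clog 2 n ≤ 2 * (m * Nat.clog 2 n) := by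
    rw [← mul_assoc]
    exact Nat.mul_le_mul_right _ (by omega)
  have h3 : mainTime n m (Nat.clog 2 n) (24 * m + 16 * n + 13) ≤ 396 * (m * Nat.clog 2 n) + 35 := by
    rw [mainTime]
    ring_nf at h1 h2 ⊢
    omega
  have h4 : (m : ℝ) * Nat.clog 2 n ≤ m * (3 * Real.log n) :=
    mul_le_mul_of_nonneg_left (clog_le hn) (Nat.cast_nonneg m)
  have h5 : (mainTime n m (Nat.clog 2 n) (24 * m + 16 * n + 13) : ℝ) ≤
      396 * (m * Nat.clog 2 n) + 35 := by exact_mod_cast h3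
  have h6 : (0 : ℝ) ≤ m * Real.log n := mul_nonneg (Nat.cast_nonneg m) (Real.log_natCast_nonneg n)
  linarith

theorem bounded_inputState (hk : k ≤ B) (hn : n ≤ B) (hm : m ≤ B) :
    (inputState u v k).Bounded B := by
  refine ⟨fun i ↦ ?_, fun a i ↦ ?_⟩
  · simp only [inputState]
    split_ifs <;> omega
  · simp only [inputState]
    split_ifs with h
    · have := (u ⟨i, h⟩).2; omega
    · have := (v ⟨i, h⟩).2; omega
    all_goals omega

theorem exists_card_le_iff {Q : Finset (Fin m) → Prop} (hS : IsMinimumSet Q S) :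
    S.card ≤ k ↔ ∃ S', Q S' ∧ S'.card ≤ k :=
  ⟨fun h ↦ ⟨S, hS.1, h⟩, fun ⟨_, h, hk⟩ ↦ (hS.2 _ h).trans hk⟩

/-- The two problems differ only in the output phase. -/
theorem solvableInTime_of_output
    {Solution Outcome : ∀ {n m : ℕ}, Graph (Fin n) (Fin m) → (Fin m → ℝ) → Finset (Fin m) → Prop}
    (hmin : ∀ {n m : ℕ} {G : Graph (Fin n) (Fin m)} {w : Fin m → ℝ} {S : Finset (Fin m)},
      V(G) = Set.univ → Connected G → Outcome G w S → IsMinimumSet (Solution G w) S)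
    (hone : ∀ {m : ℕ} {G : Graph (Fin 1) (Fin m)} {w : Fin m → ℝ}, V(G) = Set.univ → Outcome G w ∅)
    (out : Program)
    (hout : ∀ {n m k B : ℕ} {G : Graph (Fin n) (Fin m)} {u v : Fin m → Fin n} {w : Fin m → ℝ}
      {σ : State} [NeZero m], 0 < n → V(G) = Set.univ → (∀ e, G.IsLink e (u e) (v e)) → m + 1 ≤ B →
      Prepared w n k (toArray u) (toArray v) σ →
      Halts w B out σ (24 * m + 16 * n + 13) fun τ ↦ Outcome G w (τ.edgeOutput m) ∧
        (τ.reg 0 = 1 ↔ (τ.edgeOutput m).card ≤ k)) :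
    SolvableInTime Solution Outcome fun n m ↦ m * Real.log n := by
  -- The exponent 2 suffices because all words are at most `2 * n + 2 * m` or come from the input or
  -- from small constants.
  refine ⟨mainProg out, 2000, 2, fun n m G u v w k hV _ hl hG ↦ ?_⟩
  have hsq : 2 * n + 2 * m + 2 * k + 2 ≤ (n + m + k + 2) ^ 2 := by nlinarith
  have hb : (inputState u v k).Bounded ((n + m + k + 2) ^ 2) :=
    bounded_inputState (by omega) (by omega) (by omega)
  have hn0 : 0 < n := by
    obtain ⟨x, -⟩ := hG.1
    exact x.pos
  suffices ∃ T, Halts w ((n + m + k + 2) ^ 2) (mainProg out) (inputState u v k) T (fun τ ↦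
      (T : ℝ) ≤ 2000 * (m * Real.log n + 1) ∧ Outcome G w (τ.edgeOutput m) ∧
        (τ.reg 0 = 1 ↔ (τ.edgeOutput m).card ≤ k)) by
    obtain ⟨T, hT⟩ := this
    obtain ⟨t, τ, h1, h2, hle, h3, h4⟩ := hT hb
    have hS := hmin hV hG h3
    exact ⟨t, τ, h1, le_trans (by exact_mod_cast h2) hle, hS, h3, h4.trans (exists_card_le_iff hS)⟩
  rcases Nat.lt_or_ge n 2 with hn | hn
  -- Array 2 is still zero, and register 0 still holds `n = 1`, which is the right answer because
  -- the empty set has at most `k` elements.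
  · obtain rfl : n = 1 := by omega
    refine ⟨4, Halts.seq (T := 2) (T' := 2) (Halts.code (by simp [SafeAll, Instr.Safe]; omega)
      (Halts.ite (T := 1) (fun _ ↦ Halts.code trivial ?_) fun h ↦ absurd ?_ h))⟩
    · have hE : (runAll [] (runAll [.const 3 1] (inputState u v k))).edgeOutput m = ∅ := by
        simp [runAll, Instr.run, State.edgeOutput, inputState]
      rw [hE]
      exact ⟨by norm_num, hone hV, by simp [runAll, Instr.run, Instr.value, inputState]⟩
    · simp [Test.Holds, runAll, Instr.run, Instr.value, inputState]
  · have hI := isConnectedInput hV hG hl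
    have hm : 0 < m := by
      obtain ⟨h, hh, -⟩ := hI.conn {0} ⟨0, hn0, rfl⟩ ⟨1, hn, by simp⟩
      omega
    have : NeZero m := ⟨hm.ne'⟩
    refine ⟨_, halts_mainProg hI hn (by omega) (Nat.le_pow_clog (by norm_num) n) fun σ hσ ↦
      (hout hn0 hV hl (by omega) hσ).mono le_rfl fun τ hτ ↦ ⟨mainTime_le hn ?_, hτ⟩⟩
    obtain ⟨ord, tl, hS⟩ := hσ.searched
    exact hS.le_edges hn0 hV hl

/-- With a single vertex every edge is a loop. -/
theorem isMaximalForest_empty {G : Graph (Fin 1) (Fin m)} (hV : V(G) = Set.univ) (c : ℝ) :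
    IsMaximalForest (weightClass G w c) ∅ := by
  refine isMaximalForest_weightClass_iff.2 ⟨by simp, by simp, fun e _ x y _ ↦ ?_⟩
  obtain rfl := Subsingleton.elim x y
  exact .refl (by simp [hV])

theorem solvableInTime_forcing :
    SolvableInTime
      (fun G w S ↦ IsForcingSet (minSpanningTrees G w) S)
      (fun G w S ↦ IsForcingOutcome G w S)
      (fun n m ↦ m * Real.log n) := by
  refine solvableInTime_of_output (fun hV hG hS ↦ hS.isMinimumSet hV hG)
    (fun hV ↦ ⟨fun _ ↦ ∅, isMaximalForest_empty hV, by simp⟩) forcingOutputProg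
    fun {n m k B G u v w σ _} hn hV hl hB hσ ↦ ?_
  obtain ⟨ord, tl, hS⟩ := hσ.searched
  refine (halts_forcingOutputProg hσ.consts hσ.r2 hB hn rfl rfl rfl rfl (hσ.zero 2 (by norm_num))
    (hσ.zero 14 (by norm_num)) (fun f ↦ lt_of_tops hn hl hS hσ.tops)
    fun p ↦ apply_lt_of_tops hn hS hσ.tops).mono le_rfl fun τ hτ ↦ ⟨?_, hτ.2⟩
  exact isForcingOutcome_of_tops hn hV hl hS hσ.tops fun f ↦ by
    simpa [State.edgeOutput] using hτ.1 f

theorem solvableInTime_antiForcing :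
    SolvableInTime
      (fun G w S ↦ IsAntiForcingSet (minSpanningTrees G w) S)
      (fun G w S ↦ IsAntiForcingOutcome G w S)
      (fun n m ↦ m * Real.log n) := by
  refine solvableInTime_of_output (fun hV hG hS ↦ hS.isMinimumSet hV hG)
    (fun {m G w} hV ↦ ⟨fun _ ↦ ∅, isMaximalForest_empty hV, fun e ↦ ?_⟩) antiOutputProg
    fun {n m k B G u v w σ _} hn hV hl hB hσ ↦ ?_
  · simp only [Finset.notMem_empty, not_false_eq_true, true_and, false_iff, not_and, not_not]
    intro he
    obtain ⟨x, y, hxy⟩ := G.exists_isLink_of_mem_edgeSet he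
    rw [isLoop_weightClass_iff hxy]
    obtain rfl := Subsingleton.elim x y
    exact .refl (by simp [hV])
  · obtain ⟨ord, tl, hS⟩ := hσ.searched
    refine (halts_antiOutputProg hσ.consts hσ.r2 hB rfl rfl rfl (hσ.zero 2 (by norm_num))).mono
      (by omega) fun τ hτ ↦ ⟨?_, hτ.2⟩
    exact isAntiForcingOutcome_of_tops hn hV hl hS hσ.tops fun f ↦ by
      simpa [State.edgeOutput] using hτ.1 f

end Main

end ForcingMST

theorem mainTheorem3 :
    -- minimum forcing sets
    SolvableInTime
      (fun G w S ↦ IsForcingSet (minSpanningTrees G w) S)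
      (fun G w S ↦ IsForcingOutcome G w S)
      (fun n m ↦ m * Real.log n) ∧
    -- minimum anti-forcing sets
    SolvableInTime
      (fun G w S ↦ IsAntiForcingSet (minSpanningTrees G w) S)
      (fun G w S ↦ IsAntiForcingOutcome G w S)
      (fun n m ↦ m * Real.log n) ∧
    -- the two weight-class procedures are correct for every choice of the maximal forests
    (∀ (n m : ℕ) (G : Graph (Fin n) (Fin m)) (w : Fin m → ℝ) (S : Finset (Fin m)),
      V(G) = Set.univ → E(G) = Set.univ → Connected G →
        (IsForcingOutcome G w S → IsMinimumSet (IsForcingSet (minSpanningTrees G w)) S) ∧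
        (IsAntiForcingOutcome G w S →
          IsMinimumSet (IsAntiForcingSet (minSpanningTrees G w)) S)) := by
  exact ⟨solvableInTime_forcing, solvableInTime_antiForcing, fun _ _ _ _ _ hV _ hG ↦
    ⟨fun hS ↦ hS.isMinimumSet hV hG, fun hS ↦ hS.isMinimumSet hV hG⟩⟩
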